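/- Fix an infinite supply of symbols. An alphabet is a non-empty finite set of symbols; $V^*$ is the set of all words over $V$, $\lambda$ is the empty word. A language $L\subseteq V^*$ that is regular is, with respect to the alphabet $V$: finite ($\mathit{FIN}$) if it has finitely many words; monoidal ($\mathit{MON}$) if $L=V^*$; nilpotent ($\mathit{NIL}$) if $L$ or $V^*\setminus L$ is finite; combinational ($\mathit{COMB}$) if $L=V^*X$ for some $X\subseteq V$; definite ($\mathit{DEF}$) if $L=A\cup V^*B$ for finite $A,B\subseteq V^*$; symmetric definite ($\mathit{SYDEF}$) if $L=EV^*H$ for regular $E,H\subseteq V^*$; infix-closed ($\mathit{INF}$), prefix-closed ($\mathit{PRE}$), suffix-closed ($\mathit{SUF}$) if it contains all infixes, prefixes, suffixes, respectively, of its words; ordered ($\mathit{ORD}$) if it is accepted by a deterministic finite automaton with input alphabet $V$ whose state set carries a total order $\preceq$ such that $z\preceq z'$ implies $\delta(z,a)\preceq\delta(z',a)$ for all $a\in V$; commutative ($\mathit{COMM}$), circular ($\mathit{CIRC}$) if it contains with each word all its permutations, all its circular shifts, respectively; non-counting ($\mathit{NC}$) if there is $k\ge 1$ such that for all $x,y,z\in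 V^*$: $xy^kz\in L\iff xy^{k+1}z\in L$; power-separating ($\mathit{PS}$) if there is $m\ge 1$ such that for every $x\in V^*$ the set $\{x^n\mid n\ge m\}$ is disjoint from $L$ or contained in $L$; union-free ($\mathit{UF}$) if it is described by a regular expression over $V$ (with atoms $\emptyset$, $\lambda$ and the letters) built by concatenation and Kleene star only; a star language ($\mathit{STAR}$) if $L=H^*$ for a regular $H\subseteq V^*$; a left-sided, right-sided, two-sided comet ($\mathit{LCOM}$, $\mathit{RCOM}$, $\mathit{2COM}$) if $L=EG^*$, $L=G^*H$, $L=EG^*H$, respectively, with regular $E,G,H\subseteq V^*$ and $G\notin\{\emptyset,\{\lambda\}\}$. $\mathit{REG}$ is the family of all regular languages. A contextual grammar with selection in a family $F$ is a triple $(V,\mathcal S,A)$ with an alphabet $V$, a finite set $\mathcal S$ of pairs $(S,C)$, where $S$ is a language in $F$ with respect to some alphabet $U\subseteq V$ and $C$ is a finite set of contexts $(u,v)\in V^*\times V^*$ with $uv\ne\lambda$, and a finite set $A\subset V^*$ of axioms. In the internal mode, $x$ directly derives $y$ if $x=x_1x_2x_3$ and $y=x_1ux_2vx_3$ for some $(S,C)\in\mathcal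 S$ with $x_2\in S$ and some $(u,v)\in C$; the language generated is the set of all words derivable from axioms in finitely many (possibly zero) steps. $\mathcal{IC}(F)$ is the family of all languages generated in this way by contextual grammars with selection in $F$. Theorem. Consider the directed graph on the sixteen nodes $\mathit{MON}$, $\mathit{FIN}$, $\mathit{NIL}$, $\mathit{COMB}$, $\mathit{DEF}$, $\mathit{ORD}$, $\mathit{NC}$, $\mathit{PS}$, $\mathit{SYDEF}$, $\mathit{INF}$, $\mathit{PRE}$, $\mathit{SUF}$, $\mathit{STAR}$, $\mathit{COMM}$, $\mathit{CIRC}$, $\mathit{REG}$ with the arrows $\mathit{MON}\to\mathit{NIL}$, $\mathit{MON}\to\mathit{COMB}$, $\mathit{MON}\to\mathit{INF}$, $\mathit{MON}\to\mathit{STAR}$, $\mathit{MON}\to\mathit{COMM}$, $\mathit{FIN}\to\mathit{NIL}$, $\mathit{NIL}\to\mathit{DEF}$, $\mathit{COMB}\to\mathit{DEF}$, $\mathit{COMB}\to\mathit{SYDEF}$, $\mathit{DEF}\to\mathit{ORD}$, $\mathit{ORD}\to\mathit{NC}$, $\mathit{NC}\to\mathit{PS}$, $\mathit{SYDEF}\to\mathit{PS}$,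 $\mathit{INF}\to\mathit{PRE}$, $\mathit{INF}\to\mathit{SUF}$, $\mathit{PRE}\to\mathit{PS}$, $\mathit{SUF}\to\mathit{PS}$, $\mathit{COMM}\to\mathit{CIRC}$, $\mathit{PS}\to\mathit{REG}$, $\mathit{STAR}\to\mathit{REG}$, $\mathit{CIRC}\to\mathit{REG}$. If there is an arrow $X\to Y$, then $\mathcal{IC}(X)\subsetneq\mathcal{IC}(Y)$. If there is no directed path from $X$ to $Y$ and none from $Y$ to $X$ (paths of length $0$ allowed), then $\mathcal{IC}(X)$ and $\mathcal{IC}(Y)$ are incomparable, that is, neither contains the other. Moreover, $\mathcal{IC}(\mathit{REG})=\mathcal{IC}(\mathit{UF})=\mathcal{IC}(\mathit{LCOM})=\mathcal{IC}(\mathit{RCOM})=\mathcal{IC}(\mathit{2COM})$. In particular, $\mathcal{IC}(\mathit{INF})\subsetneq\mathcal{IC}(\mathit{PRE})$, $\mathcal{IC}(\mathit{SUF})\subsetneq\mathcal{IC}(\mathit{PS})$, and $\mathcal{IC}(\mathit{SUF})$ is incomparable to $\mathcal{IC}(\mathit{ORD})$ and to $\mathcal{IC}(\mathit{NC})$. 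-/

import Mathlib

open scoped Computability

namespace SubregularIC

universe u

variable {α : Type u}

/-! `α` is the (infinite) supply of symbols. An alphabet is a non-empty finite set of symbols,
a language over the alphabet `V` is a language contained in `V^*`. -/

/-- The language `V^*` of all words over the alphabet `V`. -/
def words (V : Finset α) : Language α := {w | ∀ a ∈ w, a ∈ V}

/-- `L` is a regular language over the alphabet `V`. (For `L ⊆ V^*` it makes no difference
whether the letters outside `V`, which may lead to a dead state, are fed to the automaton.) -/
def RegularOver (V : Finset α) (L : Language α) : Prop := L ≤ words V ∧ L.IsRegular

/-- A family of languages, where membership may depend on the alphabet `V` with respect to which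
the language `L` is considered: `F V L` says that `L` is in `F` with respect to `V`. -/
abbrev Family (α : Type u) := Finset α → Language α → Prop

/-- The power `x^n` of a word. -/
def wordPow (x : List α) (n : ℕ) : List α := (List.replicate n x).flatten

/-! ### Subregular families -/

/-- Regular languages. -/
def REG : Family α := fun V L => RegularOver V L

/-- Finite languages. -/
def FIN : Family α := fun V L => RegularOver V L ∧ {w | w ∈ L}.Finite

/-- Monoidal languages. -/
def MON : Family α := fun V L => RegularOver V L ∧ L = words V

/-- Nilpotent languages. -/
def NIL : Family α := fun V L =>
  RegularOver V L ∧ ({w | w ∈ L}.Finite ∨ {w | w ∈ words V ∧ w ∉ L}.Finite)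

/-- The letters of `X`, as words of length one. -/
def letters (X : Set α) : Language α := {w | ∃ a ∈ X, w = [a]}

/-- Combinational languages. -/
def COMB : Family α := fun V L =>
  RegularOver V L ∧ ∃ X : Set α, (∀ a ∈ X, a ∈ V) ∧
    L = words V * letters X

/-- Definite languages. -/
def DEF : Family α := fun V L =>
  RegularOver V L ∧ ∃ A B : Language α, A ≤ words V ∧ B ≤ words V ∧
    {w | w ∈ A}.Finite ∧ {w | w ∈ B}.Finite ∧ L = A + words V * B

/-- Symmetric definite languages. -/
def SYDEF : Family α := fun V L =>
  RegularOver V L ∧ ∃ E H : Language α, RegularOver V E ∧ RegularOver V H ∧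
    L = E * words V * H

/-- Infix-closed languages. -/
def INF : Family α := fun V L =>
  RegularOver V L ∧ ∀ x ∈ words V, ∀ y ∈ words V, ∀ z ∈ words V, x ++ y ++ z ∈ L → y ∈ L

/-- Prefix-closed languages. -/
def PRE : Family α := fun V L =>
  RegularOver V L ∧ ∀ x ∈ words V, ∀ y ∈ words V, x ++ y ∈ L → x ∈ L

/-- Suffix-closed languages. -/
def SUF : Family α := fun V L =>
  RegularOver V L ∧ ∀ x ∈ words V, ∀ y ∈ words V, x ++ y ∈ L → y ∈ L

/-- Ordered languages: those accepted by a deterministic finite automaton over `V` with a totally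
ordered set of states on which every letter of `V` acts monotonically. (The transitions of `M`
under letters outside `V` are irrelevant: only words over `V` are accepted.) -/
def ORD : Family α := fun V L =>
  RegularOver V L ∧ ∃ (σ : Type) (_ : Fintype σ) (_ : LinearOrder σ) (M : DFA α σ),
    (∀ a ∈ V, Monotone fun z => M.step z a) ∧ ∀ w, w ∈ L ↔ w ∈ words V ∧ w ∈ M.accepts

/-- Commutative languages. -/
def COMM : Family α := fun V L =>
  RegularOver V L ∧ ∀ w w' : List α, w ∈ L → w.Perm w' → w' ∈ L

/-- Circular languages. -/
def CIRC : Family α := fun V L =>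
  RegularOver V L ∧ ∀ x y : List α, x ++ y ∈ L → y ++ x ∈ L

/-- Non-counting languages. -/
def NC : Family α := fun V L =>
  RegularOver V L ∧ ∃ k : ℕ, 1 ≤ k ∧ ∀ x ∈ words V, ∀ y ∈ words V, ∀ z ∈ words V,
    (x ++ wordPow y k ++ z ∈ L ↔ x ++ wordPow y (k + 1) ++ z ∈ L)

/-- Power-separating languages. -/
def PS : Family α := fun V L =>
  RegularOver V L ∧ ∃ m : ℕ, 1 ≤ m ∧ ∀ x ∈ words V,
    (∀ n, m ≤ n → wordPow x n ∉ L) ∨ (∀ n, m ≤ n → wordPow x n ∈ L)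

/-- Regular expressions over `V` built without union, by concatenation and Kleene closure only
(from `∅`, `λ` and the letters of `V`). -/
inductive UnionFreeExpr (V : Finset α) : RegularExpression α → Prop
  | zero : UnionFreeExpr V RegularExpression.zero
  | epsilon : UnionFreeExpr V RegularExpression.epsilon
  | char (a : α) (ha : a ∈ V) : UnionFreeExpr V (RegularExpression.char a)
  | comp (r s : RegularExpression α) (hr : UnionFreeExpr V r) (hs : UnionFreeExpr V s) :
      UnionFreeExpr V (RegularExpression.comp r s)
  | star (r : RegularExpression α) (hr : UnionFreeExpr V r) :
      UnionFreeExpr V (RegularExpression.star r)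

/-- Union-free languages. -/
def UF : Family α := fun V L =>
  RegularOver V L ∧ ∃ r : RegularExpression α, UnionFreeExpr V r ∧ L = r.matches'

/-- Star languages. -/
def STAR : Family α := fun V L =>
  RegularOver V L ∧ ∃ H : Language α, RegularOver V H ∧ L = H∗

/-- Left-sided comet languages. (`0` is the empty language, `1` is `{λ}`.) -/
def LCOM : Family α := fun V L =>
  RegularOver V L ∧ ∃ E G : Language α, RegularOver V E ∧ RegularOver V G ∧
    G ≠ 0 ∧ G ≠ 1 ∧ L = E * G∗

/-- Right-sided comet languages. -/
def RCOM : Family α := fun V L =>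
  RegularOver V L ∧ ∃ G H : Language α, RegularOver V G ∧ RegularOver V H ∧
    G ≠ 0 ∧ G ≠ 1 ∧ L = G∗ * H

/-- Two-sided comet languages. -/
def TCOM : Family α := fun V L =>
  RegularOver V L ∧ ∃ E G H : Language α, RegularOver V E ∧ RegularOver V G ∧ RegularOver V H ∧
    G ≠ 0 ∧ G ≠ 1 ∧ L = E * G∗ * H

/-! ### Contextual grammars -/

/-- A contextual grammar `(V, 𝒮, A)`: an alphabet, a finite set of selection pairs `(S, C)`, each
consisting of a selection language and a finite set of contexts, and a finite set `A` of initial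
words over `V`. -/
structure ContextualGrammar (α : Type u) where
  alphabet : Finset α
  alphabet_nonempty : alphabet.Nonempty
  selections : Set (Language α × Set (List α × List α))
  selections_finite : selections.Finite
  contexts_finite : ∀ p ∈ selections, p.2.Finite
  contexts_over : ∀ p ∈ selections, ∀ c ∈ p.2, c.1 ∈ words alphabet ∧ c.2 ∈ words alphabet
  contexts_ne : ∀ p ∈ selections, ∀ c ∈ p.2, c.1 ++ c.2 ≠ []
  initial : Set (List α)
  initial_finite : initial.Finite
  initial_over : ∀ w ∈ initial, w ∈ words alphabet

namespace ContextualGrammar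

/-- Every selection language of `G` is in the family `F` with respect to some alphabet `U ⊆ V`. -/
def SelectionIn (G : ContextualGrammar α) (F : Family α) : Prop :=
  ∀ p ∈ G.selections, ∃ U : Finset α, U.Nonempty ∧ U ⊆ G.alphabet ∧ F U p.1

/-- The direct internal derivation step `x ⟹ y`. -/
def InStep (G : ContextualGrammar α) (x y : List α) : Prop :=
  ∃ x₁ x₂ x₃ : List α, x = x₁ ++ x₂ ++ x₃ ∧
    ∃ p ∈ G.selections, x₂ ∈ p.1 ∧ ∃ c ∈ p.2, y = x₁ ++ c.1 ++ x₂ ++ c.2 ++ x₃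

/-- The language generated by `G` in the internal mode. -/
def inLanguage (G : ContextualGrammar α) : Language α :=
  {z | ∃ x ∈ G.initial, Relation.ReflTransGen G.InStep x z}

end ContextualGrammar

/-- The family of all languages generated internally by contextual grammars with selection
in `F`. -/
def IC (F : Family α) : Set (Language α) :=
  {L | ∃ G : ContextualGrammar α, G.SelectionIn F ∧ G.inLanguage = L}

/-- Two families of languages are incomparable if neither is contained in the other. -/
def Incomparable (X Y : Set (Language α)) : Prop := ¬ X ⊆ Y ∧ ¬ Y ⊆ X

/-! ### The diagram -/

/-- The nodes of the diagram. -/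
inductive Node
  | MON | FIN | NIL | COMB | DEF | ORD | NC | PS | SYDEF | INF | PRE | SUF | STAR | COMM | CIRC
  | REG

/-- The family of selection languages belonging to a node. -/
def Node.family : Node → Family α
  | .MON => SubregularIC.MON
  | .FIN => SubregularIC.FIN
  | .NIL => SubregularIC.NIL
  | .COMB => SubregularIC.COMB
  | .DEF => SubregularIC.DEF
  | .ORD => SubregularIC.ORD
  | .NC => SubregularIC.NC
  | .PS => SubregularIC.PS
  | .SYDEF => SubregularIC.SYDEF
  | .INF => SubregularIC.INF
  | .PRE => SubregularIC.PRE
  | .SUF => SubregularIC.SUF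
  | .STAR => SubregularIC.STAR
  | .COMM => SubregularIC.COMM
  | .CIRC => SubregularIC.CIRC
  | .REG => SubregularIC.REG

/-- The arrows of the diagram. -/
inductive Arrow : Node → Node → Prop
  | mon_nil : Arrow .MON .NIL
  | mon_comb : Arrow .MON .COMB
  | mon_inf : Arrow .MON .INF
  | mon_star : Arrow .MON .STAR
  | mon_comm : Arrow .MON .COMM
  | fin_nil : Arrow .FIN .NIL
  | nil_def : Arrow .NIL .DEF
  | comb_def : Arrow .COMB .DEF
  | comb_sydef : Arrow .COMB .SYDEF
  | def_ord : Arrow .DEF .ORD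
  | ord_nc : Arrow .ORD .NC
  | nc_ps : Arrow .NC .PS
  | sydef_ps : Arrow .SYDEF .PS
  | inf_pre : Arrow .INF .PRE
  | inf_suf : Arrow .INF .SUF
  | pre_ps : Arrow .PRE .PS
  | suf_ps : Arrow .SUF .PS
  | comm_circ : Arrow .COMM .CIRC
  | ps_reg : Arrow .PS .REG
  | star_reg : Arrow .STAR .REG
  | circ_reg : Arrow .CIRC .REG

/-- There is a directed path (possibly of length zero) from `X` to `Y` in the diagram. -/
def Path : Node → Node → Prop := Relation.ReflTransGen Arrow

end SubregularIC

/-!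
All inclusions along the arrows but one hold because a family of languages is contained in the next
one with respect to the same alphabet. The ones that need an idea are `DEF.ord` (a definite
language is accepted by the automaton that stores a bounded suffix, with the lexicographic order on
the reversed suffixes), `ORD.nc` (orbits of monotone maps on a finite chain are eventually
constant), and `PS_of_forall_exists` (for a regular language, the bound in the definition of power
separation may depend on the word). The arrow from `MON` to `COMB` is different, since `V^*` is not
combinational; there, contexts around the empty word are simulated by inserting the whole context
next to a non-empty word (`IC_mon_or_comb_subset`).

The equalities at the top node rest on `IC_subset_of_cover`: only the words over the alphabet of the
grammar matter. A comet is obtained by padding a regular language with powers of a fresh letter, and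
by Kleene's theorem together with `(L + K)∗ = (L∗ * K∗)∗` a regular language is a finite union of
union-free languages (`REG.isUnionOfUnionFree`), among which a selection pair can be distributed.

The non-inclusions come in two kinds. For most of them, a selection language `S` is turned into a
language generated by a grammar that builds words `c^n w d^n`, where `n` is the number of letters
added to `w` so far, and that may surround a word `w ∈ S` by `p` and `q`. The counters `c^n` and
`d^n` force every grammar that generates this language to insert `p` and `q` in one step around a
factor of `w` that misses only a bounded part of `w` at both ends, so its selection languages
inherit the power to test membership in `S` (`exists_selection_of_snapshot`). Each separation is
then a pumping or closure argument for a single language `S`.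

This does not work with finite selection, since `V^*` is then not available. Separations from `FIN`
use special grammars: `a^*b` for families in which non-empty languages contain the empty word
(`not_mem_IC_of_nil_mem`, which serves for `COMB` as well), `a^n b^n` and `b^n a^n` for circular
selection (`not_IC_FIN_subset_CIRC`), and a language whose words contain squares `x₂x₂` of the words that a
selection language has to contain (`not_IC_FIN_subset_SYDEF`).

Finally, it suffices to separate each node from the maximal nodes that it does not reach
(`path_or_exists_separator`, `not_IC_subset_of_mem_separators`).
-/

namespace SubregularIC

universe u

variable {α : Type u}

/-! ### Regular languages -/

theorem mem_words {V : Finset α} {w : List α} : w ∈ words V ↔ ∀ a ∈ w, a ∈ V := Iff.rfl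

@[simp] theorem nil_mem_words (V : Finset α) : [] ∈ words V := by simp [mem_words]

@[simp] theorem cons_mem_words {V : Finset α} {a : α} {w : List α} :
    a :: w ∈ words V ↔ a ∈ V ∧ w ∈ words V := by simp [mem_words]

@[simp] theorem append_mem_words {V : Finset α} {x y : List α} :
    x ++ y ∈ words V ↔ x ∈ words V ∧ y ∈ words V := by
  simp [mem_words, or_imp, forall_and]

theorem words_mono {U V : Finset α} (h : U ⊆ V) : words U ≤ words V :=
  fun _ hw a ha => h (hw a ha)

theorem replicate_mem_words {V : Finset α} {a : α} (h : a ∈ V) (n : ℕ) :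
    List.replicate n a ∈ words V := fun _ hb => List.eq_of_mem_replicate hb ▸ h

theorem mul_le_words {V : Finset α} {L K : Language α} (hL : L ≤ words V) (hK : K ≤ words V) :
    L * K ≤ words V := by
  rintro _ ⟨x, hx, y, hy, rfl⟩
  exact append_mem_words.2 ⟨hL hx, hK hy⟩

theorem kstar_le_words {V : Finset α} {L : Language α} (hL : L ≤ words V) : L∗ ≤ words V := by
  rintro _ ⟨l, rfl, hl⟩ a ha
  obtain ⟨y, hy, hay⟩ := List.mem_flatten.1 ha
  exact hL (hl y hy) a hay

/-- A quotient of a product by `x` is determined by the quotient of the first factor by `x` and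
by the set of the quotients of the second factor by the possible rests of `x`. -/
theorem isRegular_mul {L K : Language α} (hL : L.IsRegular) (hK : K.IsRegular) :
    (L * K).IsRegular := by
  apply Language.IsRegular.of_finite_range_leftQuotient
  have fL := hL.finite_range_leftQuotient
  have fK := hK.finite_range_leftQuotient
  let F : Language α × Set (Language α) → Language α :=
    fun p => p.1 * K + (show Language α from {w | ∃ Q ∈ p.2, w ∈ Q})
  refine ((fL.prod fK.finite_subsets).image F).subset ?_
  rintro _ ⟨x, rfl⟩
  refine ⟨(L.leftQuotient x, {Q | ∃ u v, u ++ v = x ∧ u ∈ L ∧ Q = K.leftQuotient v}),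
    ⟨⟨x, rfl⟩, ?_⟩, ?_⟩
  · rintro _ ⟨u, v, -, -, rfl⟩
    exact ⟨v, rfl⟩
  · ext y
    constructor
    · rintro (⟨s, hs, t, ht, rfl⟩ | ⟨_, ⟨u, v, rfl, hu, rfl⟩, hv⟩)
      · exact ⟨x ++ s, hs, t, ht, by simp⟩
      · exact ⟨u, hu, v ++ y, hv, by simp⟩
    · rintro ⟨s, hs, t, ht, hst⟩
      rcases List.append_eq_append_iff.1 hst with ⟨r, rfl, rfl⟩ | ⟨r, rfl, rfl⟩
      · exact Or.inr ⟨_, ⟨s, r, rfl, hs, rfl⟩, ht⟩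
      · exact Or.inl ⟨r, hs, t, ht, rfl⟩

/-- The factor of `x ++ y` that covers the end of `x` splits into a suffix `v` of `x` and a prefix
of `y`; it may end with `x`. -/
theorem exists_split_of_append_mem_kstar {L : Language α} {x y : List α} (hx : x ≠ [])
    (h : x ++ y ∈ L∗) : ∃ u v, u ++ v = x ∧ u ∈ L∗ ∧ y ∈ L.leftQuotient v * L∗ := by
  obtain ⟨l, hl, hmem⟩ := h
  induction l generalizing x with
  | nil => simp at hl; exact absurd hl.1 hx
  | cons w l ih =>
    simp only [List.flatten_cons] at hl
    have hw := hmem w (by simp)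
    have hl' : ∀ y ∈ l, y ∈ L := fun y hy => hmem y (by simp [hy])
    rcases List.append_eq_append_iff.1 hl with ⟨t, rfl, rfl⟩ | ⟨t, rfl, h2⟩
    · exact ⟨[], x, rfl, Language.nil_mem_kstar _, t, hw, _, ⟨l, rfl, hl'⟩, rfl⟩
    · rcases eq_or_ne t [] with rfl | ht
      · refine ⟨[], w ++ [], rfl, Language.nil_mem_kstar _, [], ?_, y,
          ⟨l, by simpa using h2.symm, hl'⟩, rfl⟩
        change (w ++ []) ++ [] ∈ L
        simpa using hw
      · obtain ⟨u, v, rfl, hu, hy⟩ := ih ht h2.symm hl'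
        obtain ⟨m, rfl, hm⟩ := hu
        refine ⟨w ++ m.flatten, v, by simp, ⟨w :: m, by simp, ?_⟩, hy⟩
        simpa [hw] using hm

/-- For `x ≠ []`, the quotient of `L∗` by `x` is determined by the set of the quotients of `L` by
the rests `v` of `x` behind a prefix in `L∗`. -/
theorem isRegular_kstar {L : Language α} (hL : L.IsRegular) : (L∗).IsRegular := by
  apply Language.IsRegular.of_finite_range_leftQuotient
  have fL := hL.finite_range_leftQuotient
  let F : Set (Language α) → Language α := fun p => {w | ∃ Q ∈ p, w ∈ Q * L∗}
  refine ((fL.finite_subsets.image F).insert L∗).subset ?_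
  rintro _ ⟨x, rfl⟩
  rcases eq_or_ne x [] with rfl | hx
  · exact Or.inl (by simp)
  refine Or.inr ⟨{Q | ∃ u v, u ++ v = x ∧ u ∈ L∗ ∧ Q = L.leftQuotient v}, ?_, ?_⟩
  · rintro _ ⟨u, v, -, -, rfl⟩
    exact ⟨v, rfl⟩
  · ext y
    constructor
    · rintro ⟨_, ⟨u, v, rfl, hu, rfl⟩, s, hs, t, ht, rfl⟩
      change _ ∈ L∗
      obtain ⟨m, rfl, hm⟩ := hu
      obtain ⟨n, rfl, hn⟩ := ht
      refine ⟨m ++ (v ++ s) :: n, by simp, ?_⟩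
      intro z hz
      rcases List.mem_append.1 hz with h | h
      · exact hm z h
      · rcases List.mem_cons.1 h with rfl | h
        · exact hs
        · exact hn z h
    · intro h
      obtain ⟨u, v, huv, hu, hy⟩ := exists_split_of_append_mem_kstar hx h
      exact ⟨_, ⟨u, v, huv, hu, rfl⟩, hy⟩

theorem isRegular_zero : (0 : Language α).IsRegular :=
  ⟨Unit, inferInstance, ⟨fun _ _ => (), (), ∅⟩, by ext; simp [DFA.mem_accepts]⟩

theorem isRegular_top : (⊤ : Language α).IsRegular := by
  have h := (isRegular_zero (α := α)).compl
  convert h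
  ext w
  exact ⟨fun _ => Language.notMem_zero w, fun _ => trivial⟩

theorem isRegular_singleton (w : List α) : ({w} : Language α).IsRegular := by
  apply Language.IsRegular.of_finite_range_leftQuotient
  refine (((List.finite_toSet (w.tails)).image
    fun t => ({t} : Language α)).insert 0).subset ?_
  rintro _ ⟨x, rfl⟩
  by_cases h : ∃ t, x ++ t = w
  · obtain ⟨t, rfl⟩ := h
    refine Or.inr ⟨t, by simp, ?_⟩
    ext y
    change y = t ↔ x ++ y = x ++ t
    simp
  · refine Or.inl ?_
    ext y
    exact ⟨fun hy => (h ⟨y, hy⟩).elim, fun hy => (Language.notMem_zero _ hy).elim⟩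

theorem isRegular_of_finite {L : Language α} (h : {w | w ∈ L}.Finite) : L.IsRegular := by
  have key : ∀ s : Set (List α), s.Finite → Language.IsRegular (T := α) s := by
    intro s hs
    induction s, hs using Set.Finite.induction_on with
    | empty => exact isRegular_zero
    | insert _ _ ih => exact (isRegular_singleton _).add ih
  exact key _ h

theorem mem_letters_singleton {a : α} : letters {a} = ({[a]} : Language α) := by
  ext w
  exact ⟨fun ⟨b, hb, h⟩ => by rw [h, Set.mem_singleton_iff.1 hb]; rfl, fun h => ⟨a, rfl, h⟩⟩

theorem letters_finite {V : Finset α} {X : Set α} (h : ∀ a ∈ X, a ∈ V) :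
    {w | w ∈ letters X}.Finite := by
  refine ((V.finite_toSet.subset h).image fun a => [a]).subset ?_
  rintro _ ⟨a, ha, rfl⟩
  exact ⟨a, ha, rfl⟩

theorem words_eq_kstar (V : Finset α) : words V = (letters (V : Set α))∗ := by
  ext w
  constructor
  · intro h
    refine ⟨w.map fun a => [a], by rw [← List.flatMap_def]; simp, ?_⟩
    intro y hy
    obtain ⟨a, ha, rfl⟩ := List.mem_map.1 hy
    exact ⟨a, h a ha, rfl⟩
  · refine fun h => kstar_le_words ?_ h
    rintro _ ⟨a, ha, rfl⟩
    exact fun b hb => List.mem_singleton.1 hb ▸ ha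

theorem isRegular_words (V : Finset α) : (words V).IsRegular := by
  rw [words_eq_kstar]
  exact isRegular_kstar (isRegular_of_finite (letters_finite fun _ h => h))

theorem finite_words_length_le (V : Finset α) (n : ℕ) :
    {w | w ∈ words V ∧ w.length ≤ n}.Finite := by
  induction n with
  | zero => exact (Set.finite_singleton []).subset fun w hw => by simpa using hw.2
  | succ n ih =>
    refine (((V.finite_toSet.prod ih).image fun p => p.1 :: p.2).insert []).subset ?_
    rintro (_ | ⟨a, w⟩) ⟨hw, hn⟩
    · exact Or.inl rfl
    · exact Or.inr ⟨(a, w), ⟨hw a (by simp), fun b hb => hw b (by simp [hb]),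
        by simpa using hn⟩, rfl⟩

theorem exists_length_bound {s : Set (List α)} (h : s.Finite) :
    ∃ n, ∀ w ∈ s, w.length ≤ n := by
  obtain ⟨n, hn⟩ := (h.image List.length).bddAbove
  exact ⟨n, fun w hw => hn ⟨w, hw, rfl⟩⟩

namespace RegularOver

variable {V : Finset α} {L K : Language α}

theorem words (V : Finset α) : RegularOver V (words V) := ⟨le_rfl, isRegular_words V⟩

theorem zero : RegularOver V 0 := ⟨bot_le, isRegular_zero⟩

theorem singleton {w : List α} (h : w ∈ SubregularIC.words V) : RegularOver V {w} :=
  ⟨fun x hx => by rw [show x = w from hx]; exact h, isRegular_singleton w⟩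

theorem one : RegularOver V 1 := singleton (nil_mem_words V)

theorem mul (hL : RegularOver V L) (hK : RegularOver V K) : RegularOver V (L * K) :=
  ⟨mul_le_words hL.1 hK.1, isRegular_mul hL.2 hK.2⟩

theorem kstar (hL : RegularOver V L) : RegularOver V L∗ :=
  ⟨kstar_le_words hL.1, isRegular_kstar hL.2⟩

theorem inf_words (hL : L.IsRegular) : RegularOver V (SubregularIC.words V ⊓ L) :=
  ⟨inf_le_left, (isRegular_words V).inf hL⟩

theorem mono {U : Finset α} (h : U ⊆ V) (hL : RegularOver U L) : RegularOver V L :=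
  ⟨hL.1.trans (words_mono h), hL.2⟩

theorem of_finite (h : L ≤ SubregularIC.words V) (hf : {w | w ∈ L}.Finite) : RegularOver V L :=
  ⟨h, isRegular_of_finite hf⟩

end RegularOver

/-! ### Changing the selection languages of a grammar -/

theorem ContextualGrammar.InStep.mem_words {G : ContextualGrammar α} {x y : List α}
    (h : G.InStep x y) (hx : x ∈ words G.alphabet) : y ∈ words G.alphabet := by
  obtain ⟨x₁, x₂, x₃, rfl, p, hp, -, c, hc, rfl⟩ := h
  have := G.contexts_over p hp c hc
  simp only [append_mem_words] at hx ⊢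
  tauto

theorem ContextualGrammar.mem_words_of_mem_inLanguage {G : ContextualGrammar α} {z : List α}
    (h : z ∈ G.inLanguage) : z ∈ words G.alphabet := by
  obtain ⟨x, hx, hz⟩ := h
  induction hz with
  | refl => exact G.initial_over x hx
  | tail _ h ih => exact h.mem_words ih

theorem ContextualGrammar.inLanguage_le_of_step {G G' : ContextualGrammar α}
    (h₀ : G.initial ⊆ G'.initial)
    (h : ∀ x ∈ words G.alphabet, ∀ y, G.InStep x y → G'.InStep x y) :
    G.inLanguage ≤ G'.inLanguage := by
  rintro z ⟨x, hx, hz⟩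
  have key : z ∈ words G.alphabet ∧ Relation.ReflTransGen G'.InStep x z := by
    induction hz with
    | refl => exact ⟨G.initial_over x hx, .refl⟩
    | tail _ hs ih => exact ⟨hs.mem_words ih.1, ih.2.tail (h _ ih.1 _ hs)⟩
  exact ⟨x, h₀ hx, key.2⟩

/-- Only the words over the alphabet `V` of a grammar matter as words selected. Hence a selection
language may be replaced by finitely many languages whose union has the same words over `V`, and
these may use an alphabet larger than `V`. -/
theorem IC_subset_of_cover {F F' : Family α} (E : Finset α → Finset α) (hE : ∀ V, V ⊆ E V)
    (h : ∀ (V U : Finset α) (S : Language α), U.Nonempty → U ⊆ V → F U S →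
      ∃ 𝒯 : Set (Language α), 𝒯.Finite ∧
        (∀ T ∈ 𝒯, ∃ U' : Finset α, U'.Nonempty ∧ U' ⊆ E V ∧ F' U' T) ∧
        ∀ x ∈ words V, x ∈ S ↔ ∃ T ∈ 𝒯, x ∈ T) :
    IC F ⊆ IC F' := by
  rintro _ ⟨G, hG, rfl⟩
  have h' : ∀ p ∈ G.selections, ∃ 𝒯 : Set (Language α), 𝒯.Finite ∧
      (∀ T ∈ 𝒯, ∃ U' : Finset α, U'.Nonempty ∧ U' ⊆ E G.alphabet ∧ F' U' T) ∧
        ∀ x ∈ words G.alphabet, x ∈ p.1 ↔ ∃ T ∈ 𝒯, x ∈ T := by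
    intro p hp
    obtain ⟨U, hU, hUV, hF⟩ := hG p hp
    exact h _ U p.1 hU hUV hF
  choose! 𝒯 hfin hF' hmem using h'
  have hmono : words G.alphabet ≤ words (E G.alphabet) := words_mono (hE _)
  let G' : ContextualGrammar α :=
    { alphabet := E G.alphabet
      alphabet_nonempty := G.alphabet_nonempty.mono (hE _)
      selections := ⋃ p ∈ G.selections, (fun T => (T, p.2)) '' 𝒯 p
      selections_finite := G.selections_finite.biUnion fun p hp => (hfin p hp).image _
      contexts_finite := by
        simp only [Set.mem_iUnion]
        rintro _ ⟨p, hp, T, -, rfl⟩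
        exact G.contexts_finite p hp
      contexts_over := by
        simp only [Set.mem_iUnion]
        rintro _ ⟨p, hp, T, -, rfl⟩ c hc
        exact ⟨hmono (G.contexts_over p hp c hc).1, hmono (G.contexts_over p hp c hc).2⟩
      contexts_ne := by
        simp only [Set.mem_iUnion]
        rintro _ ⟨p, hp, T, -, rfl⟩
        exact G.contexts_ne p hp
      initial := G.initial
      initial_finite := G.initial_finite
      initial_over := fun w hw => hmono (G.initial_over w hw) }
  have hstep : ∀ x ∈ words G.alphabet, ∀ y, G'.InStep x y ↔ G.InStep x y := by
    intro x hx y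
    constructor
    · rintro ⟨x₁, x₂, x₃, rfl, q, hq, hx₂, c, hc, rfl⟩
      obtain ⟨p, hp, T, hT, rfl⟩ := by simpa only [G', Set.mem_iUnion, exists_prop] using hq
      simp only [append_mem_words] at hx
      exact ⟨x₁, x₂, x₃, rfl, p, hp, (hmem p hp x₂ hx.1.2).2 ⟨T, hT, hx₂⟩, c, hc, rfl⟩
    · rintro ⟨x₁, x₂, x₃, rfl, p, hp, hx₂, c, hc, rfl⟩
      simp only [append_mem_words] at hx
      obtain ⟨T, hT, hxT⟩ := (hmem p hp x₂ hx.1.2).1 hx₂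
      refine ⟨x₁, x₂, x₃, rfl, (T, p.2), ?_, hxT, c, hc, rfl⟩
      simp only [G', Set.mem_iUnion]
      exact ⟨p, hp, T, hT, rfl⟩
  refine ⟨G', ?_, le_antisymm ?_ ?_⟩
  · intro q hq
    obtain ⟨p, hp, T, hT, rfl⟩ := by simpa only [G', Set.mem_iUnion, exists_prop] using hq
    exact hF' p hp T hT
  · rintro z ⟨x, hx, hz⟩
    have key : z ∈ words G.alphabet ∧ Relation.ReflTransGen G.InStep x z := by
      induction hz with
      | refl => exact ⟨G.initial_over x hx, .refl⟩
      | tail _ hs ih =>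
        have hs' := (hstep _ ih.1 _).1 hs
        exact ⟨hs'.mem_words ih.1, ih.2.tail hs'⟩
    exact ⟨x, hx, key.2⟩
  · exact ContextualGrammar.inLanguage_le_of_step subset_rfl fun x hx y => (hstep x hx y).2

theorem IC_mono {F F' : Family α} (h : ∀ V L, V.Nonempty → F V L → F' V L) : IC F ⊆ IC F' :=
  IC_subset_of_cover id (fun _ => subset_rfl) fun _ U S hU hUV hS =>
    ⟨{S}, Set.finite_singleton S, fun _ hT => hT ▸ ⟨U, hU, hUV, h U S hU hS⟩, by simp⟩

/-! ### Powers of words -/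

@[simp] theorem wordPow_zero (x : List α) : wordPow x 0 = [] := rfl

theorem wordPow_succ (x : List α) (n : ℕ) : wordPow x (n + 1) = x ++ wordPow x n := by
  simp [wordPow, List.replicate_succ]

theorem wordPow_one (x : List α) : wordPow x 1 = x := by simp [wordPow_succ]

theorem wordPow_add (x : List α) (m n : ℕ) : wordPow x (m + n) = wordPow x m ++ wordPow x n := by
  rw [wordPow, List.replicate_add, List.flatten_append]; rfl

theorem wordPow_singleton (a : α) (n : ℕ) : wordPow [a] n = List.replicate n a := by
  induction n with
  | zero => rfl
  | succ n ih => rw [wordPow_succ, ih]; rfl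

@[simp] theorem length_wordPow (x : List α) (n : ℕ) : (wordPow x n).length = n * x.length := by
  simp [wordPow]

theorem wordPow_mem_words {V : Finset α} {x : List α} (h : x ∈ words V) (n : ℕ) :
    wordPow x n ∈ words V := by
  induction n with
  | zero => simp
  | succ n ih => rw [wordPow_succ]; exact append_mem_words.2 ⟨h, ih⟩

theorem wordPow_mem_kstar {L : Language α} {x : List α} (h : x ∈ L) (n : ℕ) :
    wordPow x n ∈ L∗ := ⟨List.replicate n x, rfl, fun _ hy => List.eq_of_mem_replicate hy ▸ h⟩

theorem evalFrom_wordPow {σ : Type*} (M : DFA α σ) (q : σ) (x : List α) (n : ℕ) :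
    M.evalFrom q (wordPow x n) = (fun z => M.evalFrom z x)^[n] q := by
  induction n generalizing q with
  | zero => rfl
  | succ n ih => rw [wordPow_succ, DFA.evalFrom_of_append, ih]; rfl

/-! ### Inclusions between families of languages -/

theorem exists_iterate_eq {σ : Type*} [Fintype σ] (f : σ → σ) (z : σ) :
    ∃ i j, i < j ∧ j ≤ Fintype.card σ ∧ f^[i] z = f^[j] z := by
  obtain ⟨i, j, hij, h⟩ := Fintype.exists_ne_map_eq_of_card_lt
    (fun i : Fin (Fintype.card σ + 1) => f^[i] z) (by simp)
  rcases lt_or_gt_of_ne hij with hlt | hlt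
  · exact ⟨i, j, hlt, Nat.lt_succ_iff.1 j.2, h⟩
  · exact ⟨j, i, hlt, Nat.lt_succ_iff.1 i.2, h.symm⟩

/-- The orbits of a monotone self-map of a finite chain are eventually constant. -/
theorem Monotone.iterate_succ_eq {σ : Type*} [Fintype σ] [LinearOrder σ] {f : σ → σ}
    (hf : Monotone f) (z : σ) {n : ℕ} (hn : Fintype.card σ ≤ n) : f^[n + 1] z = f^[n] z := by
  obtain ⟨i, j, hij, hj, h⟩ := exists_iterate_eq f z
  have hi : f^[i + 1] z = f^[i] z := by
    rcases le_total z (f z) with hz | hz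
    · have hm := hf.monotone_iterate_of_le_map hz
      exact le_antisymm (h ▸ hm (by omega : i + 1 ≤ j)) (hm (Nat.le_succ i))
    · have hm := hf.antitone_iterate_of_map_le hz
      exact le_antisymm (hm (Nat.le_succ i)) (h ▸ hm (by omega : i + 1 ≤ j))
  obtain ⟨k, rfl⟩ := Nat.exists_eq_add_of_le (show i ≤ n by omega)
  rw [show i + k + 1 = k + (i + 1) by omega, Function.iterate_add_apply, hi,
    ← Function.iterate_add_apply, Nat.add_comm]

/-- For a regular language the bound in the definition of power-separating languages may depend on
the word: the powers of a word pass through a cycle of states from an exponent on that is bounded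
by the number of states. -/
theorem PS_of_forall_exists {V : Finset α} {L : Language α} (hL : RegularOver V L)
    (h : ∀ x ∈ words V, ∃ m, (∀ n, m ≤ n → wordPow x n ∉ L) ∨ (∀ n, m ≤ n → wordPow x n ∈ L)) :
    PS V L := by
  refine ⟨hL, ?_⟩
  obtain ⟨σ, _, M, rfl⟩ := hL.2
  refine ⟨Fintype.card σ, Fintype.card_pos_iff.2 ⟨M.start⟩, fun x hx => ?_⟩
  obtain ⟨i, j, hij, hj, hf⟩ := exists_iterate_eq (fun z => M.evalFrom z x) M.start
  set f : σ → σ := fun z => M.evalFrom z x with hfdef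
  have hper : ∀ t n, i ≤ n → f^[n + t * (j - i)] M.start = f^[n] M.start := by
    intro t n hn
    induction t with
    | zero => simp
    | succ t ih =>
      rw [← ih, Nat.succ_mul, show n + (t * (j - i) + (j - i)) = n + t * (j - i) - i + j by grind,
        Function.iterate_add_apply, ← hf, ← Function.iterate_add_apply]
      rw [Nat.sub_add_cancel (by omega)]
  have hmem : ∀ t n, i ≤ n →
      (wordPow x (n + t * (j - i)) ∈ M.accepts ↔ wordPow x n ∈ M.accepts) := by
    intro t n hn
    change M.evalFrom M.start _ ∈ M.accept ↔ M.evalFrom M.start _ ∈ M.accept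
    rw [evalFrom_wordPow, evalFrom_wordPow, ← hfdef, hper t n hn]
  obtain ⟨m, hm⟩ := h x hx
  have hle : ∀ n, m ≤ n + m * (j - i) := fun n => by
    have : m * 1 ≤ m * (j - i) := Nat.mul_le_mul_left _ (by omega)
    omega
  exact hm.imp
    (fun hm n hn hmemn => hm _ (hle n) ((hmem m n (by omega)).2 hmemn))
    (fun hm n hn => (hmem m n (by omega)).1 (hm _ (hle n)))

theorem MON_words (V : Finset α) : MON V (words V) := ⟨.words V, rfl⟩

theorem MON.nil {V : Finset α} {L : Language α} (h : MON V L) : NIL V L := by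
  obtain ⟨h, rfl⟩ := h
  refine ⟨h, Or.inr ?_⟩
  convert Set.finite_empty (α := List α)
  ext; simp

theorem MON.inf {V : Finset α} {L : Language α} (h : MON V L) : INF V L := by
  obtain ⟨h, rfl⟩ := h
  exact ⟨h, fun _ _ _ hy _ _ _ => hy⟩

theorem MON.star {V : Finset α} {L : Language α} (h : MON V L) : STAR V L := by
  obtain ⟨h, rfl⟩ := h
  refine ⟨h, letters (V : Set α), .of_finite ?_ (letters_finite fun _ h => h), words_eq_kstar V⟩
  rintro _ ⟨a, ha, rfl⟩
  exact cons_mem_words.2 ⟨ha, nil_mem_words V⟩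

theorem MON.comm {V : Finset α} {L : Language α} (h : MON V L) : COMM V L := by
  obtain ⟨h, rfl⟩ := h
  exact ⟨h, fun w w' hw hp a ha => hw a (hp.mem_iff.2 ha)⟩

theorem FIN.nil {V : Finset α} {L : Language α} (h : FIN V L) : NIL V L := ⟨h.1, Or.inl h.2⟩

theorem NIL.def {V : Finset α} {L : Language α} (h : NIL V L) : DEF V L := by
  refine ⟨h.1, ?_⟩
  rcases h.2 with hf | hf
  · refine ⟨L, 0, h.1.1, bot_le, hf, Set.finite_empty, by simp⟩
  obtain ⟨n, hn⟩ := exists_length_bound hf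
  refine ⟨{w | w ∈ L ∧ w.length ≤ n}, {w | w ∈ words V ∧ w.length = n + 1},
    fun w hw => h.1.1 hw.1, fun w hw => hw.1,
    (finite_words_length_le V n).subset fun w hw => ⟨h.1.1 hw.1, hw.2⟩,
    (finite_words_length_le V (n + 1)).subset fun w hw => ⟨hw.1, hw.2.le⟩, ?_⟩
  ext w
  constructor
  · intro hw
    rcases le_or_gt w.length n with hl | hl
    · exact Or.inl ⟨hw, hl⟩
    · have hwV : w ∈ words V := h.1.1 hw
      rw [← List.take_append_drop (w.length - (n + 1)) w, append_mem_words] at hwV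
      exact Or.inr ⟨_, hwV.1, _, ⟨hwV.2, by simp; omega⟩, List.take_append_drop _ w⟩
  · rintro (hw | ⟨x, hx, y, ⟨hy, hl⟩, rfl⟩)
    · exact hw.1
    · by_contra hxy
      have := hn _ ⟨append_mem_words.2 ⟨hx, hy⟩, hxy⟩
      rw [List.length_append] at this
      omega

theorem COMB.def {V : Finset α} {L : Language α} (h : COMB V L) : DEF V L := by
  obtain ⟨h, X, hX, rfl⟩ := h
  refine ⟨h, 0, letters X, bot_le, ?_, Set.finite_empty, letters_finite hX, by simp⟩
  rintro _ ⟨a, ha, rfl⟩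
  exact cons_mem_words.2 ⟨hX a ha, nil_mem_words V⟩

theorem COMB.sydef {V : Finset α} {L : Language α} (h : COMB V L) : SYDEF V L := by
  obtain ⟨h, X, hX, rfl⟩ := h
  refine ⟨h, 1, letters X, .one, .of_finite ?_ (letters_finite hX), by simp⟩
  rintro _ ⟨a, ha, rfl⟩
  exact cons_mem_words.2 ⟨hX a ha, nil_mem_words V⟩

theorem monotone_evalFrom {σ : Type*} [LinearOrder σ] {M : DFA α σ} {V : Finset α}
    (hM : ∀ a ∈ V, Monotone fun z => M.step z a) {w : List α} (hw : w ∈ words V) :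
    Monotone fun q => M.evalFrom q w := by
  induction w with
  | nil => exact monotone_id
  | cons a w ih =>
    rw [cons_mem_words] at hw
    exact (ih hw.2).comp (hM a hw.1)

/-- The powers of a word act monotonically on a finite chain of states, so their orbits are
eventually constant. -/
theorem ORD.nc {V : Finset α} {L : Language α} (h : ORD V L) : NC V L := by
  obtain ⟨h, σ, _, _, M, hM, hL⟩ := h
  refine ⟨h, Fintype.card σ, Fintype.card_pos_iff.2 ⟨M.start⟩, fun x hx y hy z hz => ?_⟩
  have hp := wordPow_mem_words hy
  simp only [hL, append_mem_words, hx, hz, hp, true_and, DFA.mem_accepts, DFA.eval,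
    DFA.evalFrom_of_append, evalFrom_wordPow]
  rw [Monotone.iterate_succ_eq (monotone_evalFrom hM hy) _ le_rfl]

/-- The constant of a non-counting language may be increased. -/
theorem NC.iff_of_le {V : Finset α} {L : Language α} {k : ℕ}
    (h : ∀ x ∈ words V, ∀ y ∈ words V, ∀ z ∈ words V,
      (x ++ wordPow y k ++ z ∈ L ↔ x ++ wordPow y (k + 1) ++ z ∈ L)) {n : ℕ} (hn : k ≤ n)
    {x y z : List α} (hx : x ∈ words V) (hy : y ∈ words V) (hz : z ∈ words V) :
    x ++ wordPow y n ++ z ∈ L ↔ x ++ wordPow y (n + 1) ++ z ∈ L := by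
  obtain ⟨j, rfl⟩ := Nat.exists_eq_add_of_le' hn
  have := h (x ++ wordPow y j) (append_mem_words.2 ⟨hx, wordPow_mem_words hy j⟩) y hy z hz
  simpa only [Nat.add_assoc, wordPow_add, List.append_assoc] using this

theorem NC.ps {V : Finset α} {L : Language α} (h : NC V L) : PS V L := by
  obtain ⟨h, k, hk, hL⟩ := h
  refine ⟨h, k, hk, fun x hx => ?_⟩
  have key : ∀ n, k ≤ n → (wordPow x n ∈ L ↔ wordPow x k ∈ L) := by
    intro n hn
    induction n, hn using Nat.le_induction with
    | base => rfl
    | succ n hn ih =>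
      rw [← ih]
      simpa using (NC.iff_of_le hL hn (nil_mem_words V) hx (nil_mem_words V)).symm
  by_cases hxk : wordPow x k ∈ L
  · exact Or.inr fun n hn => (key n hn).2 hxk
  · exact Or.inl fun n hn => mt (key n hn).1 hxk

theorem SYDEF.ps {V : Finset α} {L : Language α} (h : SYDEF V L) : PS V L := by
  obtain ⟨h, E, H, hE, hH, rfl⟩ := h
  refine PS_of_forall_exists h fun x hx => ?_
  by_cases hn : ∃ n, wordPow x n ∈ E * words V * H
  · -- the first `n` factors of `x^N` have a prefix in `E`, the last `n` have a suffix in `H`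
    obtain ⟨n, _, ⟨e, he, w, hw, rfl⟩, y, hy, hxy⟩ := hn
    refine ⟨n + n, Or.inr fun N hN => ?_⟩
    obtain ⟨k, rfl⟩ := Nat.exists_eq_add_of_le hN
    have hye : y ∈ words V := hH.1 hy
    have hee : e ∈ words V := hE.1 he
    have hk := wordPow_mem_words hx k
    have hmid : w ++ y ++ wordPow x k ++ e ++ w ∈ words V := by
      simp only [append_mem_words]
      exact ⟨⟨⟨⟨hw, hye⟩, hk⟩, hee⟩, hw⟩
    refine ⟨_, ⟨e, he, _, hmid, rfl⟩, y, hy, ?_⟩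
    · rw [Nat.add_assoc, Nat.add_comm n k, wordPow_add, wordPow_add, ← hxy]
      simp
  · exact ⟨0, Or.inl fun n _ hx => hn ⟨n, hx⟩⟩

theorem INF.pre {V : Finset α} {L : Language α} (h : INF V L) : PRE V L :=
  ⟨h.1, fun x hx y hy hxy => h.2 [] (nil_mem_words V) x hx y hy (by simpa using hxy)⟩

theorem INF.suf {V : Finset α} {L : Language α} (h : INF V L) : SUF V L :=
  ⟨h.1, fun x hx y hy hxy => h.2 x hx y hy [] (nil_mem_words V) (by simpa using hxy)⟩

theorem PS_of_antitone {V : Finset α} {L : Language α} (h : RegularOver V L)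
    (hL : ∀ x ∈ words V, ∀ m n, wordPow x (m + n) ∈ L → wordPow x n ∈ L) : PS V L := by
  refine PS_of_forall_exists h fun x hx => ?_
  by_cases hn : ∃ n, wordPow x n ∉ L
  · obtain ⟨n, hn⟩ := hn
    refine ⟨n, Or.inl fun N hN hxN => hn ?_⟩
    obtain ⟨k, rfl⟩ := Nat.exists_eq_add_of_le' hN
    exact hL x hx _ _ hxN
  · exact ⟨0, Or.inr fun n _ => not_not.1 fun hx => hn ⟨n, hx⟩⟩

theorem PRE.ps {V : Finset α} {L : Language α} (h : PRE V L) : PS V L :=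
  PS_of_antitone h.1 fun x hx m n hmn => h.2 _ (wordPow_mem_words hx n) _
    (wordPow_mem_words hx m) (by rwa [← wordPow_add, Nat.add_comm])

theorem SUF.ps {V : Finset α} {L : Language α} (h : SUF V L) : PS V L :=
  PS_of_antitone h.1 fun x hx m n hmn => h.2 _ (wordPow_mem_words hx m) _
    (wordPow_mem_words hx n) (by rwa [← wordPow_add])

theorem COMM.circ {V : Finset α} {L : Language α} (h : COMM V L) : CIRC V L :=
  ⟨h.1, fun _ _ hxy => h.2 _ _ hxy List.perm_append_comm⟩

/-! ### Definite languages are ordered -/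

theorem take_le_take {β : Type*} [LinearOrder β] {l l' : List β} (h : l ≤ l') (n : ℕ) :
    l.take n ≤ l'.take n := by
  rcases eq_or_lt_of_le h with rfl | h
  · exact le_rfl
  have key : l.take n = l'.take n ∨ List.Lex (· < ·) (l.take n) (l'.take n) := by
    replace h : List.Lex (· < ·) l l' := h
    clear * - h
    induction h generalizing n with
    | nil => cases n <;> simp
    | cons _ ih =>
      cases n with
      | zero => simp
      | succ n => exact (ih (n := n)).imp (by simp) fun h => .cons h
    | rel h =>
      cases n with
      | zero => simp
      | succ n => exact Or.inr (.rel h)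
  exact key.elim le_of_eq fun h => le_of_lt h

/-- Membership in a definite language depends only on a suffix of bounded length. The states are
these suffixes, read from right to left and ordered lexicographically; reading a letter puts it in
front and cuts at the length bound, which is monotone. -/
theorem DEF.ord {V : Finset α} {L : Language α} (h : DEF V L) : ORD V L := by
  classical
  obtain ⟨h, A, B, hA, hB, hfA, hfB, rfl⟩ := h
  obtain ⟨n₁, hn₁⟩ := exists_length_bound hfA
  obtain ⟨n₂, hn₂⟩ := exists_length_bound hfB
  set n := n₁ + n₂ + 1
  set L := A + words V * B with hLdef
  -- membership is decided by the last `n` letters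
  have hsuf : ∀ x ∈ words V, ∀ y ∈ words V, y.length = n → (x ++ y ∈ L ↔ y ∈ L) := by
    intro x hx y hy hl
    constructor
    · rintro (hxy | ⟨s, hs, t, ht, hst⟩)
      · have := hn₁ _ hxy
        rw [List.length_append] at this
        omega
      · have := hn₂ t ht
        rcases List.append_eq_append_iff.1 hst with ⟨r, rfl, rfl⟩ | ⟨r, rfl, rfl⟩
        · rw [List.length_append] at this
          omega
        · exact Or.inr ⟨r, (append_mem_words.1 hs).2, t, ht, rfl⟩
    · rintro (hy' | ⟨s, hs, t, ht, rfl⟩)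
      · have := hn₁ _ hy'
        omega
      · exact Or.inr ⟨x ++ s, append_mem_words.2 ⟨hx, hs⟩, t, ht, by simp⟩
  let σ := {l : List (Fin V.card) // l.length ≤ n}
  have : Finite σ := (List.finite_length_le (Fin V.card) n).to_subtype
  have : Fintype σ := Fintype.ofFinite σ
  let dec : Fin V.card → α := fun i => (V.equivFin.symm i).1
  let M : DFA α σ :=
    { step := fun l a => if ha : a ∈ V then
        ⟨(V.equivFin ⟨a, ha⟩ :: l.1).take n, List.length_take_le _ _⟩ else l
      start := ⟨[], by simp⟩
      accept := {l | (l.1.map dec).reverse ∈ L} }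
  have heval : ∀ w ∈ words V, (M.eval w).1.map dec = w.reverse.take n := by
    intro w
    induction w using List.reverseRecOn with
    | nil => intro _; simp [M, DFA.eval]
    | append_singleton w a ih =>
      intro hw
      rw [append_mem_words, cons_mem_words] at hw
      have ha := hw.2.1
      rw [DFA.eval_append_singleton]
      have : (M.step (M.eval w) a).1 = (V.equivFin ⟨a, ha⟩ :: (M.eval w).1).take n := by
        simp [M, ha]
      rw [this, List.map_take, List.map_cons, ih hw.1]
      have hdec : dec (V.equivFin ⟨a, ha⟩) = a := by simp [dec]
      rw [hdec, List.reverse_append]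
      simp [n, List.take_succ_cons, List.take_take]
  have hacc : ∀ w ∈ words V, (w ∈ L ↔ w ∈ M.accepts) := by
    intro w hw
    change w ∈ L ↔ ((M.eval w).1.map dec).reverse ∈ L
    rw [heval w hw, List.take_reverse, List.reverse_reverse]
    rcases le_total w.length n with hl | hl
    · rw [Nat.sub_eq_zero_of_le hl, List.drop_zero]
    · have hw' := hw
      rw [← List.take_append_drop (w.length - n) w, append_mem_words] at hw'
      rw [← hsuf _ hw'.1 _ hw'.2 (by rw [List.length_drop]; omega), List.take_append_drop]
  refine ⟨h, σ, inferInstance, inferInstance, M, ?_, fun w =>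
    ⟨fun hw => ⟨h.1 hw, (hacc w (h.1 hw)).1 hw⟩, fun hw => (hacc w hw.1).2 hw.2⟩⟩
  intro a ha l l' hl
  simp only [M, ha, dite_true]
  exact take_le_take (List.cons_le_cons _ hl) n

/-! ### Monoidal selection by combinational selection -/

theorem mem_words_mul_letters {V : Finset α} {x : List α} (hx : x ∈ words V) (h : x ≠ []) :
    x ∈ words V * letters (V : Set α) := by
  have hx' := hx
  rw [← List.dropLast_append_getLast h, append_mem_words, cons_mem_words] at hx'
  exact ⟨_, hx'.1, _, ⟨_, hx'.2.1, rfl⟩, List.dropLast_append_getLast h⟩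

theorem COMB_words_mul_letters (V : Finset α) : COMB V (words V * letters (V : Set α)) := by
  refine ⟨(RegularOver.words V).mul (.of_finite ?_ (letters_finite fun _ h => h)), V,
    fun _ h => h, rfl⟩
  rintro _ ⟨a, ha, rfl⟩
  exact cons_mem_words.2 ⟨ha, nil_mem_words V⟩

/-- A rule with selection language `U^*` and context `(u, v)` is simulated by the same context with
selection `U^*U` when the selected word is non-empty, and by inserting `uv` next to some non-empty
word when it is empty. The latter fails for the empty word only, which can be derived only as an
axiom; so the words `uv` are then taken as axioms. -/
theorem IC_mon_or_comb_subset : IC (fun V (L : Language α) => MON V L ∨ COMB V L) ⊆ IC COMB := by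
  rintro _ ⟨G, hG, rfl⟩
  set V := G.alphabet with hV
  let C := {p ∈ G.selections | ∃ U : Finset α, U.Nonempty ∧ U ⊆ V ∧ COMB U p.1}
  let M := {p ∈ G.selections | ∃ U : Finset α, U.Nonempty ∧ U ⊆ V ∧ p.1 = words U}
  have hM : ∀ p ∈ M, ∃ U : Finset α, U.Nonempty ∧ U ⊆ V ∧ p.1 = words U := fun p hp => hp.2
  choose! U hU hUV hUw using hM
  let f : Language α × Set (List α × List α) → Language α × Set (List α × List α) :=
    fun p => (words (U p) * letters (U p : Set α), p.2)
  let g : Language α × Set (List α × List α) → Language α × Set (List α × List α) :=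
    fun p => (words V * letters (V : Set α),
      (fun c => (c.1 ++ c.2, [])) '' p.2 ∪ (fun c => ([], c.1 ++ c.2)) '' p.2)
  have hfM : M.Finite := G.selections_finite.subset fun _ h => h.1
  let G' : ContextualGrammar α :=
    { alphabet := V
      alphabet_nonempty := G.alphabet_nonempty
      selections := C ∪ f '' M ∪ g '' M
      selections_finite :=
        ((G.selections_finite.subset fun _ h => h.1).union (hfM.image f)).union (hfM.image g)
      contexts_finite := by
        rintro _ ((hp | ⟨p, hp, rfl⟩) | ⟨p, hp, rfl⟩)
        · exact G.contexts_finite _ hp.1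
        · exact G.contexts_finite p hp.1
        · exact ((G.contexts_finite p hp.1).image _).union ((G.contexts_finite p hp.1).image _)
      contexts_over := by
        rintro _ ((hp | ⟨p, hp, rfl⟩) | ⟨p, hp, rfl⟩)
        · exact G.contexts_over _ hp.1
        · exact G.contexts_over p hp.1
        · rintro _ (⟨c, hc, rfl⟩ | ⟨c, hc, rfl⟩)
          · exact ⟨append_mem_words.2 (G.contexts_over p hp.1 c hc), nil_mem_words V⟩
          · exact ⟨nil_mem_words V, append_mem_words.2 (G.contexts_over p hp.1 c hc)⟩
      contexts_ne := by
        rintro _ ((hp | ⟨p, hp, rfl⟩) | ⟨p, hp, rfl⟩)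
        · exact G.contexts_ne _ hp.1
        · exact G.contexts_ne p hp.1
        · rintro _ (⟨c, hc, rfl⟩ | ⟨c, hc, rfl⟩)
          · simpa using G.contexts_ne p hp.1 c hc
          · simpa using G.contexts_ne p hp.1 c hc
      initial := G.initial ∪ ⋃ p ∈ M, {w | [] ∈ G.initial ∧ ∃ c ∈ p.2, w = c.1 ++ c.2}
      initial_finite := by
        refine G.initial_finite.union (hfM.biUnion fun p hp => ?_)
        refine ((G.contexts_finite p hp.1).image fun c => c.1 ++ c.2).subset ?_
        rintro _ ⟨-, c, hc, rfl⟩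
        exact ⟨c, hc, rfl⟩
      initial_over := by
        rintro w (hw | hw)
        · exact G.initial_over w hw
        · simp only [Set.mem_iUnion] at hw
          obtain ⟨p, hp, -, c, hc, rfl⟩ := hw
          exact append_mem_words.2 (G.contexts_over p hp.1 c hc) }
  have hnil : ∀ p ∈ M, ∀ c ∈ p.2, ∀ x y : List α, G.InStep (x ++ y) (x ++ (c.1 ++ c.2) ++ y) := by
    intro p hp c hc x y
    refine ⟨x, [], y, by simp, p, hp.1, ?_, c, hc, by simp⟩
    rw [hUw p hp]
    exact nil_mem_words _
  refine ⟨G', ?_, le_antisymm ?_ ?_⟩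
  · rintro _ ((hp | ⟨p, hp, rfl⟩) | ⟨p, hp, rfl⟩)
    · exact hp.2
    · exact ⟨U p, hU p hp, hUV p hp, COMB_words_mul_letters _⟩
    · exact ⟨V, G.alphabet_nonempty, subset_rfl, COMB_words_mul_letters _⟩
  · rintro z ⟨x, hx, hz⟩
    have hstep : ∀ x y, G'.InStep x y → G.InStep x y := by
      rintro _ _ ⟨x₁, x₂, x₃, rfl, _, (hp | ⟨p, hp, rfl⟩) | ⟨p, hp, rfl⟩, hx₂, c, hc, rfl⟩
      · exact ⟨x₁, x₂, x₃, rfl, _, hp.1, hx₂, c, hc, rfl⟩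
      · refine ⟨x₁, x₂, x₃, rfl, p, hp.1, ?_, c, hc, rfl⟩
        rw [hUw p hp]
        exact (COMB_words_mul_letters _).1.1 hx₂
      · rcases hc with ⟨c, hc, rfl⟩ | ⟨c, hc, rfl⟩
        · simpa using hnil p hp c hc x₁ (x₂ ++ x₃)
        · simpa using hnil p hp c hc (x₁ ++ x₂) x₃
    have hz' := Relation.ReflTransGen.mono hstep _ _ hz
    rcases hx with hx | hx
    · exact ⟨x, hx, hz'⟩
    · simp only [Set.mem_iUnion] at hx
      obtain ⟨p, hp, h0, c, hc, rfl⟩ := hx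
      refine ⟨[], h0, hz'.head ?_⟩
      simpa using hnil p hp c hc [] []
  · rintro z ⟨x, hx, hz⟩
    have key : z ∈ G'.inLanguage ∧ (z = [] → [] ∈ G.initial) := by
      induction hz with
      | refl => exact ⟨⟨x, Or.inl hx, .refl⟩, fun h => h ▸ hx⟩
      | @tail y z _ hs ih =>
        obtain ⟨⟨x', hx', hz'⟩, h0⟩ := ih
        obtain ⟨x₁, x₂, x₃, rfl, p, hp, hx₂, c, hc, rfl⟩ := hs
        have hne := G.contexts_ne p hp c hc
        refine ⟨?_, fun h => absurd (by simp at h; simp [h]) hne⟩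
        obtain ⟨W, hW, hWV, hpW⟩ := hG p hp
        rcases hpW with hpW | hpW
        · have hpM : p ∈ M := ⟨hp, W, hW, hWV, hpW.2⟩
          have hyV : x₁ ++ x₂ ++ x₃ ∈ words V :=
            G'.mem_words_of_mem_inLanguage ⟨x', hx', hz'⟩
          simp only [append_mem_words] at hyV
          rcases eq_or_ne x₂ [] with rfl | hx₂0
          · rcases eq_or_ne x₃ [] with rfl | hx₃0
            · rcases eq_or_ne x₁ [] with rfl | hx₁0
              · refine ⟨c.1 ++ c.2, Or.inr ?_, by simpa using .refl⟩
                simp only [Set.mem_iUnion]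
                exact ⟨p, hpM, h0 rfl, c, hc, rfl⟩
              · refine ⟨x', hx', hz'.tail ⟨[], x₁, [], by simp, _, Or.inr ⟨p, hpM, rfl⟩,
                  mem_words_mul_letters hyV.1.1 hx₁0, _, Or.inr ⟨c, hc, rfl⟩, by simp⟩⟩
            · refine ⟨x', hx', hz'.tail ⟨x₁, x₃, [], by simp, _, Or.inr ⟨p, hpM, rfl⟩,
                  mem_words_mul_letters hyV.2 hx₃0, _, Or.inl ⟨c, hc, rfl⟩, by simp⟩⟩
          · rw [hUw p hpM] at hx₂
            exact ⟨x', hx', hz'.tail ⟨x₁, x₂, x₃, rfl, _, Or.inl (Or.inr ⟨p, hpM, rfl⟩),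
              mem_words_mul_letters hx₂ hx₂0, c, hc, rfl⟩⟩
        · exact ⟨x', hx', hz'.tail ⟨x₁, x₂, x₃, rfl, p, Or.inl (Or.inl ⟨hp, W, hW, hWV, hpW⟩),
            hx₂, c, hc, rfl⟩⟩
    exact key.1

/-! ### Comets -/

theorem eq_nil_of_mem_kstar_singleton {V : Finset α} {z : α} (hz : z ∉ V) {x : List α}
    (hx : x ∈ words V) (h : x ∈ ({[z]} : Language α)∗) : x = [] := by
  obtain ⟨l, rfl, hl⟩ := h
  rw [List.flatten_eq_nil_iff]
  intro y hy
  have hyz : y = [z] := hl y hy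
  exact absurd (hx z (List.mem_flatten.2 ⟨y, hy, by simp [hyz]⟩)) hz

theorem singleton_ne_zero (z : α) : ({[z]} : Language α) ≠ 0 := fun h =>
  Language.notMem_zero [z] (h ▸ rfl)

theorem singleton_ne_one (z : α) : ({[z]} : Language α) ≠ 1 := fun h => by
  have : [z] ∈ (1 : Language α) := h ▸ rfl
  simp at this

/-- Selection languages may be padded by powers of a letter that never occurs in a derivation. -/
theorem IC_subset_of_fresh_letter [Infinite α] {F : Family α} (T : Language α → α → Language α)
    (hT : ∀ (U : Finset α) (S : Language α) (z : α), U.Nonempty → RegularOver U S →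
      RegularOver U ({[z]} : Language α) → F U (T S z))
    (hmem : ∀ (V : Finset α) (S : Language α) (z : α), z ∉ V →
      ∀ x ∈ words V, x ∈ S ↔ x ∈ T S z) : IC REG ⊆ IC F := by
  classical
  have hfresh : ∀ V : Finset α, ∃ z, z ∉ V := fun V => Infinite.exists_notMem_finset V
  choose z hz using hfresh
  refine IC_subset_of_cover (fun V => insert (z V) V) (fun V => Finset.subset_insert _ _) ?_
  intro V U S hU hUV hS
  refine ⟨{T S (z V)}, Set.finite_singleton _, fun _ h => h ▸ ?_, ?_⟩
  · refine ⟨insert (z V) U, ⟨z V, by simp⟩, Finset.insert_subset_insert _ hUV, ?_⟩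
    exact hT _ _ _ ⟨z V, by simp⟩ (hS.mono (Finset.subset_insert _ _)) (.singleton (by simp))
  · intro x hx
    rw [hmem V S (z V) (hz V) x hx]
    exact ⟨fun h => ⟨_, rfl, h⟩, fun ⟨_, h, h'⟩ => h ▸ h'⟩

theorem IC_REG_subset_LCOM [Infinite α] : IC (α := α) REG ⊆ IC LCOM := by
  refine IC_subset_of_fresh_letter (fun S z => S * ({[z]} : Language α)∗)
    (fun U S z _ hS hz => ⟨hS.mul hz.kstar, S, {[z]}, hS, hz, singleton_ne_zero z,
      singleton_ne_one z, rfl⟩) fun V S z hz x hx =>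
      ⟨fun h => ⟨x, h, [], Language.nil_mem_kstar _, by simp⟩, ?_⟩
  rintro ⟨s, hs, t, ht, rfl⟩
  rw [eq_nil_of_mem_kstar_singleton hz (append_mem_words.1 hx).2 ht]
  change s ++ [] ∈ S
  rwa [List.append_nil]

theorem IC_REG_subset_RCOM [Infinite α] : IC (α := α) REG ⊆ IC RCOM := by
  refine IC_subset_of_fresh_letter (fun S z => ({[z]} : Language α)∗ * S)
    (fun U S z _ hS hz => ⟨hz.kstar.mul hS, {[z]}, S, hz, hS, singleton_ne_zero z,
      singleton_ne_one z, rfl⟩) fun V S z hz x hx =>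
      ⟨fun h => ⟨[], Language.nil_mem_kstar _, x, h, rfl⟩, ?_⟩
  rintro ⟨s, hs, t, ht, rfl⟩
  rw [eq_nil_of_mem_kstar_singleton hz (append_mem_words.1 hx).1 hs]
  exact ht

theorem LCOM.tcom {V : Finset α} {L : Language α} (h : LCOM V L) : TCOM V L := by
  obtain ⟨h, E, G, hE, hG, h0, h1, rfl⟩ := h
  exact ⟨h, E, G, 1, hE, hG, .one, h0, h1, by simp⟩

/-! ### Union-free languages -/

theorem UnionFreeExpr.regularOver {V : Finset α} {r : RegularExpression α}
    (h : UnionFreeExpr V r) : RegularOver V r.matches' := by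
  induction h with
  | zero => exact .zero
  | epsilon => exact .one
  | char a ha => exact .singleton (by simpa using ha)
  | comp _ _ _ _ hr hs => exact hr.mul hs
  | star _ _ hr => exact hr.kstar

/-- `L` is a finite union of languages given by union-free expressions over `V`. -/
def IsUnionOfUnionFree (V : Finset α) (L : Language α) : Prop :=
  ∃ l : List (RegularExpression α), (∀ r ∈ l, UnionFreeExpr V r) ∧
    ∀ w, w ∈ L ↔ ∃ r ∈ l, w ∈ r.matches'

namespace IsUnionOfUnionFree

variable {V : Finset α} {L K : Language α}

theorem zero : IsUnionOfUnionFree V 0 :=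
  ⟨[], by simp, fun w => by simp [Language.notMem_zero]⟩

theorem of_expr {r : RegularExpression α} (h : UnionFreeExpr V r) :
    IsUnionOfUnionFree V r.matches' := ⟨[r], by simpa using h, by simp⟩

theorem add (hL : IsUnionOfUnionFree V L) (hK : IsUnionOfUnionFree V K) :
    IsUnionOfUnionFree V (L + K) := by
  obtain ⟨l, hl, hlL⟩ := hL
  obtain ⟨k, hk, hkK⟩ := hK
  refine ⟨l ++ k, fun r hr => (List.mem_append.1 hr).elim (hl r) (hk r), fun w => ?_⟩
  simp only [Language.mem_add, hlL, hkK, List.mem_append, or_and_right, exists_or]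

theorem mul (hL : IsUnionOfUnionFree V L) (hK : IsUnionOfUnionFree V K) :
    IsUnionOfUnionFree V (L * K) := by
  obtain ⟨l, hl, hlL⟩ := hL
  obtain ⟨k, hk, hkK⟩ := hK
  refine ⟨(l ×ˢ k).map fun p => .comp p.1 p.2, ?_, fun w => ?_⟩
  · intro r hr
    obtain ⟨⟨p, q⟩, hpq, rfl⟩ := List.mem_map.1 hr
    have := List.pair_mem_product.1 hpq
    exact .comp _ _ (hl p this.1) (hk q this.2)
  · constructor
    · rintro ⟨x, hx, y, hy, rfl⟩
      obtain ⟨r, hr, hxr⟩ := (hlL x).1 hx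
      obtain ⟨s, hs, hys⟩ := (hkK y).1 hy
      exact ⟨_, List.mem_map.2 ⟨(r, s), List.pair_mem_product.2 ⟨hr, hs⟩, rfl⟩,
        x, hxr, y, hys, rfl⟩
    · rintro ⟨_, hr, hw⟩
      obtain ⟨⟨r, s⟩, hrs, rfl⟩ := List.mem_map.1 hr
      have := List.pair_mem_product.1 hrs
      obtain ⟨x, hx, y, hy, rfl⟩ := hw
      exact ⟨x, (hlL x).2 ⟨r, this.1, hx⟩, y, (hkK y).2 ⟨s, this.2, hy⟩, rfl⟩

/-- The Kleene closure of a finite union is union-free because of `(L + K)∗ = (L∗ * K∗)∗`. -/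
theorem kstar (hL : IsUnionOfUnionFree V L) : IsUnionOfUnionFree V L∗ := by
  obtain ⟨l, hl, hlL⟩ := hL
  suffices h : ∃ r, UnionFreeExpr V r ∧ r.matches' = L∗ by
    obtain ⟨r, hr, h⟩ := h
    exact h ▸ of_expr hr
  induction l generalizing L with
  | nil =>
    refine ⟨.epsilon, .epsilon, ?_⟩
    have : L = 0 := by ext w; simp [hlL, Language.notMem_zero]
    rw [this, kstar_zero]
    rfl
  | cons r l ih =>
    obtain ⟨s, hs, hsl⟩ := ih (L := {w | ∃ r ∈ l, w ∈ r.matches'})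
      (fun r hr => hl r (by simp [hr])) fun w => Iff.rfl
    refine ⟨.star (.comp (.star r) s), .star _ (.comp _ _ (.star _ (hl r (by simp))) hs), ?_⟩
    have hLadd : L = r.matches' + (show Language α from {w | ∃ r ∈ l, w ∈ r.matches'}) := by
      ext w
      rw [hlL, Language.mem_add]
      simp only [List.mem_cons, exists_eq_or_imp]
      rfl
    change (r.matches'∗ * s.matches')∗ = L∗
    rw [hsl, hLadd]
    set A := r.matches'
    set B : Language α := {w | ∃ r ∈ l, w ∈ r.matches'}
    apply le_antisymm
    · rw [← kstar_idem (A + B)]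
      apply kstar_mono
      calc A∗ * B∗ ≤ (A + B)∗ * (A + B)∗ :=
            mul_le_mul' (kstar_mono le_self_add) (kstar_mono le_add_self)
        _ = (A + B)∗ := kstar_mul_kstar _
    · apply kstar_mono
      refine add_le ?_ ?_
      · calc A ≤ A∗ := le_kstar
          _ = A∗ * 1 := (mul_one _).symm
          _ ≤ A∗ * B∗ := mul_le_mul' le_rfl one_le_kstar
      · calc B ≤ B∗ := le_kstar
          _ = 1 * B∗ := (one_mul _).symm
          _ ≤ A∗ * B∗ := mul_le_mul' one_le_kstar le_rfl

theorem of_finite_letters {X : Finset α} (h : X ⊆ V) :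
    IsUnionOfUnionFree V (letters (X : Set α)) := by
  refine ⟨X.toList.map .char, ?_, fun w => ?_⟩
  · intro r hr
    obtain ⟨a, ha, rfl⟩ := List.mem_map.1 hr
    exact .char a (h (Finset.mem_toList.1 ha))
  · constructor
    · rintro ⟨a, ha, rfl⟩
      exact ⟨_, List.mem_map.2 ⟨a, Finset.mem_toList.2 ha, rfl⟩, rfl⟩
    · rintro ⟨_, hr, hw⟩
      obtain ⟨a, ha, rfl⟩ := List.mem_map.1 hr
      exact ⟨a, Finset.mem_toList.1 ha, hw⟩

end IsUnionOfUnionFree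

section Kleene

variable {σ : Type*} (M : DFA α σ) (V : Finset α)

/-- The words over `V` that lead `M` from the state `i` to the state `j` so that all states entered
strictly in between belong to `P`. -/
def pathLanguage (P : Set σ) : σ → σ → Language α := fun i j =>
  {w | w ∈ words V ∧ M.evalFrom i w = j ∧
    ∀ x y, w = x ++ y → x ≠ [] → y ≠ [] → M.evalFrom i x ∈ P}

variable {M V}

theorem append_mem_pathLanguage {P : Set σ} {i j k : σ} {x y : List α} (hk : k ∈ P)
    (hx : x ∈ pathLanguage M V P i k) (hy : y ∈ pathLanguage M V P k j) :
    x ++ y ∈ pathLanguage M V P i j := by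
  obtain ⟨hxV, hxk, hxP⟩ := hx
  obtain ⟨hyV, hyj, hyP⟩ := hy
  refine ⟨append_mem_words.2 ⟨hxV, hyV⟩, by rw [DFA.evalFrom_of_append, hxk, hyj], ?_⟩
  intro s t hst hs ht
  rcases List.append_eq_append_iff.1 hst with ⟨r, rfl, rfl⟩ | ⟨r, rfl, rfl⟩
  · rw [DFA.evalFrom_of_append, hxk]
    rcases eq_or_ne r [] with rfl | hr
    · exact hk
    · exact hyP r t rfl hr ht
  · rcases eq_or_ne r [] with rfl | hr
    · rw [List.append_nil] at hxk
      rw [hxk]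
      exact hk
    · exact hxP s r rfl hs hr

theorem pathLanguage_mono {P Q : Set σ} (h : P ⊆ Q) (i j : σ) :
    pathLanguage M V P i j ≤ pathLanguage M V Q i j :=
  fun _ hw => ⟨hw.1, hw.2.1, fun x y hxy hx hy => h (hw.2.2 x y hxy hx hy)⟩

theorem cons_mem_pathLanguage {P : Set σ} {i j : σ} {a : α} {w : List α} (ha : a ∈ V)
    (hw : w ∈ pathLanguage M V P (M.step i a) j) (h : w ≠ [] → M.step i a ∈ P) :
    a :: w ∈ pathLanguage M V P i j := by
  refine ⟨cons_mem_words.2 ⟨ha, hw.1⟩, hw.2.1, ?_⟩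
  rintro (_ | ⟨b, x⟩) y hxy hx hy
  · exact absurd rfl hx
  obtain ⟨rfl, rfl⟩ := List.cons.inj hxy
  rcases eq_or_ne x [] with rfl | hx'
  · exact h (by simpa using hy)
  · exact hw.2.2 x y rfl hx' hy

/-- Kleene's recursion: a path with inner states in `P ∪ {k}` avoids `k`, or it splits at its
visits of `k`. -/
theorem pathLanguage_insert (P : Set σ) (i j k : σ) :
    pathLanguage M V (insert k P) i j = pathLanguage M V P i j +
      pathLanguage M V P i k * (pathLanguage M V P k k)∗ * pathLanguage M V P k j := by
  apply le_antisymm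
  · intro w
    induction w generalizing i with
    | nil =>
      exact fun hw => Or.inl ⟨hw.1, hw.2.1, fun x y hxy hx _ =>
        absurd (List.append_eq_nil_iff.1 hxy.symm).1 hx⟩
    | cons a w ih =>
      rintro ⟨hwV, hwj, hP⟩
      rw [cons_mem_words] at hwV
      have ha1 : [a] ∈ pathLanguage M V P i (M.step i a) :=
        cons_mem_pathLanguage hwV.1 ⟨nil_mem_words V, rfl, fun x y hxy hx _ =>
          absurd (List.append_eq_nil_iff.1 hxy.symm).1 hx⟩ fun h => absurd rfl h
      rcases eq_or_ne w [] with rfl | hw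
      · exact Or.inl (hwj ▸ ha1)
      have hstep : M.step i a ∈ insert k P := hP [a] w rfl (by simp) hw
      have hw' := ih (M.step i a) ⟨hwV.2, hwj, fun x y hxy hx hy => by
        simpa using hP (a :: x) y (by simp [hxy]) (by simp) hy⟩
      rcases hstep with hk | hk
      · rw [hk] at hw' ha1
        refine Or.inr ?_
        have hle : pathLanguage M V P k j + pathLanguage M V P k k * (pathLanguage M V P k k)∗ *
            pathLanguage M V P k j ≤ (pathLanguage M V P k k)∗ * pathLanguage M V P k j :=
          add_le ((one_mul _).symm.le.trans (mul_le_mul' one_le_kstar le_rfl))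
            (mul_le_mul' mul_kstar_le_kstar le_rfl)
        rw [mul_assoc]
        exact ⟨[a], ha1, w, hle hw', rfl⟩
      · rcases hw' with hw' | ⟨_, ⟨x, hx, y, hy, rfl⟩, z, hz, rfl⟩
        · exact Or.inl (cons_mem_pathLanguage hwV.1 hw' fun _ => hk)
        · exact Or.inr ⟨_, ⟨a :: x, cons_mem_pathLanguage hwV.1 hx fun _ => hk, y, hy, rfl⟩,
            z, hz, rfl⟩
  · refine add_le (pathLanguage_mono (Set.subset_insert _ _) _ _) ?_
    have hk : k ∈ insert k P := Set.mem_insert _ _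
    have hmono := pathLanguage_mono (M := M) (V := V) (Set.subset_insert k P)
    have hmul : ∀ i j, pathLanguage M V (insert k P) i k * pathLanguage M V (insert k P) k j ≤
        pathLanguage M V (insert k P) i j := by
      rintro i j _ ⟨x, hx, y, hy, rfl⟩
      exact append_mem_pathLanguage hk hx hy
    refine (mul_le_mul' ?_ (hmono k j)).trans (hmul i j)
    refine mul_kstar_le (hmono i k) ?_
    exact (mul_le_mul' le_rfl (hmono k k)).trans (hmul i k)

theorem isUnionOfUnionFree_pathLanguage (P : Finset σ) (i j : σ) :
    IsUnionOfUnionFree V (pathLanguage M V (P : Set σ) i j) := by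
  classical
  induction P using Finset.induction_on generalizing i j with
  | empty =>
    have h1 : IsUnionOfUnionFree V (letters ((V.filter fun a => M.step i a = j : Finset α) :
        Set α)) := .of_finite_letters (Finset.filter_subset _ _)
    have h2 : IsUnionOfUnionFree V (if i = j then (1 : Language α) else 0) := by
      split_ifs
      · exact .of_expr .epsilon
      · exact .zero
    convert h1.add h2 using 1
    ext w
    rw [Language.mem_add]
    constructor
    · rintro ⟨hwV, hwj, hP⟩
      rcases w with _ | ⟨a, _ | ⟨b, w⟩⟩
      · refine Or.inr ?_
        rw [if_pos (by simpa using hwj)]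
        exact Language.nil_mem_one
      · exact Or.inl ⟨a, by simpa using ⟨hwV a (by simp), hwj⟩, rfl⟩
      · exact absurd (hP [a] (b :: w) rfl (by simp) (by simp)) (by simp)
    · rintro (⟨a, ha, rfl⟩ | hw)
      · have ha' : a ∈ V ∧ M.step i a = j := by simpa using ha
        refine cons_mem_pathLanguage ha'.1 ⟨nil_mem_words V, ha'.2, ?_⟩ fun h => absurd rfl h
        exact fun x y hxy hx _ => absurd (List.append_eq_nil_iff.1 hxy.symm).1 hx
      · split_ifs at hw with hij
        · rw [Language.mem_one] at hw
          subst hw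
          exact ⟨nil_mem_words V, hij,
            fun x y hxy hx _ => absurd (List.append_eq_nil_iff.1 hxy.symm).1 hx⟩
        · exact absurd hw (Language.notMem_zero w)
  | insert k P _ ih =>
    rw [Finset.coe_insert, pathLanguage_insert]
    exact (ih i j).add (((ih i k).mul (ih k k).kstar).mul (ih k j))

end Kleene

/-- The language of an automaton is the union over the accepting states of its path languages with
arbitrary inner states. -/
theorem REG.isUnionOfUnionFree {V : Finset α} {L : Language α} (h : REG V L) :
    IsUnionOfUnionFree V L := by
  classical
  obtain ⟨hV, σ, _, M, rfl⟩ := h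
  have hsum : ∀ s : Finset σ, IsUnionOfUnionFree V
      {w | ∃ j ∈ s, w ∈ pathLanguage M V (Finset.univ : Finset σ) M.start j} := by
    intro s
    induction s using Finset.induction_on with
    | empty =>
      refine (congrArg _ (Language.ext fun w => ?_)).mp (IsUnionOfUnionFree.zero (V := V))
      exact ⟨fun h => absurd h (Language.notMem_zero w), fun ⟨_, h, _⟩ => absurd h (by simp)⟩
    | insert j s _ ih =>
      refine (congrArg _ (Language.ext fun w => ?_)).mp
        ((isUnionOfUnionFree_pathLanguage (M := M) (V := V) Finset.univ M.start j).add ih)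
      change _ ∨ (∃ k ∈ s, _) ↔ (∃ k ∈ insert j s, _)
      simp only [Finset.mem_insert, exists_eq_or_imp]
      rfl
  refine (congrArg _ (Language.ext fun w => ?_)).mp
    (hsum (Finset.univ.filter fun j => j ∈ M.accept))
  constructor
  · rintro ⟨j, hj, -, rfl, -⟩
    exact (Finset.mem_filter.1 hj).2
  · exact fun hw => ⟨M.eval w, Finset.mem_filter.2 ⟨Finset.mem_univ _, hw⟩, hV hw, rfl,
      fun _ _ _ _ _ => Finset.mem_coe.2 (Finset.mem_univ _)⟩

/-- A selection pair whose language is a finite union may be replaced by several pairs. -/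
theorem IC_REG_subset_UF : IC (α := α) REG ⊆ IC UF := by
  refine IC_subset_of_cover id (fun _ => subset_rfl) fun V U S hU hUV hS => ?_
  obtain ⟨l, hl, hlS⟩ := hS.isUnionOfUnionFree
  refine ⟨{T | ∃ r ∈ l, T = r.matches'}, ?_, ?_, fun x _ => ?_⟩
  · refine ((List.finite_toSet l).image RegularExpression.matches').subset ?_
    rintro _ ⟨r, hr, rfl⟩
    exact ⟨r, hr, rfl⟩
  · rintro _ ⟨r, hr, rfl⟩
    exact ⟨U, hU, hUV, (hl r hr).regularOver, r, hl r hr, rfl⟩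
  · rw [hlS]
    exact ⟨fun ⟨r, hr, hx⟩ => ⟨_, ⟨r, hr, rfl⟩, hx⟩, fun ⟨_, ⟨r, hr, h⟩, hx⟩ => ⟨r, hr, h ▸ hx⟩⟩

/-! ### Languages that record which words are selected -/

/-- A factor without the letter `p` lies on one side of a given occurrence of `p`. -/
theorem append_eq_append_cons_cases {s f t l r : List α} {p : α} (h : s ++ f ++ t = l ++ p :: r)
    (hp : p ∉ f) : (∃ t', l = s ++ f ++ t') ∨ ∃ s', r = s' ++ f ++ t := by
  rcases List.append_eq_append_iff.1 h with ⟨m, hl, hm⟩ | ⟨m, hl, hm⟩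
  · exact Or.inl ⟨m, hl⟩
  rcases m with _ | ⟨a, m⟩
  · exact Or.inl ⟨[], by simpa using hl.symm⟩
  obtain ⟨rfl, rfl⟩ := List.cons.inj hm
  right
  rcases List.append_eq_append_iff.1 hl with ⟨k, rfl, hk⟩ | ⟨k, rfl, hk⟩
  · exact absurd (hk ▸ by simp) hp
  · rcases k with _ | ⟨b, k⟩
    · have hf : f = p :: m := by simpa using hk.symm
      exact absurd (hf ▸ by simp) hp
    · obtain ⟨rfl, rfl⟩ := List.cons.inj hk
      exact ⟨k, rfl⟩

/-- The letters `c`, `d`, `p`, `q` are pairwise distinct and do not belong to `B`. -/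
structure Fresh (B : Finset α) (c d p q : α) : Prop where
  cd : c ≠ d
  cp : c ≠ p
  cq : c ≠ q
  dp : d ≠ p
  dq : d ≠ q
  pq : p ≠ q
  c_notMem : c ∉ B
  d_notMem : d ∉ B
  p_notMem : p ∉ B
  q_notMem : q ∉ B

theorem exists_fresh [Infinite α] (B : Finset α) : ∃ c d p q, Fresh B c d p q := by
  classical
  obtain ⟨c, hc⟩ := Infinite.exists_notMem_finset B
  obtain ⟨d, hd⟩ := Infinite.exists_notMem_finset (insert c B)
  obtain ⟨p, hp⟩ := Infinite.exists_notMem_finset (insert d (insert c B))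
  obtain ⟨q, hq⟩ := Infinite.exists_notMem_finset (insert p (insert d (insert c B)))
  simp only [Finset.mem_insert, not_or] at hd hp hq
  exact ⟨c, d, p, q, Ne.symm hd.1, Ne.symm hp.2.1, Ne.symm hq.2.2.1, Ne.symm hp.1, Ne.symm hq.2.1,
    Ne.symm hq.1, hc, hd.2, hp.2.2, hq.2.2.2⟩

/-- The grammar whose derivations build the words `c^n s w₀ t d^n` with `s, t ∈ A^*` and
`n = |s| + |t|`, letter by letter, and may then surround a factor that belongs to `S` by `p`
and `q`. -/
def snapshotGrammar [DecidableEq α] {A B : Finset α} {w₀ : List α} (hA : A ⊆ B)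
    (hw₀ : w₀ ∈ words B) (c d p q : α) (S : Language α) : ContextualGrammar α where
  alphabet := insert c (insert d (insert p (insert q B)))
  alphabet_nonempty := ⟨c, by simp⟩
  selections := {(words (insert c (insert d (insert p (insert q B)))),
    (fun a => ([c, a], [d])) '' (A : Set α) ∪ (fun a => ([c], [a, d])) '' (A : Set α)),
    (S, {([p], [q])})}
  selections_finite := by simp
  contexts_finite := by
    rintro _ (rfl | rfl)
    · exact (A.finite_toSet.image _).union (A.finite_toSet.image _)
    · exact Set.finite_singleton _
  contexts_over := by
    rintro _ (rfl | rfl) x hx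
    · rcases hx with ⟨a, ha, rfl⟩ | ⟨a, ha, rfl⟩ <;> simp [hA ha]
    · rcases hx with rfl
      simp
  contexts_ne := by
    rintro _ (rfl | rfl) x hx
    · rcases hx with ⟨a, ha, rfl⟩ | ⟨a, ha, rfl⟩ <;> simp
    · rcases hx with rfl
      simp
  initial := {w₀}
  initial_finite := Set.finite_singleton _
  initial_over := by
    rintro w rfl a ha
    simp [hw₀ a ha]

/-- The words over `A` around the factor `w₀`. -/
def around (A : Finset α) (w₀ : List α) : Language α :=
  {w | ∃ s ∈ words A, ∃ t ∈ words A, w = s ++ w₀ ++ t}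

theorem around_le_words {A B : Finset α} {w₀ : List α} (hA : A ⊆ B) (hw₀ : w₀ ∈ words B) :
    around A w₀ ≤ words B := by
  rintro _ ⟨s, hs, t, ht, rfl⟩
  exact append_mem_words.2 ⟨append_mem_words.2 ⟨words_mono hA hs, hw₀⟩, words_mono hA ht⟩

/-- A factor of `c^n p w q d^n` without `p` and `q` belongs to one of the three zones. -/
theorem factor_zone {c d p q : α} {s f t w : List α} {n m : ℕ} (hpf : p ∉ f) (hqf : q ∉ f)
    (h : s ++ f ++ t = List.replicate n c ++ p :: (w ++ q :: List.replicate m d)) :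
    (∀ e ∈ f, e = c) ∨ (∀ e ∈ f, e ∈ w) ∨ ∀ e ∈ f, e = d := by
  rcases append_eq_append_cons_cases h hpf with ⟨t', h⟩ | ⟨s', h⟩
  · exact Or.inl fun e he => List.eq_of_mem_replicate (n := n) (by rw [h]; simp [he])
  · rcases append_eq_append_cons_cases h.symm hqf with ⟨t', h⟩ | ⟨s', h⟩
    · exact Or.inr (Or.inl fun e he => by rw [h]; simp [he])
    · exact Or.inr (Or.inr fun e he => List.eq_of_mem_replicate (n := m) (by rw [h]; simp [he]))

section Snapshot

variable [DecidableEq α] {A B : Finset α} {w₀ : List α} (hA : A ⊆ B) (hw₀ : w₀ ∈ words B)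
  {c d p q : α} {S : Language α}

theorem snapshotGrammar_inStep {x y : List α} :
    (snapshotGrammar hA hw₀ c d p q S).InStep x y ↔ ∃ x₁ x₂ x₃, x = x₁ ++ x₂ ++ x₃ ∧
      ((x₂ ∈ words (insert c (insert d (insert p (insert q B)))) ∧ ∃ a ∈ A,
        y = x₁ ++ [c, a] ++ x₂ ++ [d] ++ x₃ ∨ y = x₁ ++ [c] ++ x₂ ++ [a, d] ++ x₃) ∨
      x₂ ∈ S ∧ y = x₁ ++ [p] ++ x₂ ++ [q] ++ x₃) := by
  constructor
  · rintro ⟨x₁, x₂, x₃, h, _, rfl | rfl, hx₂, k, hk, rfl⟩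
    · rcases hk with ⟨a, ha, rfl⟩ | ⟨a, ha, rfl⟩
      · exact ⟨x₁, x₂, x₃, h, Or.inl ⟨hx₂, a, ha, Or.inl rfl⟩⟩
      · exact ⟨x₁, x₂, x₃, h, Or.inl ⟨hx₂, a, ha, Or.inr rfl⟩⟩
    · rcases hk with rfl
      exact ⟨x₁, x₂, x₃, h, Or.inr ⟨hx₂, rfl⟩⟩
  · rintro ⟨x₁, x₂, x₃, h, ⟨hx₂, a, ha, rfl | rfl⟩ | ⟨hx₂, rfl⟩⟩
    · exact ⟨x₁, x₂, x₃, h, _, Or.inl rfl, hx₂, _, Or.inl ⟨a, ha, rfl⟩, rfl⟩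
    · exact ⟨x₁, x₂, x₃, h, _, Or.inl rfl, hx₂, _, Or.inr ⟨a, ha, rfl⟩, rfl⟩
    · exact ⟨x₁, x₂, x₃, h, _, Or.inr rfl, hx₂, _, rfl, rfl⟩

/-- Each context of the snapshot grammar contains as many letters `c` as `d`, as many `p` as `q`,
as many letters of `A` as `c`, and no letter of `B \ A`. -/
theorem snapshotGrammar_counts (hf : Fresh B c d p q) {z : List α}
    (hz : z ∈ (snapshotGrammar hA hw₀ c d p q S).inLanguage) :
    z.count d = z.count c ∧ z.count q = z.count p ∧
      z.countP (· ∈ A) = z.count c + w₀.countP (· ∈ A) ∧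
      z.countP (· ∈ B \ A) = w₀.countP (· ∈ B \ A) := by
  obtain ⟨hcd, hcp, hcq, hdp, hdq, hpq, hc, hd, hp, hq⟩ := hf
  obtain ⟨x, hx, hz⟩ := hz
  have hB : ∀ e, e ∉ B → w₀.count e = 0 := fun e he => List.count_eq_zero.2 fun h => he (hw₀ e h)
  have hA' : ∀ e, e ∉ B → e ∉ A := fun e he h => he (hA h)
  induction hz with
  | refl =>
    rcases (show x = w₀ from hx) with rfl
    simp [hB c hc, hB d hd, hB p hp, hB q hq]
  | tail _ hst ih =>
    obtain ⟨x₁, x₂, x₃, rfl, h'⟩ := (snapshotGrammar_inStep hA hw₀).1 hst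
    simp only [List.count_append, List.countP_append] at ih
    have key : ∀ y, (∃ u v, y = x₁ ++ u ++ x₂ ++ v ++ x₃ ∧
        (u ++ v).count d = (u ++ v).count c ∧ (u ++ v).count q = (u ++ v).count p ∧
        (u ++ v).countP (· ∈ A) = (u ++ v).count c ∧ (u ++ v).countP (· ∈ B \ A) = 0) →
        y.count d = y.count c ∧ y.count q = y.count p ∧
      y.countP (· ∈ A) = y.count c + w₀.countP (· ∈ A) ∧
      y.countP (· ∈ B \ A) = w₀.countP (· ∈ B \ A) := by
      rintro _ ⟨u, v, rfl, huv⟩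
      simp only [List.count_append, List.countP_append] at huv ⊢
      omega
    apply key
    rcases h' with ⟨-, a, ha, h'⟩ | ⟨-, rfl⟩
    · have e1 : ∀ e, e ∉ B → ¬ a = e := fun e he h => he (h ▸ hA ha)
      rcases h' with rfl | rfl
      · exact ⟨_, _, rfl, by simp [e1 c hc, e1 d hd, e1 p hp,
          e1 q hq, ha, hA' c hc, hA' d hd, hc, hd, hcd, hcp, hcq, hdp, hdq, hcd.symm]⟩
      · exact ⟨_, _, rfl, by simp [e1 c hc, e1 d hd, e1 p hp,
          e1 q hq, ha, hA' c hc, hA' d hd, hc, hd, hcd, hcp, hcq, hdp, hdq, hcd.symm]⟩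
    · exact ⟨_, _, rfl, by simp [hA' p hp, hA' q hq, hp, hq,
        hpq, hpq.symm, hcp.symm, hcq.symm, hdp.symm, hdq.symm]⟩

theorem build_mem_snapshotGrammar {s t : List α} (hs : s ∈ words A) (ht : t ∈ words A) :
    List.replicate (s.length + t.length) c ++ (s ++ w₀ ++ t) ++
      List.replicate (s.length + t.length) d ∈ (snapshotGrammar hA hw₀ c d p q S).inLanguage := by
  have hAV : A ⊆ insert c (insert d (insert p (insert q B))) := fun a ha => by simp [hA ha]
  have hBV : B ⊆ insert c (insert d (insert p (insert q B))) := fun a ha => by simp [ha]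
  refine ⟨w₀, rfl, ?_⟩
  induction s with
  | nil =>
    induction t using List.reverseRecOn with
    | nil => simpa using .refl
    | append_singleton t a ih =>
      rw [append_mem_words, cons_mem_words] at ht
      refine (ih ht.1).tail ((snapshotGrammar_inStep hA hw₀).2 ⟨List.replicate t.length c, w₀ ++ t,
        List.replicate t.length d, by simp, Or.inl ⟨?_, a, ht.2.1, Or.inr ?_⟩⟩)
      · exact append_mem_words.2 ⟨words_mono hBV hw₀, words_mono hAV ht.1⟩
      · rw [show ([] : List α).length + (t ++ [a]).length = t.length + 1 by simp]
        nth_rw 1 [List.replicate_succ']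
        rw [List.replicate_succ]
        simp
  | cons a s ih =>
    rw [cons_mem_words] at hs
    refine (ih hs.2).tail ((snapshotGrammar_inStep hA hw₀).2
      ⟨List.replicate (s.length + t.length) c, s ++ w₀ ++ t,
      List.replicate (s.length + t.length) d, by simp, Or.inl ⟨?_, a, hs.1, Or.inl ?_⟩⟩)
    · exact append_mem_words.2 ⟨append_mem_words.2 ⟨words_mono hAV hs.2, words_mono hBV hw₀⟩,
        words_mono hAV ht⟩
    · rw [show (a :: s).length + t.length = s.length + t.length + 1 by simp; omega]
      nth_rw 1 [List.replicate_succ']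
      rw [List.replicate_succ]
      simp

theorem test_mem_snapshotGrammar {s t : List α} (hs : s ∈ words A) (ht : t ∈ words A)
    (hS : s ++ w₀ ++ t ∈ S) :
    List.replicate (s.length + t.length) c ++ p :: ((s ++ w₀ ++ t) ++
      q :: List.replicate (s.length + t.length) d) ∈
        (snapshotGrammar hA hw₀ c d p q S).inLanguage := by
  obtain ⟨x, hx, h⟩ := build_mem_snapshotGrammar (c := c) (d := d) (p := p) (q := q) (S := S)
    hA hw₀ hs ht
  exact ⟨x, hx, h.tail ((snapshotGrammar_inStep hA hw₀).2
    ⟨_, s ++ w₀ ++ t, _, rfl, Or.inr ⟨hS, by simp⟩⟩)⟩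

/-- The last step of a derivation of `c^n p w q d^n` inserts `p` and `q`: a context `(ca, d)` or
`(c, ad)` would leave a letter `a` among the `c` or the `d`, or a `c` or `d` on the wrong side. -/
theorem mem_of_test_mem_snapshotGrammar (hf : Fresh B c d p q) {w : List α}
    {n : ℕ} (hw : w ∈ words B) (h : List.replicate n c ++ p :: (w ++ q :: List.replicate n d) ∈
        (snapshotGrammar hA hw₀ c d p q S).inLanguage) : w ∈ S := by
  obtain ⟨hcd, hcp, hcq, hdp, hdq, hpq, hc, hd, hp, hq⟩ := hf
  have hB : ∀ {e w}, e ∉ B → w ∈ words B → e ∉ w := fun he hw h => he (hw _ h)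
  obtain ⟨x, hx, h⟩ := h
  rcases h.cases_tail with h' | ⟨y, -, h⟩
  · rcases (show x = w₀ from hx) with rfl
    exact absurd (h' ▸ by simp) (hB hp hw₀)
  obtain ⟨x₁, x₂, x₃, rfl, ⟨-, a, ha, h | h⟩ | ⟨hx₂, h⟩⟩ := (snapshotGrammar_inStep hA hw₀).1 h
  · have hap : a ≠ p := fun h => hp (h ▸ hA ha)
    have hac : a ≠ c := fun h => hc (h ▸ hA ha)
    rw [List.append_assoc, List.append_assoc, eq_comm] at h
    rcases append_eq_append_cons_cases h (by simp [hcp.symm, hap.symm]) with ⟨t', h⟩ | ⟨s', h⟩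
    · exact absurd (List.eq_of_mem_replicate (h ▸ by simp : a ∈ List.replicate n c)) hac
    · have : c ∈ w ++ q :: List.replicate n d := h ▸ by simp
      simp [hB hc hw, hcq, List.mem_replicate, hcd] at this
  · have haq : a ≠ q := fun h => hq (h ▸ hA ha)
    have had : a ≠ d := fun h => hd (h ▸ hA ha)
    rw [eq_comm, show List.replicate n c ++ p :: (w ++ q :: List.replicate n d) =
      (List.replicate n c ++ p :: w) ++ q :: List.replicate n d by simp] at h
    rcases append_eq_append_cons_cases h (by simp [hdq.symm, haq.symm]) with ⟨t', h⟩ | ⟨s', h⟩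
    · have : d ∈ List.replicate n c ++ p :: w := h ▸ by simp
      simp [hB hd hw, hdp, List.mem_replicate, hcd.symm] at this
    · exact absurd (List.eq_of_mem_replicate (h ▸ by simp : a ∈ List.replicate n d)) had
  · have hp' : p ∉ List.replicate n c := fun h => hcp (List.eq_of_mem_replicate h).symm
    have hp'' : p ∉ w ++ q :: List.replicate n d := by
      simp [hB hp hw, hpq, List.mem_replicate, hdp.symm]
    rw [show x₁ ++ [p] ++ x₂ ++ [q] ++ x₃ = x₁ ++ p :: (x₂ ++ q :: x₃) by simp,
      List.append_cons_inj_of_notMem hp' hp''] at h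
    have h := h.2.2
    rw [List.append_cons_inj_of_notMem (hB hq hw) (fun h => hdq (List.eq_of_mem_replicate h).symm)]
      at h
    exact h.1 ▸ hx₂

/-- Only a rule with `p` in its left and `q` in its right context can lead to `c^n p w q d^n` with
a long word `w`, because contexts without `p` and `q` would have to reach into all three zones. -/
theorem snapshot_last_step (hf : Fresh B c d p q) {w x₁ x₂ x₃ u v : List α} {n : ℕ}
    (hw : w ∈ words B) (hy : x₁ ++ x₂ ++ x₃ ∈ (snapshotGrammar hA hw₀ c d p q S).inLanguage)
    (hz : x₁ ++ u ++ x₂ ++ v ++ x₃ ∈ (snapshotGrammar hA hw₀ c d p q S).inLanguage)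
    (h : x₁ ++ u ++ x₂ ++ v ++ x₃ = List.replicate n c ++ p :: (w ++ q :: List.replicate n d))
    (huv : u ++ v ≠ []) (hl : u.length + v.length < w.length) :
    ∃ x y, x ∈ words A ∧ y ∈ words A ∧ w = x ++ x₂ ++ y ∧
      u = List.replicate (x.length + y.length) c ++ p :: x ∧
      v = y ++ q :: List.replicate (x.length + y.length) d := by
  have cy := snapshotGrammar_counts hA hw₀ hf hy
  have cz := snapshotGrammar_counts hA hw₀ hf hz
  have hzV := ContextualGrammar.mem_words_of_mem_inLanguage hz
  obtain ⟨hcd, hcp, hcq, hdp, hdq, hpq, hc, hd, hp, hq⟩ := hf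
  have hB : ∀ {e w}, e ∉ B → w ∈ words B → e ∉ w := fun he hw h => he (hw _ h)
  have hA' : ∀ e, e ∉ B → e ∉ A := fun e he h => he (hA h)
  simp only [List.count_append, List.countP_append] at cy cz
  have e1 : (u ++ v).count d = (u ++ v).count c := by simp only [List.count_append]; omega
  have e2 : (u ++ v).count q = (u ++ v).count p := by simp only [List.count_append]; omega
  have e3 : (u ++ v).countP (· ∈ A) = (u ++ v).count c := by
    simp only [List.count_append, List.countP_append]; omega
  have e4 : (u ++ v).countP (· ∈ B \ A) = 0 := by
    simp only [List.countP_append]; omega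
  have huvA : ∀ e ∈ u ++ v, e ∈ B → e ∈ A := by
    intro e he heB
    by_contra heA
    exact List.countP_eq_zero.1 e4 e he (by simp [heB, heA])
  have hpc : (x₁ ++ u ++ x₂ ++ v ++ x₃).count p = 1 := by
    rw [h]
    simp [List.count_eq_zero.2 (hB hp hw), List.count_replicate, hcp, hdp,
      hpq.symm]
  have hcn : ∀ {e}, e ≠ c → e ∉ List.replicate n c := fun he h => he (List.eq_of_mem_replicate h)
  have hdn : ∀ {e}, e ≠ d → e ∉ List.replicate n d := fun he h => he (List.eq_of_mem_replicate h)
  have hpr : p ∉ w ++ q :: List.replicate n d := by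
    simp [hB hp hw, hpq, List.mem_replicate, hdp.symm]
  have inj : ∀ {l r}, l ++ p :: r = List.replicate n c ++ p :: (w ++ q :: List.replicate n d) →
      l = List.replicate n c ∧ r = w ++ q :: List.replicate n d := fun h => by
    rw [eq_comm, List.append_cons_inj_of_notMem (hcn hcp.symm) hpr] at h
    exact ⟨h.1.symm, h.2.2.symm⟩
  have inj' : ∀ {l r}, l ++ q :: r = w ++ q :: List.replicate n d →
      l = w ∧ r = List.replicate n d := fun h => by
    rw [eq_comm, List.append_cons_inj_of_notMem (hB hq hw) (hdn hdq.symm)] at h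
    exact ⟨h.1.symm, h.2.2.symm⟩
  -- if the context contains `p`, it contains `q`; both in one component would enclose all of `w`
  by_cases hp' : p ∈ u ++ v
  · have hp1 : 1 ≤ (u ++ v).count p := List.count_pos_iff.2 hp'
    have hq' : q ∈ u ++ v := List.count_pos_iff.1 (e2 ▸ hp1)
    rcases List.mem_append.1 hp' with hpu | hpv
    · obtain ⟨i, k, rfl⟩ := List.append_of_mem hpu
      have h1 := inj (l := x₁ ++ i) (r := k ++ x₂ ++ v ++ x₃) (by simpa using h)
      have hqi : q ∉ i := fun hqi => hcn hcq.symm (h1.1 ▸ List.mem_append_right x₁ hqi)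
      by_cases hqk : q ∈ k
      · obtain ⟨k, k', rfl⟩ := List.append_of_mem hqk
        have h2 := inj' (l := k) (r := k' ++ x₂ ++ v ++ x₃) (by simpa using h1.2)
        rw [h2.1] at hl
        simp at hl
        omega
      · have hqv : q ∈ v := by simpa [hqi, hqk, hpq.symm] using hq'
        obtain ⟨m, j, rfl⟩ := List.append_of_mem hqv
        have h2 := inj' (l := k ++ x₂ ++ m) (r := j ++ x₃) (by simpa using h1.2)
        have hk : k ∈ words B := fun e he => hw e (h2.1 ▸ by simp [he])
        have hm : m ∈ words B := fun e he => hw e (h2.1 ▸ by simp [he])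
        have hkA : k ∈ words A := fun e he => huvA e (by simp [he]) (hk e he)
        have hmA : m ∈ words A := fun e he => huvA e (by simp [he]) (hm e he)
        have hi := (List.append_eq_replicate_iff.1 h1.1).2.2
        have hj := (List.append_eq_replicate_iff.1 h2.2).2.1
        have hkc := List.countP_eq_length.2 fun e (he : e ∈ k) => decide_eq_true (hkA e he)
        have hmc := List.countP_eq_length.2 fun e (he : e ∈ m) => decide_eq_true (hmA e he)
        rw [hi, hj] at e1 e3
        simp [List.count_replicate, List.countP_replicate,
          List.count_eq_zero.2 (hB hc hk), List.count_eq_zero.2 (hB hc hm),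
          List.count_eq_zero.2 (hB hd hk), List.count_eq_zero.2 (hB hd hm), hA' c hc, hA' d hd,
          hA' p hp, hA' q hq, hkc, hmc, hcd, hcd.symm, hcp.symm, hcq.symm, hdp.symm,
          hdq.symm] at e1 e3
        refine ⟨k, m, hkA, hmA, h2.1.symm, ?_, ?_⟩
        · rw [e3, ← hi]
        · rw [e3, ← e1, ← hj]
    · obtain ⟨i, k, rfl⟩ := List.append_of_mem hpv
      have h1 := inj (l := x₁ ++ u ++ x₂ ++ i) (r := k ++ x₃) (by simpa using h)
      have hqi : q ∉ i := fun hqi => hcn hcq.symm (h1.1 ▸ by simp [hqi])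
      have hqu : q ∉ u := fun hqi => hcn hcq.symm (h1.1 ▸ by simp [hqi])
      have hqk : q ∈ k := by simpa [hqi, hqu, hpq.symm] using hq'
      obtain ⟨k, k', rfl⟩ := List.append_of_mem hqk
      have h2 := inj' (l := k) (r := k' ++ x₃) (by simpa using h1.2)
      rw [h2.1] at hl
      simp at hl
      omega
  · -- otherwise it contains `c`, `d` and a letter of `A`, but `u` and `v` meet one zone each
    have hq' : q ∉ u ++ v := by
      rwa [← List.count_eq_zero, e2, List.count_eq_zero]
    have hp2 := List.mem_append.not.1 hp'
    have hq2 := List.mem_append.not.1 hq'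
    push Not at hp2 hq2
    have zu := factor_zone (s := x₁) (t := x₂ ++ v ++ x₃) hp2.1 hq2.1 (by simpa using h)
    have zv := factor_zone (s := x₁ ++ u ++ x₂) (t := x₃) hp2.2 hq2.2 h
    have hlet : ∀ e ∈ u ++ v, e = c ∨ e ∈ A ∨ e = d := by
      intro e he
      have hwA : e ∈ w → e ∈ A := fun hew => huvA e he (hw e hew)
      rcases List.mem_append.1 he with he | he
      · rcases zu with zu | zu | zu
        · exact Or.inl (zu e he)
        · exact Or.inr (Or.inl (hwA (zu e he)))
        · exact Or.inr (Or.inr (zu e he))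
      · rcases zv with zu | zu | zu
        · exact Or.inl (zu e he)
        · exact Or.inr (Or.inl (hwA (zu e he)))
        · exact Or.inr (Or.inr (zu e he))
    have hpos : 0 < (u ++ v).count c := by
      by_contra h0
      obtain ⟨e, he⟩ := List.exists_mem_of_ne_nil _ huv
      rcases hlet e he with rfl | heA | rfl
      · exact h0 (List.count_pos_iff.2 he)
      · exact h0 (e3 ▸ List.countP_pos_iff.2 ⟨e, he, by simpa using heA⟩)
      · exact h0 (e1 ▸ List.count_pos_iff.2 he)
    have hcm : c ∈ u ++ v := List.count_pos_iff.1 hpos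
    have hdm : d ∈ u ++ v := List.count_pos_iff.1 (e1 ▸ hpos)
    obtain ⟨a, ham, haA⟩ := List.countP_pos_iff.1 (e3 ▸ hpos)
    have haB : a ∈ B := hA (by simpa using haA)
    have hac : a ≠ c := fun h => hc (h ▸ haB)
    have had : a ≠ d := fun h => hd (h ▸ haB)
    have hzone : ∀ f : List α, ((∀ e ∈ f, e = c) ∨ (∀ e ∈ f, e ∈ w) ∨ ∀ e ∈ f, e = d) →
        ¬ (c ∈ f ∧ d ∈ f) ∧ ¬ (c ∈ f ∧ a ∈ f) ∧ ¬ (d ∈ f ∧ a ∈ f) := by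
      rintro f (z | z | z)
      · exact ⟨fun h => hcd (z d h.2).symm, fun h => hac (z a h.2), fun h => hcd (z d h.1).symm⟩
      · exact ⟨fun h => hB hc hw (z c h.1), fun h => hB hc hw (z c h.1),
          fun h => hB hd hw (z d h.1)⟩
      · exact ⟨fun h => hcd (z c h.1), fun h => hcd (z c h.1), fun h => had (z a h.2)⟩
    have zu' := hzone u zu
    have zv' := hzone v zv
    rw [List.mem_append] at hcm hdm ham
    exfalso
    rcases hcm with h1 | h1 <;> rcases hdm with h2 | h2 <;> rcases ham with h3 | h3 <;>
      first
        | exact zu'.1 ⟨h1, h2⟩ | exact zu'.2.1 ⟨h1, h3⟩ | exact zu'.2.2 ⟨h2, h3⟩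
        | exact zv'.1 ⟨h1, h2⟩ | exact zv'.2.1 ⟨h1, h3⟩ | exact zv'.2.2 ⟨h2, h3⟩

/-- A grammar with selection in `F` for the snapshot language of `S` can test a long word `w` of
`S` only by selecting a factor `w'` of `w` that misses bounded ends, and it cannot distinguish `w'`
from the other words of its selection language. -/
theorem exists_selection_of_snapshot (hf : Fresh B c d p q) {F : Family α}
    (h : (snapshotGrammar hA hw₀ c d p q S).inLanguage ∈ IC F) :
    ∃ (K : ℕ) (𝒯 : Set (Language α)), 𝒯.Finite ∧ (∀ T ∈ 𝒯, ∃ U : Finset α, F U T) ∧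
      ∀ w ∈ S, w ∈ around A w₀ → K < w.length → ∃ T ∈ 𝒯, ∃ x y w', w = x ++ w' ++ y ∧
        x.length ≤ K ∧ y.length ≤ K ∧ x ∈ words A ∧ y ∈ words A ∧ w' ∈ T ∧
        ∀ w'' ∈ T, w'' ∈ around A w₀ → x ++ w'' ++ y ∈ S := by
  obtain ⟨G, hG, hGL⟩ := h
  obtain ⟨K₁, hK₁⟩ := exists_length_bound G.initial_finite
  obtain ⟨K₂, hK₂⟩ := exists_length_bound
    ((G.selections_finite.biUnion G.contexts_finite).image fun k => k.1 ++ k.2)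
  refine ⟨K₁ + K₂, Prod.fst '' G.selections, G.selections_finite.image _, ?_, ?_⟩
  · rintro _ ⟨r, hr, rfl⟩
    obtain ⟨U, -, -, hU⟩ := hG r hr
    exact ⟨U, hU⟩
  intro w hwS hw hK
  obtain ⟨s, hs, t, ht, hwst⟩ := id hw
  have hwB := around_le_words hA hw₀ hw
  have hz := test_mem_snapshotGrammar (c := c) (d := d) (p := p) (q := q) hA hw₀ hs ht
    (hwst ▸ hwS)
  rw [← hwst] at hz
  have hz' := hz
  rw [← hGL] at hz'
  obtain ⟨a, ha, hz'⟩ := hz'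
  rcases hz'.cases_tail with h' | ⟨y, hy, x₁, x₂, x₃, rfl, r, hr, hx₂, k, hk, h'⟩
  · have := hK₁ a ha
    rw [← h'] at this
    simp at this
    omega
  have hy' : x₁ ++ x₂ ++ x₃ ∈ (snapshotGrammar hA hw₀ c d p q S).inLanguage :=
    hGL ▸ ⟨a, ha, hy⟩
  have hkl : k.1.length + k.2.length ≤ K₂ := by
    rw [← List.length_append]
    exact hK₂ _ ⟨k, Set.mem_biUnion hr hk, rfl⟩
  obtain ⟨x, y, hxA, hyA, hxy, hu, hv⟩ := snapshot_last_step hA hw₀ hf hwB hy'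
    (h' ▸ hz) h'.symm (G.contexts_ne r hr k hk) (by omega)
  have hl : x.length + y.length ≤ K₂ := by
    rw [hu, hv] at hkl
    simp at hkl
    omega
  refine ⟨r.1, ⟨r, hr, rfl⟩, x, y, x₂, hxy, by omega, by omega, hxA, hyA, hx₂, ?_⟩
  intro w'' hw''T hw''
  obtain ⟨s', hs', t', ht', hst'⟩ := id hw''
  refine mem_of_test_mem_snapshotGrammar hA hw₀ hf
    (n := s'.length + t'.length + (x.length + y.length)) ?_ ?_
  · exact append_mem_words.2 ⟨append_mem_words.2 ⟨words_mono hA hxA, around_le_words hA hw₀ hw''⟩,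
      words_mono hA hyA⟩
  have hb := build_mem_snapshotGrammar (c := c) (d := d) (p := p) (q := q) (S := S) hA hw₀ hs' ht'
  rw [← hst'] at hb
  rw [← hGL] at hb ⊢
  obtain ⟨a, ha, hb⟩ := hb
  refine ⟨a, ha, hb.tail ⟨_, w'', _, rfl, r, hr, hw''T, k, hk, ?_⟩⟩
  have e1 := List.replicate_add (s'.length + t'.length) (x.length + y.length) (a := c)
  have e2 := List.replicate_add (x.length + y.length) (s'.length + t'.length) (a := d)
  rw [Nat.add_comm] at e2
  rw [hu, hv, e1, e2]
  simp only [List.append_assoc, List.cons_append]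

end Snapshot

/-- Properties of a selection language that hold from some bound on hold uniformly for the finitely
many selection languages of a grammar. -/
theorem exists_uniform_bound {ι : Type*} {s : Set ι} (hs : s.Finite) {P : ι → ℕ → Prop}
    (hP : ∀ i m n, m ≤ n → P i m → P i n) (h : ∀ i ∈ s, ∃ n, P i n) : ∃ n, ∀ i ∈ s, P i n := by
  choose! f hf using h
  obtain ⟨n, hn⟩ := (hs.image f).bddAbove
  exact ⟨n, fun i hi => hP i _ _ (hn ⟨i, hi, rfl⟩) (hf i hi)⟩

/-- If `IC F' ⊆ IC F`, then a selection language `S ∈ F'` has long words only for the reason that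
they have long inner factors that belong to a language `T ∈ F`, whose words all yield words of
`S`. -/
theorem exists_selection_of_IC_subset [Infinite α] {F F' : Family α} (h : IC F' ⊆ IC F)
    (hwords : ∀ V : Finset α, F' V (words V)) {A B : Finset α} {w₀ : List α} (hA : A ⊆ B)
    (hw₀ : w₀ ∈ words B) (hB : B.Nonempty) {S : Language α} (hS : F' B S) :
    ∃ (K : ℕ) (𝒯 : Set (Language α)), 𝒯.Finite ∧ (∀ T ∈ 𝒯, ∃ U : Finset α, F U T) ∧
      ∀ w ∈ S, w ∈ around A w₀ → K < w.length → ∃ T ∈ 𝒯, ∃ x y w', w = x ++ w' ++ y ∧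
        x.length ≤ K ∧ y.length ≤ K ∧ x ∈ words A ∧ y ∈ words A ∧ w' ∈ T ∧
        ∀ w'' ∈ T, w'' ∈ around A w₀ → x ++ w'' ++ y ∈ S := by
  classical
  obtain ⟨c, d, p, q, hf⟩ := exists_fresh B
  refine exists_selection_of_snapshot hA hw₀ hf (h ⟨snapshotGrammar hA hw₀ c d p q S, ?_, rfl⟩)
  rintro _ (rfl | rfl)
  · exact ⟨_, ⟨c, Finset.mem_insert_self _ _⟩, subset_rfl, hwords _⟩
  · exact ⟨B, hB, fun a ha => by simp [snapshotGrammar, ha], hS⟩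

theorem eq_append_of_append_eq_append {x w' y s m t : List α} (h : x ++ w' ++ y = s ++ m ++ t)
    (hx : x.length ≤ s.length) (hy : y.length ≤ t.length) :
    ∃ s' t', s = x ++ s' ∧ t = t' ++ y ∧ w' = s' ++ m ++ t' := by
  obtain ⟨s', rfl⟩ : x <+: s := List.prefix_of_prefix_length_le
    ⟨w' ++ y, by simpa using h⟩ ⟨m ++ t, by simp⟩ hx
  obtain ⟨t', rfl⟩ : y <:+ t := List.suffix_of_suffix_length_le
    ⟨x ++ w', h⟩ ⟨x ++ s' ++ m, by simp⟩ hy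
  refine ⟨s', t', rfl, rfl, ?_⟩
  have h1 : x ++ (w' ++ y) = x ++ (s' ++ m ++ t' ++ y) := by simpa using h
  exact List.append_cancel_right (List.append_cancel_left h1)

/-! ### Separating languages obtained from selection languages -/

/-- The most convenient form of `exists_selection_of_IC_subset`: a word `smt` of `S` with long `s`
and `t` is derived by a rule whose selected word contains the factor `m`. -/
theorem exists_selection_of_factor [Infinite α] {F F' : Family α} (h : IC F' ⊆ IC F)
    (hwords : ∀ V : Finset α, F' V (words V)) {B : Finset α} (hB : B.Nonempty) {S : Language α}
    (hS : F' B S) (hSB : S ≤ words B) :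
    ∃ (K : ℕ) (𝒯 : Set (Language α)), 𝒯.Finite ∧ (∀ T ∈ 𝒯, ∃ U : Finset α, F U T) ∧
      ∀ s m t, s ++ m ++ t ∈ S → K ≤ s.length → K ≤ t.length → m ≠ [] →
        ∃ T ∈ 𝒯, ∃ x s' t' y, s = x ++ s' ∧ t = t' ++ y ∧ s' ++ m ++ t' ∈ T ∧
          ∀ w ∈ T, w ∈ words B → x ++ w ++ y ∈ S := by
  obtain ⟨K, 𝒯, hfin, hF, hsel⟩ := exists_selection_of_IC_subset h hwords (subset_refl B)
    (nil_mem_words B) hB hS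
  have haround : ∀ w ∈ words B, w ∈ around B ([] : List α) := fun w hw =>
    ⟨w, hw, [], nil_mem_words B, by simp⟩
  refine ⟨K, 𝒯, hfin, hF, fun s m t hw hs ht hm => ?_⟩
  have hl := List.length_pos_iff.2 hm
  obtain ⟨T, hT, x, y, w', hxy, hx, hy, -, -, hw', hmem⟩ := hsel _ hw (haround _ (hSB hw))
    (by simp only [List.length_append]; omega)
  obtain ⟨s', t', hs', ht', rfl⟩ := eq_append_of_append_eq_append hxy.symm (hx.trans hs)
    (hy.trans ht)
  exact ⟨T, hT, x, s', t', y, hs', ht', hw', fun w hw hwB => hmem w hw (haround w hwB)⟩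

theorem SYDEF_words (V : Finset α) : SYDEF V (words V) :=
  ⟨.words V, 1, 1, .one, .one, by simp⟩

theorem append_cons_inj {l r l' r' : List α} {p p' : α} (h : l ++ p :: r = l' ++ p' :: r')
    (hp' : p' ∉ l) (hp : p ∉ l') : l = l' ∧ p = p' ∧ r = r' := by
  induction l generalizing l' with
  | nil =>
    cases l' with
    | nil => simpa using h
    | cons e l' => exact absurd (List.cons.inj h).1 (by simp at hp; exact hp.1)
  | cons e l ih =>
    cases l' with
    | nil => exact absurd (List.cons.inj h).1.symm (by simp at hp'; exact hp'.1)
    | cons e' l' =>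
      obtain ⟨rfl, h'⟩ := List.cons.inj h
      simp only [List.mem_cons, not_or] at hp hp'
      obtain ⟨rfl, h''⟩ := ih h' hp'.2 hp.2
      exact ⟨rfl, h''⟩

theorem append_cons_inj_right {l r l' r' : List α} {p p' : α} (h : l ++ p :: r = l' ++ p' :: r')
    (hp' : p' ∉ r) (hp : p ∉ r') : l = l' ∧ p = p' ∧ r = r' := by
  have h2 := congrArg List.reverse h
  simp only [List.reverse_append, List.reverse_cons, List.append_assoc, List.singleton_append] at h2
  obtain ⟨h3, h4, h5⟩ := append_cons_inj h2 (by simpa using hp') (by simpa using hp)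
  exact ⟨List.reverse_injective h5, h4, List.reverse_injective h3⟩

theorem mem_words_singleton {a : α} {w : List α} :
    w ∈ words {a} ↔ w = List.replicate w.length a := by
  simp [mem_words, List.eq_replicate_iff]

/-- Finitely many finite languages cannot contain arbitrarily long selected words. -/
theorem not_IC_MON_subset_FIN [Infinite α] : ¬ IC (α := α) MON ⊆ IC FIN := by
  intro h
  obtain ⟨a⟩ : Nonempty α := inferInstance
  obtain ⟨K, 𝒯, hfin, hF, hsel⟩ := exists_selection_of_factor h MON_words
    (Finset.singleton_nonempty a) (MON_words {a}) le_rfl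
  obtain ⟨N, hN⟩ := exists_uniform_bound hfin (P := fun T n => ∀ w ∈ T, w.length ≤ n)
    (fun T m n hmn h w hw => (h w hw).trans hmn) fun T hT => by
      obtain ⟨U, hU⟩ := hF T hT
      exact exists_length_bound hU.2
  have ha : a ∈ ({a} : Finset α) := by simp
  obtain ⟨T, hT, x, s', t', y, -, -, hw, -⟩ := hsel (List.replicate K a)
    (List.replicate (N + 1) a) (List.replicate K a)
    (by simp only [append_mem_words]; simp [replicate_mem_words]) (by simp) (by simp) (by simp)
  have := hN T hT _ hw
  simp only [List.length_append, List.length_replicate] at this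
  omega

/-- In a derivation of the snapshot language of `{a, b}^* b`, the words `a^n b` can be selected only
as words `a^m b`, up to their beginning. -/
theorem exists_selection_of_IC_COMB_subset [Infinite α] {F : Family α} (h : IC COMB ⊆ IC F)
    {a b : α} (hab : a ≠ b) :
    ∃ (K : ℕ) (𝒯 : Set (Language α)), 𝒯.Finite ∧ (∀ T ∈ 𝒯, ∃ U : Finset α, F U T) ∧
      ∀ n, K ≤ n → ∃ T ∈ 𝒯, ∃ m, n ≤ m + K ∧ List.replicate m a ++ [b] ∈ T ∧
        ∀ s t, s ∈ words {a} → t ∈ words {a} → s ++ [b] ++ t ∈ T → t = [] := by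
  classical
  have hS : COMB {a, b} (words {a, b} * letters {b}) := by
    refine ⟨(RegularOver.words _).mul ?_, {b}, by simp, rfl⟩
    rw [mem_letters_singleton]
    exact .singleton (by simp)
  have hb : [b] ∈ words ({a, b} : Finset α) := by simp
  obtain ⟨K, 𝒯, hfin, hF, hsel⟩ := exists_selection_of_IC_subset (A := {a}) (w₀ := [b])
    (IC_mon_or_comb_subset.trans h) (fun V => Or.inl (MON_words V)) (by simp) hb (by simp)
    (Or.inr hS)
  have hlast : ∀ w, w ∈ words {a, b} * letters {b} → w.getLast? = some b := by
    rintro _ ⟨x, -, _, ⟨e, rfl, rfl⟩, rfl⟩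
    simp
  have hlast' : ∀ s t, t ∈ words ({a} : Finset α) → (s ++ t).getLast? = some b → t = [] := by
    intro s t ht h
    by_contra h0
    rw [List.getLast?_append_of_ne_nil _ h0, List.getLast?_eq_some_getLast h0] at h
    have := ht _ (List.getLast_mem h0)
    rw [Option.some.inj h] at this
    exact hab (Finset.mem_singleton.1 this).symm
  refine ⟨K, 𝒯, hfin, hF, fun n hn => ?_⟩
  have ha : a ∈ ({a} : Finset α) := by simp
  have hw : List.replicate n a ++ [b] ∈ words {a, b} * letters {b} :=
    ⟨_, replicate_mem_words (by simp) n, [b], ⟨b, rfl, rfl⟩, rfl⟩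
  obtain ⟨T, hT, x, y, w', hxy, hx, hy, hxA, hyA, hw', hmem⟩ := hsel _ hw
    ⟨_, replicate_mem_words ha n, [], nil_mem_words _, by simp⟩ (by simp; omega)
  obtain rfl := hlast' _ y hyA (by rw [← hxy]; simp)
  obtain ⟨s', t', hs', ht', rfl⟩ := eq_append_of_append_eq_append (m := [b]) (t := [])
    (by simpa using hxy.symm) (by simpa using hx.trans hn) le_rfl
  obtain rfl : t' = [] := by simpa using ht'.symm
  have h2 := (List.append_eq_replicate_iff.1 hs'.symm)
  refine ⟨T, hT, s'.length, ?_, ?_, ?_⟩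
  · omega
  · rw [← h2.2.2]
    simpa using hw'
  · intro s t hs ht hst
    have := hlast _ (hmem _ hst ⟨s, hs, t, ht, rfl⟩)
    rw [List.append_nil, ← List.append_assoc] at this
    exact hlast' _ t ht this

/-- A nilpotent language with a long word `a^m b` contains `a^n ba` for large `n`. -/
theorem not_IC_COMB_subset_NIL [Infinite α] : ¬ IC (α := α) COMB ⊆ IC NIL := by
  intro h
  obtain ⟨a, b, hab⟩ := exists_pair_ne α
  obtain ⟨K, 𝒯, hfin, hF, hsel⟩ := exists_selection_of_IC_COMB_subset h hab
  obtain ⟨N, hN⟩ := exists_uniform_bound hfin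
    (P := fun T n => (∀ w ∈ T, w.length ≤ n) ∨ ∃ U, T ≤ words U ∧ ∀ w ∈ words U, n < w.length →
      w ∈ T)
    (fun T m n hmn h => h.imp (fun h w hw => (h w hw).trans hmn)
      fun ⟨U, hU, h⟩ => ⟨U, hU, fun w hw hl => h w hw (hmn.trans_lt hl)⟩) fun T hT => by
      obtain ⟨U, hU, hf | hf⟩ := hF T hT
      · obtain ⟨n, hn⟩ := exists_length_bound hf
        exact ⟨n, Or.inl hn⟩
      · obtain ⟨n, hn⟩ := exists_length_bound hf
        refine ⟨n, Or.inr ⟨U, hU.1, fun w hw hl => ?_⟩⟩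
        by_contra hwT
        exact absurd (hn w ⟨hw, hwT⟩) (by omega)
  obtain ⟨T, hT, m, hm, hmT, hT'⟩ := hsel (K + N + 1) (by omega)
  rcases hN T hT with hl | ⟨U, hTU, hU⟩
  · have := hl _ hmT
    simp at this
    omega
  · have haU : List.replicate m a ++ [b] ∈ words U := hTU hmT
    rw [append_mem_words] at haU
    have ha : a ∈ U := haU.1 a (by simp; omega)
    have hst := hU (List.replicate N a ++ [b] ++ [a])
      (by simp [ha, replicate_mem_words ha N]; exact haU.2 b (by simp)) (by simp)
    have := hT' _ [a] (replicate_mem_words (by simp) N) (by simp) hst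
    simp at this

/-- A circular language with the word `a^m b` contains `ba^m`. -/
theorem not_IC_COMB_subset_CIRC [Infinite α] : ¬ IC (α := α) COMB ⊆ IC CIRC := by
  intro h
  obtain ⟨a, b, hab⟩ := exists_pair_ne α
  obtain ⟨K, 𝒯, hfin, hF, hsel⟩ := exists_selection_of_IC_COMB_subset h hab
  obtain ⟨T, hT, m, hm, hmT, hT'⟩ := hsel (K + 1) (by omega)
  obtain ⟨U, hU⟩ := hF T hT
  have := hT' [] _ (nil_mem_words _) (replicate_mem_words (by simp) m) (hU.2 _ _ hmT)
  simp at this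
  omega

theorem ORD_contains [DecidableEq α] (V : Finset α) (b : α) :
    ORD V (words V ⊓ {w | b ∈ w}) := by
  let M : DFA α Bool := ⟨fun z c => z || decide (c = b), false, {true}⟩
  have hM : ∀ w z, M.evalFrom z w = (z || decide (b ∈ w)) := by
    intro w
    induction w with
    | nil => simp
    | cons c w ih =>
      intro z
      change M.evalFrom (M.step z c) w = _
      rw [ih]
      simp [M, Bool.or_assoc, eq_comm]
  have hacc : ∀ w, w ∈ M.accepts ↔ b ∈ w := fun w => by
    change M.evalFrom false w ∈ ({true} : Set Bool) ↔ _
    simp [hM]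
  have hreg : Language.IsRegular ({w | b ∈ w} : Language α) :=
    ⟨Bool, inferInstance, M, Language.ext hacc⟩
  refine ⟨.inf_words hreg, Bool, inferInstance, inferInstance, M, fun a _ z z' hz => ?_,
    fun w => ?_⟩
  · simp only [M]
    cases z <;> cases z' <;> cases decide (a = b) <;> simp_all
  · rw [hacc]
    exact Iff.rfl

/-- The words that contain `b`: a definite language cannot see a letter `b` far from the end. -/
theorem not_IC_ORD_subset_DEF [Infinite α] : ¬ IC (α := α) ORD ⊆ IC DEF := by
  classical
  intro h
  obtain ⟨a, b, hab⟩ := exists_pair_ne α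
  obtain ⟨K, 𝒯, hfin, hF, hsel⟩ := exists_selection_of_factor h
    (fun V => (MON_words V).nil.def.ord) (B := {a, b}) (by simp) (ORD_contains _ b) inf_le_left
  obtain ⟨N, hN⟩ := exists_uniform_bound hfin
    (P := fun T n => ∃ (U : Finset α) (C D : Language α), T = C + words U * D ∧
      (∀ w ∈ C, w.length ≤ n) ∧ ∀ w ∈ D, w.length ≤ n)
    (fun T m n hmn ⟨U, C, D, h, hC, hD⟩ => ⟨U, C, D, h, fun w hw => (hC w hw).trans hmn,
      fun w hw => (hD w hw).trans hmn⟩) fun T hT => by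
      obtain ⟨U, -, C, D, -, -, hC, hD, h⟩ := hF T hT
      obtain ⟨m, hm⟩ := exists_length_bound hC
      obtain ⟨n, hn⟩ := exists_length_bound hD
      exact ⟨m + n, U, C, D, h, fun w hw => (hm w hw).trans (by omega),
        fun w hw => (hn w hw).trans (by omega)⟩
  have ha : ∀ n, List.replicate n a ∈ words {a, b} := replicate_mem_words (by simp)
  have hb : ∀ n, b ∉ List.replicate n a := fun n h => hab (List.eq_of_mem_replicate h).symm
  obtain ⟨T, hT, x, s', t', y, hs, ht, hw, hmem⟩ := hsel (List.replicate K a)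
    ([b] ++ List.replicate (N + 1) a) (List.replicate K a)
    ⟨by
      change _ ∈ words {a, b}
      simp only [append_mem_words]
      exact ⟨⟨ha _, by simp, ha _⟩, ha _⟩, by change b ∈ (_ : List α); simp⟩
    (by simp) (by simp) (by simp)
  obtain ⟨U, C, D, rfl, hC, hD⟩ := hN T hT
  rcases hw with hw | ⟨u, hu, v, hv, huv⟩
  · have := hC _ hw
    simp only [List.length_append, List.length_replicate] at this
    omega
  have hlv := hD v hv
  have huv : u ++ v = s' ++ [b] ++ (List.replicate (N + 1) a ++ t') := by simpa using huv
  obtain ⟨r, hr⟩ : v <:+ List.replicate (N + 1) a ++ t' := List.suffix_of_suffix_length_le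
    ⟨u, huv⟩ ⟨s' ++ [b], rfl⟩ (by simp; omega)
  have hst := ha K
  have hbt := hb K
  rw [ht, append_mem_words] at hst
  rw [ht, List.mem_append, not_or] at hbt
  have hrv : r ++ v ∈ words {a, b} := hr ▸ append_mem_words.2 ⟨ha _, hst.1⟩
  have hbv : b ∉ r ++ v := by rw [hr, List.mem_append, not_or]; exact ⟨hb _, hbt.1⟩
  have hbx := hb K
  rw [hs, List.mem_append, not_or] at hbx
  -- the suffix `v` of the selected word is selected as well, and it contains no `b`
  have hxvy : b ∈ x ++ v ++ y := (hmem v (Or.inr ⟨[], nil_mem_words U, v, hv, rfl⟩)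
    (append_mem_words.1 hrv).2).2
  simp only [List.mem_append, not_or] at hbv hxvy
  tauto

theorem replicate_add_add (i j k : ℕ) (a : α) : List.replicate (i + j + k) a =
    List.replicate i a ++ List.replicate j a ++ List.replicate k a := by
  rw [List.replicate_add, List.replicate_add]

/-- Non-counting selection languages cannot tell odd from even numbers of letters `a` between two
letters `b`. -/
theorem not_IC_subset_NC_of_parity [Infinite α] [DecidableEq α] {F : Family α}
    (hwords : ∀ V : Finset α, F V (words V)) {a b : α} {S : Language α}
    (hS : F {a, b} S) (hSV : S ≤ words {a, b})
    (h0 : ∀ n, b :: (List.replicate (2 * n) a ++ [b]) ∈ S)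
    (h1 : ∀ n, b :: (List.replicate (2 * n + 1) a ++ [b]) ∉ S) : ¬ IC F ⊆ IC NC := by
  intro h
  obtain ⟨K, 𝒯, hfin, hF, hsel⟩ := exists_selection_of_factor h hwords (B := {a, b}) (by simp)
    hS hSV
  obtain ⟨k, hk⟩ := exists_uniform_bound hfin
    (P := fun T n => ∃ U, T ≤ words U ∧ ∀ k, n ≤ k → ∀ x ∈ words U, ∀ y ∈ words U,
      ∀ z ∈ words U, x ++ wordPow y k ++ z ∈ T → x ++ wordPow y (k + 1) ++ z ∈ T)
    (fun T m n hmn ⟨U, hU, h⟩ => ⟨U, hU, fun k hk => h k (hmn.trans hk)⟩) fun T hT => by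
      obtain ⟨U, hU, k, hk, h⟩ := hF T hT
      exact ⟨k, U, hU.1, fun n hn x hx y hy z hz => (NC.iff_of_le h hn hx hy hz).1⟩
  obtain ⟨T, hT, x, s', t', y, hs, ht, hw, hmem⟩ := hsel (b :: List.replicate K a)
    (List.replicate (2 * k + 2) a) (List.replicate K a ++ [b])
    (by
      convert h0 (K + k + 1) using 1
      rw [show 2 * (K + k + 1) = K + (2 * k + 2) + K by ring, replicate_add_add]
      simp only [List.append_assoc, List.cons_append]) (by simp) (by simp) (by simp)
  obtain ⟨U, hTU, hU⟩ := hk T hT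
  have hwU : s' ++ List.replicate (2 * k + 2) a ++ t' ∈ words U := hTU hw
  simp only [append_mem_words] at hwU
  have haU : [a] ∈ words U := fun e he => hwU.1.2 e (by simp at he; simp [he])
  rw [← wordPow_singleton] at hw
  have hw' := hU _ (by omega) s' hwU.1.1 [a] haU t' hwU.2 hw
  have hst : b :: List.replicate K a ∈ words {a, b} ∧ List.replicate K a ++ [b] ∈ words {a, b} := by
    simp [replicate_mem_words]
  rw [hs, ht, append_mem_words, append_mem_words] at hst
  have := hmem _ hw' (by
    simp only [append_mem_words]
    exact ⟨⟨hst.1.2, wordPow_mem_words (by simp) _⟩, hst.2.1⟩)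
  refine h1 (K + k + 1) ?_
  convert this using 1
  rw [wordPow_singleton, show x ++ (s' ++ List.replicate (2 * k + 2 + 1) a ++ t') ++ y =
    x ++ s' ++ List.replicate (2 * k + 2 + 1) a ++ (t' ++ y) by simp, ← hs, ← ht,
    show 2 * (K + k + 1) + 1 = K + (2 * k + 2 + 1) + K by ring, replicate_add_add]
  simp only [List.append_assoc, List.cons_append]

theorem mem_kstar_pair {a b : α} {w : List α} :
    w ∈ ({[a, b]} : Language α)∗ ↔ ∃ n, w = wordPow [a, b] n := by
  constructor
  · rintro ⟨l, rfl, hl⟩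
    refine ⟨l.length, ?_⟩
    rw [wordPow, ← List.eq_replicate_iff.2 ⟨rfl, hl⟩]
  · rintro ⟨n, rfl⟩
    exact wordPow_mem_kstar (show [a, b] ∈ ({[a, b]} : Language α) from rfl) n

theorem wordPow_pair_self (a : α) (n : ℕ) : wordPow [a, a] n = List.replicate (2 * n) a := by
  rw [← wordPow_singleton]
  induction n with
  | zero => rfl
  | succ n ih => rw [wordPow_succ, ih, Nat.mul_succ, wordPow_succ, wordPow_succ]; rfl

theorem regularOver_even_block [DecidableEq α] (a b : α) :
    RegularOver {a, b} ({[b]} * ({[a, a]} : Language α)∗ * {[b]}) :=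
  .mul (.mul (.singleton (by simp)) (.kstar (.singleton (by simp)))) (.singleton (by simp))

/-- The language `b(aa)^*b{a, b}^*` is symmetric definite and tests the parity. -/
theorem not_IC_SYDEF_subset_NC [Infinite α] : ¬ IC (α := α) SYDEF ⊆ IC NC := by
  classical
  obtain ⟨a, b, hab⟩ := exists_pair_ne α
  have hE := regularOver_even_block a b
  refine not_IC_subset_NC_of_parity SYDEF_words (a := a) (b := b)
    (S := {[b]} * ({[a, a]} : Language α)∗ * {[b]} * words {a, b} * 1)
    ⟨(hE.mul (.words _)).mul .one, _, 1, hE, .one, rfl⟩ ((hE.mul (.words _)).mul .one).1 ?_ ?_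
  · intro n
    rw [mul_one]
    refine ⟨_, ⟨_, ⟨[b], rfl, _, mem_kstar_pair.2 ⟨n, rfl⟩, rfl⟩, [b], rfl, rfl⟩, [],
      nil_mem_words _, ?_⟩
    simp [wordPow_pair_self]
  · rintro n h
    rw [mul_one] at h
    obtain ⟨_, ⟨_, ⟨_, rfl, _, hn, rfl⟩, _, rfl, rfl⟩, t, -, ht⟩ := h
    obtain ⟨m, rfl⟩ := mem_kstar_pair.1 hn
    rw [wordPow_pair_self] at ht
    have ht' : List.replicate (2 * m) a ++ b :: t = List.replicate (2 * n + 1) a ++ b :: [] := by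
      simpa using ht
    have hba : ∀ n, b ∉ List.replicate n a := fun n h => hab (List.eq_of_mem_replicate h).symm
    have := congrArg List.length (append_cons_inj ht' (hba _) (hba _)).1
    simp at this
    omega

/-- Languages given by forbidden infixes are infix-closed. -/
theorem INF_forbidden_infix {V : Finset α} {L : Language α} (hL : L.IsRegular) :
    INF V (words V ⊓ (⊤ * L * ⊤)ᶜ) := by
  refine ⟨.inf_words (isRegular_mul (isRegular_mul isRegular_top hL) isRegular_top).compl,
    fun x hx y hy z hz h => ⟨hy, ?_⟩⟩
  rintro ⟨_, ⟨s, -, t, ht, rfl⟩, r, -, rfl⟩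
  exact h.2 ⟨_, ⟨x ++ s, trivial, t, ht, rfl⟩, r ++ z, trivial, by simp⟩

/-- The words over `{a, b}` without an infix in `b(aa)^*ab` are infix-closed and test the parity. -/
theorem not_IC_INF_subset_NC [Infinite α] : ¬ IC (α := α) INF ⊆ IC NC := by
  classical
  obtain ⟨a, b, hab⟩ := exists_pair_ne α
  have hba : ∀ n, b ∉ List.replicate n a := fun n h => hab (List.eq_of_mem_replicate h).symm
  have hO : RegularOver {a, b} ({[b]} * ({[a, a]} : Language α)∗ * {[a, b]}) :=
    .mul (.mul (.singleton (by simp)) (.kstar (.singleton (by simp)))) (.singleton (by simp))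
  refine not_IC_subset_NC_of_parity (fun V => (MON_words V).inf) (a := a) (b := b)
    (INF_forbidden_infix hO.2) inf_le_left ?_ ?_
  · intro n
    have hV : b :: (List.replicate (2 * n) a ++ [b]) ∈ words {a, b} := by
      simp [replicate_mem_words]
    refine ⟨hV, ?_⟩
    rintro ⟨_, ⟨s, -, _, ⟨_, ⟨_, rfl, _, hm, rfl⟩, _, rfl, rfl⟩, rfl⟩, r, -, hr⟩
    obtain ⟨m, rfl⟩ := mem_kstar_pair.1 hm
    have hr : s ++ b :: (List.replicate (2 * m + 1) a ++ b :: r) =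
        [] ++ b :: (List.replicate (2 * n) a ++ b :: []) := by
      rw [wordPow_pair_self] at hr
      simpa [List.replicate_succ'] using hr
    have hs : b ∉ s := by
      have := congrArg (List.count b) hr
      simp [List.count_replicate, hab] at this
      exact List.count_eq_zero.1 (by omega)
    have := (append_cons_inj (append_cons_inj hr hs (by simp)).2.2 (hba _) (hba _)).1
    have := congrArg List.length this
    simp at this
    omega
  · intro n h
    refine h.2 ⟨_, ⟨[], trivial, _, ⟨_, ⟨[b], rfl, _, mem_kstar_pair.2 ⟨n, rfl⟩, rfl⟩, [a, b], rfl,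
      rfl⟩, rfl⟩, [], trivial, ?_⟩
    simp [wordPow_pair_self, List.replicate_succ']

theorem even_block_STAR [DecidableEq α] (a : α) : STAR {a} (({[a, a]} : Language α)∗) := by
  have h : RegularOver {a} ({[a, a]} : Language α) := .singleton (by simp)
  exact ⟨h.kstar, _, h, rfl⟩

theorem even_block_COMM [DecidableEq α] (a : α) : COMM {a} (({[a, a]} : Language α)∗) := by
  refine ⟨(even_block_STAR a).1, fun w w' hw hp => ?_⟩
  obtain ⟨n, rfl⟩ := mem_kstar_pair.1 hw
  rw [wordPow_pair_self, List.replicate_perm] at hp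
  exact hp ▸ mem_kstar_pair.2 ⟨n, (wordPow_pair_self a n).symm⟩

/-- A power-separating language contains almost all or almost no powers of a letter `a`, so it
cannot test whether their number is even. -/
theorem not_IC_subset_PS_of_even [Infinite α] [DecidableEq α] {F : Family α}
    (hwords : ∀ V : Finset α, F V (words V)) {a : α}
    (hS : F {a} (({[a, a]} : Language α)∗)) : ¬ IC F ⊆ IC PS := by
  intro h
  obtain ⟨K, 𝒯, hfin, hF, hsel⟩ := exists_selection_of_factor h hwords (B := {a}) (by simp)
    hS (even_block_STAR a).1.1
  obtain ⟨N, hN⟩ := exists_uniform_bound hfin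
    (P := fun T n => ∀ e : α, ∀ m k, n ≤ m → n ≤ k → List.replicate m e ∈ T →
      List.replicate k e ∈ T) (fun T m n hmn h e i j hi hj => h e i j (hmn.trans hi) (hmn.trans hj))
    fun T hT => by
      obtain ⟨U, hU, n, hn, h⟩ := hF T hT
      refine ⟨n, fun e i j hi hj hiT => ?_⟩
      have he : [e] ∈ words U := by
        have hiU : List.replicate i e ∈ words U := hU.1 hiT
        simpa using hiU e (by simp; omega)
      rcases h [e] he with h | h
      · exact absurd (wordPow_singleton e i ▸ hiT) (h i hi)
      · exact wordPow_singleton e j ▸ h j hj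
  obtain ⟨T, hT, x, s', t', y, hs, ht, hw, hmem⟩ := hsel (List.replicate K a)
    (List.replicate (2 * N + 2) a) (List.replicate K a)
    (mem_kstar_pair.2 ⟨K + N + 1, by
      rw [wordPow_pair_self, ← replicate_add_add]
      congr 1
      ring⟩) (by simp) (by simp) (by simp)
  have hx := (List.append_eq_replicate_iff.1 hs.symm)
  have hy := (List.append_eq_replicate_iff.1 ht.symm)
  rw [hx.2.2, hy.2.1, ← replicate_add_add] at hw
  have hw2 := hmem _ (hN T hT a _ (s'.length + (2 * N + 3) + t'.length) (by omega) (by omega) hw)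
    (replicate_mem_words (by simp) _)
  rw [hx.2.1, hy.2.2, ← replicate_add_add] at hw2
  obtain ⟨n, hn⟩ := mem_kstar_pair.1 hw2
  have := congrArg List.length hn
  simp at this
  omega

theorem not_IC_STAR_subset_PS [Infinite α] : ¬ IC (α := α) STAR ⊆ IC PS := by
  classical
  obtain ⟨a⟩ : Nonempty α := inferInstance
  exact not_IC_subset_PS_of_even (fun V => (MON_words V).star) (even_block_STAR a)

theorem not_IC_COMM_subset_PS [Infinite α] : ¬ IC (α := α) COMM ⊆ IC PS := by
  classical
  obtain ⟨a⟩ : Nonempty α := inferInstance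
  exact not_IC_subset_PS_of_even (fun V => (MON_words V).comm) (even_block_COMM a)

/-- Rotating a factor of `(ab)^n` by one letter destroys the alternation of the letters. -/
theorem not_IC_STAR_subset_CIRC [Infinite α] : ¬ IC (α := α) STAR ⊆ IC CIRC := by
  classical
  intro h
  obtain ⟨a, b, hab⟩ := exists_pair_ne α
  have hreg : RegularOver {a, b} ({[a, b]} : Language α) := .singleton (by simp)
  obtain ⟨K, 𝒯, hfin, hF, hsel⟩ := exists_selection_of_factor h (fun V => (MON_words V).star)
    (B := {a, b}) (by simp) (S := ({[a, b]} : Language α)∗) ⟨hreg.kstar, _, hreg, rfl⟩ hreg.kstar.1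
  obtain ⟨T, hT, x, s', t', y, hs, ht, hw, hmem⟩ := hsel (wordPow [a, b] K) [a, b]
    (wordPow [a, b] K) (mem_kstar_pair.2 ⟨K + 1 + K, by
      rw [wordPow_add, wordPow_add, wordPow_one]⟩) (by simp; omega) (by simp; omega) (by simp)
  obtain ⟨U, hU⟩ := hF T hT
  have hwords : s' ++ [a, b] ++ t' ∈ words {a, b} := by
    have hst : wordPow [a, b] K ∈ words {a, b} := wordPow_mem_words (by simp) K
    have hst' := hst
    rw [hs, append_mem_words] at hst
    rw [ht, append_mem_words] at hst'
    simp [hst.2, hst'.1]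
  have hw1 := hmem _ hw hwords
  obtain ⟨e, f, r, hef⟩ : ∃ e f r, s' ++ [a, b] ++ t' = e :: f :: r := by
    rcases s' with _ | ⟨e, _ | ⟨f, s⟩⟩
    · exact ⟨_, _, _, rfl⟩
    · exact ⟨_, _, _, rfl⟩
    · exact ⟨_, _, _, rfl⟩
  rw [hef] at hw hwords hw1
  have hw2 := hmem _ (hU.2 [e] (f :: r) hw) (by simp at hwords ⊢; tauto)
  obtain ⟨m, hm⟩ := mem_kstar_pair.1 hw1
  obtain ⟨n, hn⟩ := mem_kstar_pair.1 hw2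
  have hmn : m = n := by
    have h1 := congrArg List.length hm
    have h2 := congrArg List.length hn
    simp at h1 h2
    omega
  have hfe : f = e := by
    rw [← hmn, ← hm] at hn
    simpa using (List.cons.inj (List.append_cancel_left (as := x) (bs := _) (cs := _)
      (by simpa using hn))).1
  have hchain : ∀ n, (wordPow [a, b] n ++ [a]).IsChain (· ≠ ·) := by
    intro n
    induction n with
    | zero => simp
    | succ n ih =>
      rw [wordPow_succ]
      rcases n with _ | n
      · simp [hab, hab.symm]
      · rw [wordPow_succ] at ih ⊢
        simpa [hab, hab.symm] using ih
  have h1 := hchain m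
  rw [← hm, hfe] at h1
  have h2 : [e, e].IsChain (· ≠ ·) := h1.infix ⟨x, r ++ y ++ [a], by simp⟩
  simp at h2

/-! ### Separations by the order of the letters -/

/-- The words `a^i b^j`. -/
def sorted (a b : α) : Language α := words {a} * words {b}

theorem mem_sorted_iff [DecidableEq α] {a b : α} (hab : a ≠ b) {w : List α} :
    w ∈ sorted a b ↔ w ∈ words {a, b} ∧ w.Pairwise fun e f => ¬ (e = b ∧ f = a) := by
  constructor
  · rintro ⟨s, hs, t, ht, rfl⟩
    refine ⟨append_mem_words.2 ⟨words_mono (by simp) hs, words_mono (by simp) ht⟩, ?_⟩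
    have hs' : ∀ e ∈ s, e = a := fun e he => Finset.mem_singleton.1 (hs e he)
    have ht' : ∀ e ∈ t, e = b := fun e he => Finset.mem_singleton.1 (ht e he)
    change (s ++ t).Pairwise _
    rw [List.pairwise_append]
    refine ⟨List.pairwise_of_forall_mem_list ?_, List.pairwise_of_forall_mem_list ?_, ?_⟩
    · exact fun e he f hf h => hab ((hs' e he).symm.trans h.1)
    · exact fun e he f hf h => hab (h.2.symm.trans (ht' f hf))
    · exact fun e he f hf h => hab ((hs' e he).symm.trans h.1)
  · rintro ⟨hw, h⟩
    induction w with
    | nil => exact ⟨[], nil_mem_words _, [], nil_mem_words _, rfl⟩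
    | cons e w ih =>
      rw [cons_mem_words] at hw
      rw [List.pairwise_cons] at h
      obtain ⟨s, hs, t, ht, hst⟩ := ih hw.2 h.2
      rcases (by simpa using hw.1 : e = a ∨ e = b) with rfl | rfl
      · exact ⟨e :: s, cons_mem_words.2 ⟨by simp, hs⟩, t, ht, by simpa using hst⟩
      · refine ⟨[], nil_mem_words _, e :: w, ?_, rfl⟩
        refine cons_mem_words.2 ⟨by simp, fun f hf => ?_⟩
        have := hw.2 f hf
        have := h.1 f hf
        simp_all

theorem not_mem_sorted_of_sublist [DecidableEq α] {a b : α} (hab : a ≠ b) {w : List α}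
    (h : List.Sublist [b, a] w) : w ∉ sorted a b := fun hw => by
  have := ((mem_sorted_iff hab).1 hw).2.sublist h
  simp at this

theorem INF_sorted [DecidableEq α] {a b : α} (hab : a ≠ b) : INF {a, b} (sorted a b) := by
  refine ⟨((RegularOver.words _).mono (by simp)).mul ((RegularOver.words _).mono (by simp)),
    fun x hx y hy z hz h => ?_⟩
  rw [mem_sorted_iff hab] at h ⊢
  exact ⟨hy, h.2.sublist (List.IsInfix.sublist ⟨x, z, rfl⟩)⟩

/-- The words `a^i b^j` form an infix-closed language. It cannot be tested by selection languages
that contain, with a word `a^i b^j` with `i, j ≥ 1`, a word with a letter `b` before a letter `a`.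
-/
theorem not_IC_INF_subset_of_unsorted [Infinite α] {F : Family α}
    (hF : ∀ (U : Finset α) (T : Language α) (a b : α) (w : List α), a ≠ b → F U T → w ∈ T →
      w ∈ sorted a b → a ∈ w → b ∈ w → ∃ w' ∈ T, (∀ e ∈ w', e ∈ w) ∧ List.Sublist [b, a] w') :
    ¬ IC INF ⊆ IC F := by
  classical
  intro h
  obtain ⟨a, b, hab⟩ := exists_pair_ne α
  obtain ⟨K, 𝒯, -, hF', hsel⟩ := exists_selection_of_factor h (fun V => (MON_words V).inf)
    (B := {a, b}) (by simp) (INF_sorted hab) (INF_sorted hab).1.1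
  have ha : List.replicate K a ∈ words {a} := replicate_mem_words (by simp) K
  have hb : List.replicate K b ∈ words {b} := replicate_mem_words (by simp) K
  obtain ⟨T, hT, x, s', t', y, hs, ht, hw, hmem⟩ := hsel (List.replicate K a) [a, b]
    (List.replicate K b) ⟨_, append_mem_words.2 ⟨ha, (by simp : [a] ∈ words {a})⟩, b :: _,
      cons_mem_words.2 ⟨by simp, hb⟩, by simp⟩ (by simp) (by simp) (by simp)
  obtain ⟨U, hU⟩ := hF' T hT
  rw [hs, append_mem_words] at ha
  rw [ht, append_mem_words] at hb
  have hsort : s' ++ [a, b] ++ t' ∈ sorted a b :=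
    ⟨_, append_mem_words.2 ⟨ha.2, (by simp : [a] ∈ words {a})⟩, b :: _,
      cons_mem_words.2 ⟨by simp, hb.1⟩, by simp⟩
  obtain ⟨w', hw', hsub, hun⟩ := hF U T a b _ hab hU hw hsort (by simp) (by simp)
  have hV := ((mem_sorted_iff hab).1 hsort).1
  exact not_mem_sorted_of_sublist hab (hun.trans
    (List.IsInfix.sublist ⟨x, y, rfl⟩)) (hmem w' hw' fun e he => hV e (hsub e he))

theorem pair_sublist_append_self {a b : α} {w : List α} (ha : a ∈ w) (hb : b ∈ w) :
    List.Sublist [b, a] (w ++ w) := by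
  have := (List.singleton_sublist.2 hb).append (List.singleton_sublist.2 ha)
  simpa using this

theorem not_IC_INF_subset_STAR [Infinite α] : ¬ IC (α := α) INF ⊆ IC STAR := by
  refine not_IC_INF_subset_of_unsorted fun U T a b w _ hT hw _ ha hb => ⟨w ++ w, ?_, by simp,
    pair_sublist_append_self ha hb⟩
  obtain ⟨-, H, -, rfl⟩ := hT
  obtain ⟨l, rfl, hl⟩ := hw
  refine ⟨l ++ l, by simp, fun y hy => hl y (by simpa using hy)⟩

/-- In `(euh)(euh)` with `e ∈ E` and `h ∈ H`, the part between the first `e` and the last `h` is in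
`U^*`. -/
theorem SYDEF.append_self_mem {U : Finset α} {T : Language α} (h : SYDEF U T) {w : List α}
    (hw : w ∈ T) : w ++ w ∈ T := by
  obtain ⟨-, E, H, hE, hH, rfl⟩ := h
  obtain ⟨_, ⟨e, he, u, hu, rfl⟩, h, hh, rfl⟩ := hw
  exact ⟨_, ⟨e, he, u ++ h ++ e ++ u, append_mem_words.2 ⟨append_mem_words.2
    ⟨append_mem_words.2 ⟨hu, hH.1 hh⟩, hE.1 he⟩, hu⟩, rfl⟩, h, hh, by simp⟩

theorem not_IC_INF_subset_SYDEF [Infinite α] : ¬ IC (α := α) INF ⊆ IC SYDEF := by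
  exact not_IC_INF_subset_of_unsorted fun U T a b w _ hT hw _ ha hb => ⟨w ++ w,
    hT.append_self_mem hw, by simp, pair_sublist_append_self ha hb⟩

theorem not_IC_INF_subset_CIRC [Infinite α] : ¬ IC (α := α) INF ⊆ IC CIRC := by
  refine not_IC_INF_subset_of_unsorted fun U T a b w hab hT hw h ha hb => ?_
  obtain ⟨s, hs, t, ht, rfl⟩ := h
  have has : a ∈ s := (List.mem_append.1 ha).resolve_right fun h =>
    hab (Finset.mem_singleton.1 (ht a h))
  have hbt : b ∈ t := (List.mem_append.1 hb).resolve_left fun h =>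
    hab (Finset.mem_singleton.1 (hs b h)).symm
  have hst := (List.singleton_sublist.2 hbt).append (List.singleton_sublist.2 has)
  exact ⟨t ++ s, hT.2 s t hw, by simp [or_comm], by simpa using hst⟩

theorem PRE_forbidden_prefix {V : Finset α} {L : Language α} (hL : L.IsRegular) :
    PRE V (words V ⊓ (L * ⊤)ᶜ) := by
  refine ⟨.inf_words (isRegular_mul hL isRegular_top).compl, fun x hx y hy h => ⟨hx, ?_⟩⟩
  rintro ⟨s, hs, r, -, rfl⟩
  exact h.2 ⟨s, hs, r ++ y, trivial, by simp⟩

theorem SUF_forbidden_suffix {V : Finset α} {L : Language α} (hL : L.IsRegular) :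
    SUF V (words V ⊓ (⊤ * L)ᶜ) := by
  refine ⟨.inf_words (isRegular_mul isRegular_top hL).compl, fun x hx y hy h => ⟨hy, ?_⟩⟩
  rintro ⟨r, -, s, hs, rfl⟩
  exact h.2 ⟨x ++ r, trivial, s, hs, by simp⟩

theorem exists_three_ne [Infinite α] : ∃ a b c : α, a ≠ b ∧ a ≠ c ∧ b ≠ c := by
  obtain ⟨a, b, c, _, h⟩ := exists_fresh (∅ : Finset α)
  exact ⟨a, b, c, h.cd, h.cp, h.dp⟩

/-- The words whose first letter different from `a` is not `c`: the letter `b` protects the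
letters `c` in `a^n b c^n`, but it may be missing in a suffix. -/
theorem not_IC_PRE_subset_SUF [Infinite α] : ¬ IC (α := α) PRE ⊆ IC SUF := by
  classical
  intro h
  obtain ⟨a, b, c, hab, hac, hbc⟩ := exists_three_ne (α := α)
  have hL : RegularOver {a, b, c} (words {a} * ({[c]} : Language α)) :=
    .mul ((RegularOver.words _).mono (by simp)) (.singleton (by simp))
  obtain ⟨K, 𝒯, hfin, hF, hsel⟩ := exists_selection_of_factor h (fun V => (MON_words V).inf.pre)
    (B := {a, b, c}) (by simp) (PRE_forbidden_prefix hL.2) inf_le_left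
  have haV : List.replicate K a ∈ words {a, b, c} := replicate_mem_words (by simp) K
  have hcV : List.replicate K c ∈ words {a, b, c} := replicate_mem_words (by simp) K
  obtain ⟨T, hT, x, s', t', y, hs, ht, hw, hmem⟩ := hsel (List.replicate K a) [b, c]
    (List.replicate K c) (by
      refine ⟨append_mem_words.2 ⟨append_mem_words.2 ⟨haV, by simp⟩, hcV⟩, ?_⟩
      rintro ⟨_, ⟨s, hs, _, rfl, rfl⟩, r, -, h⟩
      have h : s ++ c :: r = List.replicate K a ++ b :: (c :: List.replicate K c) := by
        simpa using h
      refine hbc (append_cons_inj h (fun h => ?_) fun h => ?_).2.1.symm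
      · exact hab (Finset.mem_singleton.1 (hs b h)).symm
      · exact hac (List.eq_of_mem_replicate h).symm) (by simp) (by simp) (by simp)
  obtain ⟨U, hU⟩ := hF T hT
  have hwU : s' ++ [b, c] ++ t' ∈ words U := hU.1.1 hw
  have hcT : [c] ++ t' ∈ T := by
    have e : s' ++ [b, c] ++ t' = (s' ++ [b]) ++ ([c] ++ t') := by simp
    rw [e] at hw hwU
    rw [append_mem_words] at hwU
    exact hU.2 _ hwU.1 _ hwU.2 hw
  rw [ht, append_mem_words] at hcV
  refine (hmem _ hcT (by simp [hcV.1])).2 ⟨_, ⟨x, ?_, [c], rfl, rfl⟩, t' ++ y, trivial, by simp⟩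
  have := replicate_mem_words (Finset.mem_singleton_self a) K
  rw [hs, append_mem_words] at this
  exact this.1

/-- The words whose last letter different from `a` is not `c`, as the mirror image of the language
in `not_IC_PRE_subset_SUF`. -/
theorem not_IC_SUF_subset_PRE [Infinite α] : ¬ IC (α := α) SUF ⊆ IC PRE := by
  classical
  intro h
  obtain ⟨a, b, c, hab, hac, hbc⟩ := exists_three_ne (α := α)
  have hL : RegularOver {a, b, c} (({[c]} : Language α) * words {a}) :=
    .mul (.singleton (by simp)) ((RegularOver.words _).mono (by simp))
  obtain ⟨K, 𝒯, hfin, hF, hsel⟩ := exists_selection_of_factor h (fun V => (MON_words V).inf.suf)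
    (B := {a, b, c}) (by simp) (SUF_forbidden_suffix hL.2) inf_le_left
  have haV : List.replicate K a ∈ words {a, b, c} := replicate_mem_words (by simp) K
  have hcV : List.replicate K c ∈ words {a, b, c} := replicate_mem_words (by simp) K
  obtain ⟨T, hT, x, s', t', y, hs, ht, hw, hmem⟩ := hsel (List.replicate K c) [c, b]
    (List.replicate K a) (by
      refine ⟨append_mem_words.2 ⟨append_mem_words.2 ⟨hcV, by simp⟩, haV⟩, ?_⟩
      rintro ⟨r, -, _, ⟨_, rfl, s, hs, rfl⟩, h⟩
      have h : r ++ c :: s = (List.replicate K c ++ [c]) ++ b :: List.replicate K a := by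
        simpa using h
      refine hbc (append_cons_inj_right h (fun h => ?_) fun h => ?_).2.1.symm
      · exact hab (Finset.mem_singleton.1 (hs b h)).symm
      · exact hac (List.eq_of_mem_replicate h).symm) (by simp) (by simp) (by simp)
  obtain ⟨U, hU⟩ := hF T hT
  have hwU : s' ++ [c, b] ++ t' ∈ words U := hU.1.1 hw
  have hcT : s' ++ [c] ∈ T := by
    have e : s' ++ [c, b] ++ t' = (s' ++ [c]) ++ ([b] ++ t') := by simp
    rw [e] at hw hwU
    rw [append_mem_words] at hwU
    exact hU.2 _ hwU.1 _ hwU.2 hw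
  rw [hs, append_mem_words] at hcV
  refine (hmem _ hcT (by simp [hcV.2])).2 ⟨x ++ s', trivial, _, ⟨[c], rfl, y, ?_, rfl⟩, by simp⟩
  have := replicate_mem_words (Finset.mem_singleton_self a) K
  rw [ht, append_mem_words] at this
  exact this.2

/-- The words over `{a, b}` with exactly one letter `b`: a star language is closed under squares. -/
theorem not_IC_COMM_subset_STAR [Infinite α] : ¬ IC (α := α) COMM ⊆ IC STAR := by
  classical
  intro h
  obtain ⟨a, b, hab⟩ := exists_pair_ne α
  set S : Language α := words {a} * {[b]} * words {a} with hSdef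
  have hreg : RegularOver {a, b} S :=
    .mul (.mul ((RegularOver.words _).mono (by simp)) (.singleton (by simp)))
      ((RegularOver.words _).mono (by simp))
  have hcount : ∀ w, w ∈ S ↔ w ∈ words {a, b} ∧ w.count b = 1 := by
    intro w
    constructor
    · intro hw
      refine ⟨hreg.1 hw, ?_⟩
      obtain ⟨_, ⟨s, hs, _, rfl, rfl⟩, t, ht, rfl⟩ := hw
      have hs' : b ∉ s := fun h => hab (Finset.mem_singleton.1 (hs b h)).symm
      have ht' : b ∉ t := fun h => hab (Finset.mem_singleton.1 (ht b h)).symm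
      simp [List.count_eq_zero.2 hs', List.count_eq_zero.2 ht']
    · rintro ⟨hw, hc⟩
      obtain ⟨s, t, rfl⟩ := List.append_of_mem (List.count_pos_iff.1 (hc ▸ one_pos))
      simp only [List.count_append, List.count_cons_self] at hc
      have hs : b ∉ s := List.count_eq_zero.1 (by omega)
      have ht : b ∉ t := List.count_eq_zero.1 (by omega)
      have hmem : ∀ r, r ∈ words {a, b} → b ∉ r → r ∈ words {a} := by
        intro r hr hbr e he
        have := hr e he
        simp only [Finset.mem_insert, Finset.mem_singleton] at this ⊢
        exact this.resolve_right fun h => hbr (h ▸ he)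
      rw [append_mem_words, cons_mem_words] at hw
      exact ⟨_, ⟨s, hmem s hw.1 hs, [b], rfl, rfl⟩, t, hmem t hw.2.2 ht, by simp⟩
  obtain ⟨K, 𝒯, hfin, hF, hsel⟩ := exists_selection_of_factor h (fun V => (MON_words V).comm)
    (B := {a, b}) (by simp) (S := S) ⟨hreg, fun w w' hw hp => by
      rw [hcount] at hw ⊢
      exact ⟨fun e he => hw.1 e (hp.mem_iff.2 he), hp.count_eq b ▸ hw.2⟩⟩ hreg.1
  have ha : List.replicate K a ∈ words {a} := replicate_mem_words (by simp) K
  obtain ⟨T, hT, x, s', t', y, hs, ht, hw, hmem⟩ := hsel (List.replicate K a) [b]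
    (List.replicate K a) ⟨_, ⟨_, ha, [b], rfl, rfl⟩, _, ha, rfl⟩ (by simp) (by simp) (by simp)
  obtain ⟨U, -, H, -, rfl⟩ := hF T hT
  obtain ⟨l, hl, hH⟩ := hw
  have hst := ha
  rw [hs, append_mem_words] at ha
  rw [ht, append_mem_words] at hst
  have hab' : words ({a} : Finset α) ≤ words {a, b} := words_mono (by simp)
  have hs2 : s' ∈ words {a, b} := hab' ha.2
  have ht2 : t' ∈ words {a, b} := hab' hst.1
  have := (hcount _).1 (hmem ((s' ++ [b] ++ t') ++ (s' ++ [b] ++ t'))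
    ⟨l ++ l, by rw [hl]; simp, fun y hy => hH y (by simpa using hy)⟩ (by
      simp [hs2, ht2]))
  simp at this
  omega

/-- The words over `{a, b}` whose product under `a ↦ (0 1)`, `b ↦ (1 2)` is the identity form a
circular language, but a selection closed under permutations would exchange the two
transpositions, which do not commute. -/
theorem not_IC_CIRC_subset_COMM [Infinite α] : ¬ IC (α := α) CIRC ⊆ IC COMM := by
  classical
  intro h
  obtain ⟨a, b, hab⟩ := exists_pair_ne α
  let f : α → Equiv.Perm (Fin 3) := fun c => if c = a then Equiv.swap 0 1 else Equiv.swap 1 2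
  let M : DFA α (Equiv.Perm (Fin 3)) := ⟨fun z c => z * f c, 1, {1}⟩
  have hM : ∀ w z, M.evalFrom z w = z * (w.map f).prod := by
    intro w
    induction w with
    | nil => simp
    | cons c w ih =>
      intro z
      change M.evalFrom (z * f c) w = _
      rw [ih]
      simp [mul_assoc]
  have hacc : ∀ w, w ∈ M.accepts ↔ (w.map f).prod = 1 := fun w => by
    change M.evalFrom 1 w ∈ ({1} : Set (Equiv.Perm (Fin 3))) ↔ _
    simp [hM]
  have hreg : RegularOver {a, b} (words {a, b} ⊓ M.accepts) :=
    .inf_words ⟨_, inferInstance, M, rfl⟩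
  obtain ⟨K, 𝒯, hfin, hF, hsel⟩ := exists_selection_of_factor h (fun V => (MON_words V).comm.circ)
    (B := {a, b}) (by simp) (S := words {a, b} ⊓ M.accepts) ⟨hreg, fun x y hxy => by
      obtain ⟨hV, hxy⟩ := hxy
      refine ⟨append_mem_words.2 (append_mem_words.1 hV).symm, (hacc _).2 ?_⟩
      have := (hacc _).1 hxy
      rw [List.map_append, List.prod_append] at this ⊢
      exact mul_eq_one_comm.1 this⟩ hreg.1
  have hfa : f a = Equiv.swap 0 1 := by simp [f]
  have hfb : f b = Equiv.swap 1 2 := by simp [f, hab.symm]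
  have haV : ∀ n, List.replicate n a ∈ words {a, b} := replicate_mem_words (by simp)
  obtain ⟨T, hT, x, s', t', y, hs, ht, hw, hmem⟩ := hsel (List.replicate (2 * K) a) [a, b, b, a]
    (List.replicate (2 * K) a) ⟨by
      change _ ∈ words {a, b}
      simp only [append_mem_words]
      exact ⟨⟨haV _, by simp⟩, haV _⟩, (hacc _).2 (by
        simp [hfa, hfb, pow_mul, pow_two])⟩ (by simp; omega) (by simp; omega) (by simp)
  obtain ⟨U, hU⟩ := hF T hT
  have haV' := haV (2 * K)
  have haV'' := haV (2 * K)
  rw [hs, append_mem_words] at haV'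
  rw [ht, append_mem_words] at haV''
  have h1 := (hacc _).1 (hmem _ hw (by simp [haV'.2, haV''.1])).2
  have h2 := (hacc _).1 (hmem _ (hU.2 _ (s' ++ [b, a, b, a] ++ t') hw
    (((List.Perm.swap _ _ _).append_left _).append_right _)) (by simp [haV'.2, haV''.1])).2
  rw [← h1] at h2
  simp only [List.map_append, List.prod_append, mul_left_inj, mul_right_inj] at h2
  simp only [List.map_cons, List.prod_cons, ← mul_assoc, mul_left_inj, hfa, hfb] at h2
  revert h2
  decide

/-! ### A non-counting language that ordered selection cannot test -/

section NC

variable [DecidableEq α] (a b : α)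

/-- The automaton of `(a{a, b}b)^*`: the state is the position in the current block of three
letters, and `3` is the dead state. -/
def blockDFA : DFA α (Fin 4) where
  step z c := if c = a then (![1, 2, 3, 3] : Fin 4 → Fin 4) z else
    if c = b then (![3, 2, 0, 3] : Fin 4 → Fin 4) z else 3
  start := 0
  accept := {0}

variable {a b}

theorem blockDFA_step (z : Fin 4) (c : α) : (blockDFA a b).step z c = 3 ∨
    z.1 < 3 ∧ ((blockDFA a b).step z c).1 = (z.1 + 1) % 3 := by
  simp only [blockDFA]
  split_ifs
  · revert z; decide
  · revert z; decide
  · exact Or.inl rfl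

theorem blockDFA_dead (w : List α) : (blockDFA a b).evalFrom 3 w = 3 := by
  induction w with
  | nil => rfl
  | cons c w ih =>
    change (blockDFA a b).evalFrom ((blockDFA a b).step 3 c) w = 3
    rcases blockDFA_step (a := a) (b := b) 3 c with h | h
    · rw [h, ih]
    · exact absurd h.1 (by decide)

/-- A word shifts the position by its length, or it leads to the dead state. -/
theorem blockDFA_evalFrom (w : List α) (z : Fin 4) : (blockDFA a b).evalFrom z w = 3 ∨
    z.1 < 3 ∧ ((blockDFA a b).evalFrom z w).1 = (z.1 + w.length) % 3 := by
  induction w generalizing z with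
  | nil =>
    change z = 3 ∨ z.1 < 3 ∧ z.1 = (z.1 + 0) % 3
    revert z
    decide
  | cons c w ih =>
    change (blockDFA a b).evalFrom ((blockDFA a b).step z c) w = 3 ∨
      z.1 < 3 ∧ ((blockDFA a b).evalFrom ((blockDFA a b).step z c) w).1 = _
    rcases blockDFA_step (a := a) (b := b) z c with h | h
    · rw [h]
      exact Or.inl (blockDFA_dead w)
    · rcases ih ((blockDFA a b).step z c) with h' | h'
      · exact Or.inl h'
      · refine Or.inr ⟨h.1, ?_⟩
        rw [h'.2, h.2, List.length_cons]
        omega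

set_option maxRecDepth 100000 in
/-- If a self-map of the four states acts as a shift by `r` as long as it does not lead to the dead
state, and it does so somewhere, then its third power is idempotent or constantly dead. -/
theorem partial_shift_iterate (g : Fin 4 → Fin 4) (n : ℕ)
    (h : ∀ z : Fin 4, g z = 3 ∨ z.1 < 3 ∧ (g z).1 = (z.1 + n) % 3)
    (h' : ∃ z : Fin 4, z ≠ 3 ∧ g z = 3) (z : Fin 4) : g^[3] z = g^[4] z := by
  have key : ∀ (r : Fin 3) (g : Fin 4 → Fin 4),
      (∀ z : Fin 4, g z = 3 ∨ z.1 < 3 ∧ (g z).1 = (z.1 + r.1) % 3) →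
      (∃ z : Fin 4, z ≠ 3 ∧ g z = 3) → ∀ z, g (g (g z)) = g (g (g (g z))) := by
    decide
  exact key ⟨n % 3, Nat.mod_lt _ (by norm_num)⟩ g (by simpa using h) h' z

theorem blockDFA_exists_dead (hab : a ≠ b) {w : List α} (hw : w ≠ []) :
    ∃ z : Fin 4, z ≠ 3 ∧ (blockDFA a b).evalFrom z w = 3 := by
  obtain ⟨c, w, rfl⟩ := List.exists_cons_of_ne_nil hw
  have key : ∃ z : Fin 4, z ≠ 3 ∧ (blockDFA a b).step z c = 3 := by
    by_cases hc : c = a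
    · exact ⟨2, by decide, by simp [blockDFA, hc]⟩
    · by_cases hc' : c = b
      · exact ⟨0, by decide, by simp [blockDFA, hc', hab.symm]⟩
      · exact ⟨0, by decide, by simp [blockDFA, hc, hc']⟩
  obtain ⟨z, hz, h⟩ := key
  refine ⟨z, hz, ?_⟩
  change (blockDFA a b).evalFrom ((blockDFA a b).step z c) w = 3
  rw [h, blockDFA_dead]

/-- If the length of `y` is a multiple of three, then `y` acts as a partial identity; otherwise the
orbit of `y` passes through all positions, one of which leads to the dead state. -/
theorem blockDFA_iterate (hab : a ≠ b) (y : List α) (z : Fin 4) :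
    (fun z => (blockDFA a b).evalFrom z y)^[3] z =
      (fun z => (blockDFA a b).evalFrom z y)^[4] z := by
  rcases eq_or_ne y [] with rfl | hy
  · rfl
  exact partial_shift_iterate _ y.length (blockDFA_evalFrom y) (blockDFA_exists_dead hab hy) z

theorem blockDFA_accepts_le : (blockDFA a b).accepts ≤ words {a, b} := by
  intro w hw
  have key : ∀ w z, w ∉ words {a, b} → (blockDFA a b).evalFrom z w = 3 := by
    intro w
    induction w with
    | nil => exact fun z h => absurd (nil_mem_words _) h
    | cons c w ih =>
      intro z h
      change (blockDFA a b).evalFrom ((blockDFA a b).step z c) w = 3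
      by_cases hc : c = a ∨ c = b
      · exact ih _ fun hw => h (cons_mem_words.2 ⟨by simpa using hc, hw⟩)
      · rw [not_or] at hc
        rw [show (blockDFA a b).step z c = 3 by simp [blockDFA, hc.1, hc.2], blockDFA_dead]
  by_contra h
  have hw : (blockDFA a b).evalFrom 0 w = 0 := hw
  rw [key w 0 h] at hw
  exact absurd hw (by decide)

/-- All words act on the states with period one from the third power on. -/
theorem NC_blockDFA (hab : a ≠ b) : NC {a, b} (blockDFA a b).accepts := by
  refine ⟨⟨blockDFA_accepts_le, Fin 4, inferInstance, _, rfl⟩, 3, by norm_num,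
    fun x _ y _ z _ => ?_⟩
  change (blockDFA a b).evalFrom 0 _ ∈ ({0} : Set (Fin 4)) ↔
    (blockDFA a b).evalFrom 0 _ ∈ ({0} : Set (Fin 4))
  simp only [DFA.evalFrom_of_append, evalFrom_wordPow]
  rw [blockDFA_iterate hab]

end NC

/-- With `α = aab` and `β = abb`, a state `q` that is fixed by `α` and by `βα^N` is fixed by
`abα^N` as well: if `q ≤ qa`, then `qb ≤ qab ≤ q` and `qβ ≤ qb ≤ qab`, and dually. -/
theorem monotone_eval_eq {σ : Type*} [LinearOrder σ] {f g F : σ → σ} (hf : Monotone f)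
    (hg : Monotone g) (hF : Monotone F) {q : σ} (hα : g (f (f q)) = q) (hFq : F q = q)
    (hβ : F (g (g (f q))) = q) : F (g (f q)) = q := by
  rcases le_total q (f q) with h | h
  · have h1 : g (f q) ≤ q := (hg (hf h)).trans hα.le
    have h2 : g (g (f q)) ≤ g (f q) := (hg h1).trans (hg h)
    exact le_antisymm ((hF h1).trans hFq.le) (hβ.ge.trans (hF h2))
  · have h1 : q ≤ g (f q) := hα.ge.trans (hg (hf h))
    have h2 : g (f q) ≤ g (g (f q)) := (hg h).trans (hg h1)
    exact le_antisymm ((hF h2).trans hβ.le) (hFq.ge.trans (hF h1))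

/-- The language `(a{a, b}b)^*` is non-counting. In a long word of it over the blocks `α = aab` and
`β = abb`, an ordered automaton reaches a state that is fixed by `α` and by `βα^N`. Hence it cannot
detect an additional factor `abα^N`, whose length is not a multiple of three. -/
theorem not_IC_NC_subset_ORD [Infinite α] : ¬ IC (α := α) NC ⊆ IC ORD := by
  classical
  intro h
  obtain ⟨a, b, hab⟩ := exists_pair_ne α
  obtain ⟨K, 𝒯, hfin, hF, hsel⟩ := exists_selection_of_factor h
    (fun V => (MON_words V).nil.def.ord.nc) (B := {a, b}) (by simp) (NC_blockDFA hab)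
    blockDFA_accepts_le
  obtain ⟨N, hN⟩ := exists_uniform_bound hfin
    (P := fun T n => ∃ (U : Finset α) (σ : Type) (_ : Fintype σ) (_ : LinearOrder σ) (M : DFA α σ),
      (∀ a ∈ U, Monotone fun z => M.step z a) ∧ (∀ w, w ∈ T ↔ w ∈ words U ∧ w ∈ M.accepts) ∧
      Fintype.card σ ≤ n)
    (fun T m n hmn ⟨U, σ, i, j, M, h, h', hc⟩ => ⟨U, σ, i, j, M, h, h', hc.trans hmn⟩)
    fun T hT => by
      obtain ⟨U, -, σ, i, j, M, h, h'⟩ := hF T hT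
      exact ⟨_, U, σ, i, j, M, h, h', le_rfl⟩
  let A : List α := [a, a, b]
  let B : List α := [a, b, b]
  have hA0 : (blockDFA a b).evalFrom 0 A = 0 := by
    simp [blockDFA, DFA.evalFrom, A, hab.symm]
  have hB0 : (blockDFA a b).evalFrom 0 B = 0 := by
    simp [blockDFA, DFA.evalFrom, B, hab.symm]
  have hpow : ∀ w n, (blockDFA a b).evalFrom 0 w = 0 →
      (blockDFA a b).evalFrom 0 (wordPow w n) = 0 := fun w n hw => by
    rw [evalFrom_wordPow]
    exact Function.iterate_fixed hw n
  set G := B ++ wordPow A N with hG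
  have hG0 : (blockDFA a b).evalFrom 0 G = 0 := by
    rw [hG, DFA.evalFrom_of_append, hB0, hpow A N hA0]
  -- one more factor `G` makes sure that the middle part is not empty
  obtain ⟨T, hT, x, s', t', y, hs, ht, hw, hmem⟩ := hsel (wordPow A K) (wordPow G (N + 1))
    (wordPow A K) (by
      change (blockDFA a b).evalFrom 0 _ = 0
      rw [DFA.evalFrom_of_append, DFA.evalFrom_of_append, hpow A K hA0, hpow G _ hG0, hpow A K hA0])
    (by simp [A]; omega) (by simp [A]; omega) (by simp [hG, B, wordPow_succ])
  obtain ⟨U, σ, _, _, M, hM, hTM, hcard⟩ := hN T hT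
  have hwT := (hTM _).1 hw
  obtain ⟨⟨hsU, hGU⟩, htU⟩ : (s' ∈ words U ∧ wordPow G (N + 1) ∈ words U) ∧ t' ∈ words U := by
    simpa [and_assoc] using hwT.1
  have haU : a ∈ U := hGU a (by simp [wordPow_succ, hG, B])
  have hbU : b ∈ U := hGU b (by simp [wordPow_succ, hG, B])
  have hAU : A ∈ words U := by simp [A, haU, hbU]
  have hBU : B ∈ words U := by simp [B, haU, hbU]
  have hANU := wordPow_mem_words hAU N
  have hGU' : G ∈ words U := append_mem_words.2 ⟨hBU, hANU⟩
  have hmono := fun w (hw : w ∈ words U) => monotone_evalFrom hM hw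
  -- the state after the middle part is fixed by `G`, and it is a state after `α^N`
  set q := M.evalFrom (M.evalFrom M.start s') (wordPow G (N + 1)) with hq
  have hGq : M.evalFrom q G = q := by
    rw [hq, evalFrom_wordPow]
    exact (Function.iterate_succ_apply' (fun z => M.evalFrom z G) _ _).symm.trans
      (Monotone.iterate_succ_eq (hmono G hGU') _ (by omega))
  have hAq : M.evalFrom q A = q := by
    have h1 : q = M.evalFrom (M.evalFrom q B) (wordPow A N) := by
      rw [← DFA.evalFrom_of_append, ← hG, hGq]
    rw [h1, evalFrom_wordPow]
    exact (Function.iterate_succ_apply' (fun z => M.evalFrom z A) _ _).symm.trans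
      (Monotone.iterate_succ_eq (hmono A hAU) _ hcard)
  have hANq : M.evalFrom q (wordPow A N) = q := by
    rw [evalFrom_wordPow]
    exact Function.iterate_fixed hAq N
  have hab' : M.evalFrom q ([a, b] ++ wordPow A N) = q := by
    rw [DFA.evalFrom_of_append]
    refine monotone_eval_eq (hM a haU) (hM b hbU) (hmono _ hANU) hAq hANq ?_
    change M.evalFrom (M.evalFrom q B) (wordPow A N) = q
    rw [← DFA.evalFrom_of_append, ← hG, hGq]
  have hw' : s' ++ (wordPow G (N + 1) ++ ([a, b] ++ wordPow A N)) ++ t' ∈ T := by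
    refine (hTM _).2 ⟨?_, ?_⟩
    · simp only [append_mem_words]
      exact ⟨⟨hsU, hGU, by simp [haU, hbU], hANU⟩, htU⟩
    · have := hwT.2
      change M.evalFrom M.start _ ∈ M.accept at this ⊢
      rw [DFA.evalFrom_of_append, DFA.evalFrom_of_append, ← hq] at this
      rw [DFA.evalFrom_of_append, DFA.evalFrom_of_append, DFA.evalFrom_of_append _ _ (wordPow G _),
        ← hq, hab']
      exact this
  have hAab : A ∈ words ({a, b} : Finset α) := by simp [A]
  have hBab : B ∈ words ({a, b} : Finset α) := by simp [B]
  have hst := wordPow_mem_words hAab K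
  have hst' := hst
  rw [hs, append_mem_words] at hst
  rw [ht, append_mem_words] at hst'
  have hmem' := hmem _ hw' (by
    simp only [append_mem_words]
    exact ⟨⟨hst.2, wordPow_mem_words (append_mem_words.2 ⟨hBab, wordPow_mem_words hAab N⟩) _,
      by simp, wordPow_mem_words hAab N⟩, hst'.1⟩)
  -- the word with the additional `ab` has a length that is not a multiple of three
  have hev : (blockDFA a b).evalFrom 0 _ = 0 := hmem'
  rcases blockDFA_evalFrom (a := a) (b := b)
    (x ++ (s' ++ (wordPow G (N + 1) ++ ([a, b] ++ wordPow A N)) ++ t') ++ y) 0 with h' | h'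
  · rw [hev] at h'
    exact absurd h' (by decide)
  · have h3 := h'.2
    rw [hev] at h3
    have hsl := congrArg List.length hs
    have htl := congrArg List.length ht
    have hGl : G.length = 3 * (N + 1) := by simp [hG, A, B]; ring
    simp only [List.length_append, length_wordPow, hGl] at h3 hsl htl
    simp [A] at h3 hsl htl
    have e : (N + 1) * (3 * (N + 1)) = 3 * ((N + 1) * (N + 1)) := by ring
    rw [e] at h3
    omega

/-! ### Separating languages generated with finite selection -/

theorem FIN_singleton {V : Finset α} {w : List α} (h : w ∈ words V) : FIN V {w} :=
  ⟨.singleton h, Set.finite_singleton w⟩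

/-- The grammar with the axiom `b` that puts a letter `a` in front of a word of `S`. -/
def prependGrammar [DecidableEq α] (a b : α) (S : Language α) : ContextualGrammar α where
  alphabet := {a, b}
  alphabet_nonempty := by simp
  selections := {(S, {([a], [])})}
  selections_finite := Set.finite_singleton _
  contexts_finite := by rintro _ rfl; exact Set.finite_singleton _
  contexts_over := by rintro _ rfl _ rfl; simp
  contexts_ne := by rintro _ rfl _ rfl; simp
  initial := {[b]}
  initial_finite := Set.finite_singleton _
  initial_over := by rintro _ rfl; simp

/-- A selected word ends with the only letter `b`, so the new letter is put among the letters `a`.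
-/
theorem prependGrammar_inLanguage [DecidableEq α] {a b : α} (hab : a ≠ b) {S : Language α}
    (hb : [b] ∈ S) (hS : ∀ w ∈ S, w.getLast? = some b) :
    (prependGrammar a b S).inLanguage = {w | ∃ n, w = List.replicate n a ++ [b]} := by
  ext w
  constructor
  · rintro ⟨x, hx, hw⟩
    induction hw with
    | refl => exact ⟨0, hx⟩
    | tail _ hst ih =>
      obtain ⟨n, hn⟩ := ih
      obtain ⟨x₁, x₂, x₃, rfl, _, rfl, hx₂, _, rfl, rfl⟩ := hst
      obtain ⟨t, rfl⟩ := List.getLast?_eq_some_iff.1 (hS x₂ hx₂)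
      have hn : (x₁ ++ t) ++ b :: x₃ = List.replicate n a ++ b :: [] := by simpa using hn
      have hbn : b ∉ List.replicate n a := fun h => hab (List.eq_of_mem_replicate h).symm
      have hc : b ∉ x₁ ++ t ∧ b ∉ x₃ := by
        have := congrArg (List.count b) hn
        simp [List.count_eq_zero.2 hbn] at this
        rw [List.mem_append, not_or]
        simp only [← List.count_eq_zero]
        omega
      obtain ⟨h1, -, rfl⟩ := append_cons_inj hn hc.1 hbn
      obtain ⟨-, h2, h3⟩ := List.append_eq_replicate_iff.1 h1
      refine ⟨x₁.length + 1 + t.length, ?_⟩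
      rw [replicate_add_add, ← h2, ← h3]
      simp
  · rintro ⟨n, rfl⟩
    refine ⟨[b], rfl, ?_⟩
    induction n with
    | zero => exact .refl
    | succ n ih =>
      refine ih.tail ⟨List.replicate n a, [b], [], by simp, _, rfl, hb, _, rfl, ?_⟩
      rw [List.replicate_succ']
      simp

/-- If all non-empty selection languages contain the empty word, then every context can be put at
the end of the word `b`. -/
theorem not_mem_IC_of_nil_mem {F : Family α} {a b : α} (hab : a ≠ b)
    (hF : ∀ (U : Finset α) (T : Language α), F U T → ∀ w ∈ T, [] ∈ T) :
    ({w | ∃ n, w = List.replicate n a ++ [b]} : Language α) ∉ IC F := by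
  rintro ⟨G, hG, hL⟩
  obtain ⟨K, hK⟩ := exists_length_bound G.initial_finite
  have h1 : List.replicate K a ++ [b] ∈ G.inLanguage := hL ▸ ⟨K, rfl⟩
  have h0 : [b] ∈ G.inLanguage := hL ▸ ⟨0, rfl⟩
  obtain ⟨x, hx, hz⟩ := h1
  rcases hz.cases_tail with h | ⟨y, -, x₁, x₂, x₃, -, p, hp, hx₂, k, hk, -⟩
  · have := hK x hx
    rw [← h] at this
    simp at this
  · obtain ⟨U, -, -, hU⟩ := hG p hp
    obtain ⟨w, hw, hb⟩ := h0
    have : [b] ++ k.1 ++ k.2 ∈ G.inLanguage :=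
      ⟨w, hw, hb.tail ⟨[b], [], [], by simp, p, hp, hF U _ hU _ hx₂, k, hk, by simp⟩⟩
    rw [hL] at this
    obtain ⟨n, hn⟩ := this
    rcases n with _ | n
    · exact G.contexts_ne p hp k hk (by simpa using hn)
    · exact hab (List.cons.inj (by simpa [List.replicate_succ] using hn)).1.symm

/-- The language `a^*b` is generated with the selection language `{b}`. -/
theorem not_IC_FIN_subset_of_nil_mem [Infinite α] {F : Family α}
    (hF : ∀ (U : Finset α) (T : Language α), F U T → ∀ w ∈ T, [] ∈ T) : ¬ IC FIN ⊆ IC F := by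
  classical
  intro h
  obtain ⟨a, b, hab⟩ := exists_pair_ne α
  refine not_mem_IC_of_nil_mem hab hF (h ⟨prependGrammar a b {[b]}, ?_,
    prependGrammar_inLanguage hab rfl ?_⟩)
  · rintro _ rfl
    exact ⟨{a, b}, by simp, subset_rfl, FIN_singleton (by simp)⟩
  · rintro _ rfl
    simp

/-- The language `a^*b` is generated with the selection language `{a, b}^*b`. -/
theorem not_IC_COMB_subset_of_nil_mem [Infinite α] {F : Family α}
    (hF : ∀ (U : Finset α) (T : Language α), F U T → ∀ w ∈ T, [] ∈ T) : ¬ IC COMB ⊆ IC F := by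
  classical
  intro h
  obtain ⟨a, b, hab⟩ := exists_pair_ne α
  refine not_mem_IC_of_nil_mem hab hF (h ⟨prependGrammar a b (words {a, b} * letters {b}), ?_,
    prependGrammar_inLanguage hab ⟨[], nil_mem_words _, [b], ⟨b, rfl, rfl⟩, rfl⟩ ?_⟩)
  · rintro _ rfl
    refine ⟨{a, b}, by simp, subset_rfl, (RegularOver.words _).mul ?_, {b}, by simp, rfl⟩
    rw [mem_letters_singleton]
    exact .singleton (by simp)
  · rintro _ ⟨x, -, _, ⟨e, rfl, rfl⟩, rfl⟩
    simp

theorem PRE.nil_mem {U : Finset α} {T : Language α} (h : PRE U T) {w : List α} (hw : w ∈ T) :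
    [] ∈ T := h.2 [] (nil_mem_words U) w (h.1.1 hw) hw

theorem SUF.nil_mem {U : Finset α} {T : Language α} (h : SUF U T) {w : List α} (hw : w ∈ T) :
    [] ∈ T := h.2 w (h.1.1 hw) [] (nil_mem_words U) (by simpa using hw)

theorem STAR.nil_mem {U : Finset α} {T : Language α} (h : STAR U T) : [] ∈ T := by
  obtain ⟨-, H, -, rfl⟩ := h
  exact Language.nil_mem_kstar H

theorem singleton_mem_words (a : α) : [a] ∈ words {a} := by simp

theorem sublist_around (x₁ u x₂ v x₃ : List α) :
    List.Sublist (u ++ v) (x₁ ++ u ++ x₂ ++ v ++ x₃) := by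
  rw [List.append_assoc _ v]
  exact ((List.sublist_append_right x₁ u).trans (List.sublist_append_left _ x₂)).append
    (List.sublist_append_left v x₃)

theorem pair_sublist_of_mem_sorted {a b : α} (hab : a ≠ b) {w : List α} (hw : w ∈ sorted a b)
    (ha : a ∈ w) (hb : b ∈ w) : List.Sublist [a, b] w := by
  obtain ⟨s, hs, t, ht, rfl⟩ := hw
  have has : a ∈ s := (List.mem_append.1 ha).resolve_right fun h =>
    hab (Finset.mem_singleton.1 (ht a h))
  have hbt : b ∈ t := (List.mem_append.1 hb).resolve_left fun h =>
    hab (Finset.mem_singleton.1 (hs b h)).symm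
  exact (List.singleton_sublist.2 has).append (List.singleton_sublist.2 hbt)

/-- The grammar of the words `a^n b^n` and `b^n a^n` with `n ≥ 1`. -/
def nestGrammar [DecidableEq α] (a b : α) : ContextualGrammar α where
  alphabet := {a, b}
  alphabet_nonempty := by simp
  selections := {({[a, b]}, {([a], [b])}), ({[b, a]}, {([b], [a])})}
  selections_finite := by simp
  contexts_finite := by rintro _ (rfl | rfl) <;> exact Set.finite_singleton _
  contexts_over := by rintro _ (rfl | rfl) _ rfl <;> simp
  contexts_ne := by rintro _ (rfl | rfl) _ rfl <;> simp
  initial := {[a, b], [b, a]}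
  initial_finite := by simp
  initial_over := by rintro _ (rfl | rfl) <;> simp

theorem nestGrammar_inLanguage_le [DecidableEq α] {a b : α} (hab : a ≠ b) {w : List α}
    (hw : w ∈ (nestGrammar a b).inLanguage) :
    (w ∈ sorted a b ∨ w ∈ sorted b a) ∧ w.count a = w.count b := by
  obtain ⟨x, hx, hw⟩ := hw
  have hgrow : ∀ {a b : α} (x₁ x₃ : List α), a ≠ b → x₁ ++ [a, b] ++ x₃ ∈ sorted a b →
      x₁ ++ [a, a, b, b] ++ x₃ ∈ sorted a b := by
    intro a b x₁ x₃ hab h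
    rw [mem_sorted_iff hab] at h ⊢
    refine ⟨?_, ?_⟩
    · have := h.1
      simp only [append_mem_words] at this ⊢
      exact ⟨⟨this.1.1, by simp⟩, this.2⟩
    · have := h.2
      simp [List.pairwise_append] at this ⊢
      grind
  induction hw with
  | refl =>
    rcases hx with rfl | rfl
    · exact ⟨Or.inl ⟨[a], singleton_mem_words a, [b], singleton_mem_words b, rfl⟩,
        by simp [hab, hab.symm]⟩
    · exact ⟨Or.inr ⟨[b], singleton_mem_words b, [a], singleton_mem_words a, rfl⟩,
        by simp [hab, hab.symm]⟩
  | tail _ hst ih =>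
    obtain ⟨x₁, x₂, x₃, rfl, _, rfl | rfl, rfl, _, rfl, rfl⟩ := hst
    · refine ⟨Or.inl ?_, ?_⟩
      · have := hgrow x₁ x₃ hab (ih.1.resolve_right (not_mem_sorted_of_sublist hab.symm
          (List.IsInfix.sublist ⟨x₁, x₃, rfl⟩)))
        simpa using this
      · have := ih.2
        simp [hab, hab.symm] at this ⊢
        omega
    · refine ⟨Or.inr ?_, ?_⟩
      · have := hgrow x₁ x₃ hab.symm (ih.1.resolve_left (not_mem_sorted_of_sublist hab
          (List.IsInfix.sublist ⟨x₁, x₃, rfl⟩)))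
        simpa using this
      · have := ih.2
        simp [hab, hab.symm] at this ⊢
        omega

theorem mem_nestGrammar_inLanguage [DecidableEq α] (a b : α) (n : ℕ) :
    List.replicate (n + 1) a ++ List.replicate (n + 1) b ∈ (nestGrammar a b).inLanguage ∧
      List.replicate (n + 1) b ++ List.replicate (n + 1) a ∈ (nestGrammar a b).inLanguage := by
  have h1 : ∀ (c : α) n, List.replicate (n + 1) c = List.replicate n c ++ [c] := fun c n =>
    List.replicate_succ'
  constructor
  · refine ⟨[a, b], Or.inl rfl, ?_⟩
    induction n with
    | zero => exact .refl
    | succ n ih =>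
      refine ih.tail ⟨List.replicate n a, [a, b], List.replicate n b, ?_, _, Or.inl rfl, rfl, _,
        rfl, ?_⟩
      · nth_rw 1 [h1]
        simp [List.replicate_succ]
      · nth_rw 1 [h1, h1]
        simp [List.replicate_succ]
  · refine ⟨[b, a], Or.inr rfl, ?_⟩
    induction n with
    | zero => exact .refl
    | succ n ih =>
      refine ih.tail ⟨List.replicate n b, [b, a], List.replicate n a, ?_, _, Or.inr rfl, rfl, _,
        rfl, ?_⟩
      · nth_rw 1 [h1]
        simp [List.replicate_succ]
      · nth_rw 1 [h1, h1]
        simp [List.replicate_succ]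

/-- A context used to derive `a^n b^n` has the form `(u, v)` with a letter `a` before a letter `b`
in `uv`. If its selection language is circular, then it can be put around a factor of `b^m a^m`. -/
theorem not_IC_FIN_subset_CIRC [Infinite α] : ¬ IC (α := α) FIN ⊆ IC CIRC := by
  classical
  intro h
  obtain ⟨a, b, hab⟩ := exists_pair_ne α
  obtain ⟨G, hG, hL⟩ := h ⟨nestGrammar a b, by
    rintro _ (rfl | rfl)
    · exact ⟨{a, b}, by simp, subset_rfl, FIN_singleton (by simp)⟩
    · exact ⟨{a, b}, by simp, subset_rfl, FIN_singleton (by simp)⟩, rfl⟩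
  obtain ⟨K, hK⟩ := exists_length_bound G.initial_finite
  have hz := (mem_nestGrammar_inLanguage a b K).1
  have hzs : List.replicate (K + 1) a ++ List.replicate (K + 1) b ∈ sorted a b :=
    ⟨_, replicate_mem_words (by simp) _, _, replicate_mem_words (by simp) _, rfl⟩
  have hz' := hz
  rw [← hL] at hz'
  obtain ⟨x, hx, hz'⟩ := hz'
  rcases hz'.cases_tail with h | ⟨y, hy, x₁, x₂, x₃, rfl, p, hp, hx₂, k, hk, h⟩
  · have := hK x hx
    rw [← h] at this
    simp at this
    omega
  have hy' : x₁ ++ x₂ ++ x₃ ∈ (nestGrammar a b).inLanguage := hL ▸ ⟨x, hx, hy⟩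
  rw [h] at hz hzs
  have cy := (nestGrammar_inLanguage_le hab hy').2
  have cz := (nestGrammar_inLanguage_le hab hz).2
  rw [mem_sorted_iff hab] at hzs
  have hsub1 : List.Sublist (k.1 ++ k.2) (x₁ ++ k.1 ++ x₂ ++ k.2 ++ x₃) :=
    sublist_around _ _ _ _ _
  have hsub2 : List.Sublist x₂ (x₁ ++ k.1 ++ x₂ ++ k.2 ++ x₃) :=
    List.IsInfix.sublist ⟨x₁ ++ k.1, k.2 ++ x₃, by simp⟩
  have huv : k.1 ++ k.2 ∈ sorted a b :=
    (mem_sorted_iff hab).2 ⟨fun e he => hzs.1 e (hsub1.subset he), hzs.2.sublist hsub1⟩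
  have hx₂s : x₂ ∈ sorted a b :=
    (mem_sorted_iff hab).2 ⟨fun e he => hzs.1 e (hsub2.subset he), hzs.2.sublist hsub2⟩
  have hcount : (k.1 ++ k.2).count a = (k.1 ++ k.2).count b := by
    simp only [List.count_append] at cy cz ⊢
    omega
  have hpos : 0 < (k.1 ++ k.2).count a := by
    by_contra h0
    obtain ⟨e, he⟩ := List.exists_mem_of_ne_nil _ (G.contexts_ne p hp k hk)
    have heab := ((mem_sorted_iff hab).1 huv).1 e he
    rcases (by simpa using heab : e = a ∨ e = b) with rfl | rfl
    · exact h0 (List.count_pos_iff.2 he)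
    · exact h0 (hcount ▸ List.count_pos_iff.2 he)
  have huv' := pair_sublist_of_mem_sorted hab huv (List.count_pos_iff.1 hpos)
    (List.count_pos_iff.1 (hcount ▸ hpos))
  obtain ⟨s, hs, t, ht, rfl⟩ := hx₂s
  obtain ⟨U, -, -, hU⟩ := hG p hp
  have hts := hU.2 s t hx₂
  have hY := (mem_nestGrammar_inLanguage a b (s.length + t.length)).2
  rw [← hL] at hY
  obtain ⟨x', hx', hY⟩ := hY
  have hW : List.replicate (s.length + 1) b ++ k.1 ++ (t ++ s) ++ k.2 ++
      List.replicate (t.length + 1) a ∈ (nestGrammar a b).inLanguage := by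
    rw [← hL]
    refine ⟨x', hx', hY.tail ⟨_, t ++ s, _, ?_, p, hp, hts, k, hk, rfl⟩⟩
    have e1 := List.replicate_add (s.length + 1) t.length (a := b)
    have e2 := List.replicate_add s.length (t.length + 1) (a := a)
    rw [show s.length + 1 + t.length = s.length + t.length + 1 by omega,
      ← mem_words_singleton.1 ht] at e1
    rw [← Nat.add_assoc, ← mem_words_singleton.1 hs] at e2
    rw [e1, e2]
    simp only [List.append_assoc]
  rcases (nestGrammar_inLanguage_le hab hW).1 with hW | hW
  · refine not_mem_sorted_of_sublist hab ?_ hW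
    have hba : List.Sublist ([b] ++ [a]) (List.replicate (s.length + 1) b ++
        List.replicate (t.length + 1) a) :=
      (List.singleton_sublist.2 (by simp)).append (List.singleton_sublist.2 (by simp))
    have := sublist_around [] (List.replicate (s.length + 1) b) (k.1 ++ (t ++ s) ++ k.2)
      (List.replicate (t.length + 1) a) []
    exact hba.trans (by simpa using this)
  · exact not_mem_sorted_of_sublist hab.symm (huv'.trans (sublist_around _ _ _ _ _)) hW

/-! ### Finite selection against symmetric definite selection -/

/-- The grammar with the axioms `a` and `faag` that replaces `a` by `cad`, `f` by `fc` and `g` by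
`dgs`. The letters `a`, `c`, `d`, `f`, `g`, `s` are the values of `e` at `0, …, 5`. -/
def doubleGrammar [DecidableEq α] (e : ℕ ↪ α) : ContextualGrammar α where
  alphabet := (Finset.range 6).map e
  alphabet_nonempty := by simp
  selections := {({[e 0]}, {([e 1], [e 2])}), ({[e 3]}, {([], [e 1])}), ({[e 4]}, {([e 2], [e 5])})}
  selections_finite := by simp
  contexts_finite := by rintro _ (rfl | rfl | rfl) <;> exact Set.finite_singleton _
  contexts_over := by rintro _ (rfl | rfl | rfl) _ rfl <;> simp
  contexts_ne := by rintro _ (rfl | rfl | rfl) _ rfl <;> simp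
  initial := {[e 0], [e 3, e 0, e 0, e 4]}
  initial_finite := by simp
  initial_over := by rintro _ (rfl | rfl) <;> simp

/-- The number of pairs of an occurrence of `a` and a later occurrence of `b` in a word. -/
def pairCount [DecidableEq α] (a b : α) : List α → ℕ
  | [] => 0
  | x :: w => (if x = a then w.count b else 0) + pairCount a b w

theorem pairCount_append [DecidableEq α] (a b : α) (x y : List α) :
    pairCount a b (x ++ y) = pairCount a b x + pairCount a b y + x.count a * y.count b := by
  induction x with
  | nil => simp [pairCount]
  | cons c x ih =>
    simp only [List.cons_append, pairCount, ih, List.count_append, List.count_cons]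
    split_ifs with h1 h2 h2
    · ring
    · simp [h1] at h2
    · simp at h2; exact absurd h2 h1
    · ring

theorem pairCount_eq_zero [DecidableEq α] {a b : α} {w : List α} (h : a ∉ w) :
    pairCount a b w = 0 := by
  induction w with
  | nil => rfl
  | cons c w ih =>
    rw [List.mem_cons, not_or] at h
    simp [pairCount, ih h.2, Ne.symm h.1]

section Double

variable [DecidableEq α] {e : ℕ ↪ α}

theorem doubleGrammar_inStep {x y : List α} : (doubleGrammar e).InStep x y ↔ ∃ x₁ x₃,
    (x = x₁ ++ [e 0] ++ x₃ ∧ y = x₁ ++ [e 1, e 0, e 2] ++ x₃) ∨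
    (x = x₁ ++ [e 3] ++ x₃ ∧ y = x₁ ++ [e 3, e 1] ++ x₃) ∨
    (x = x₁ ++ [e 4] ++ x₃ ∧ y = x₁ ++ [e 2, e 4, e 5] ++ x₃) := by
  constructor
  · rintro ⟨x₁, x₂, x₃, rfl, _, rfl | rfl | rfl, rfl, _, rfl, rfl⟩
    · exact ⟨x₁, x₃, Or.inl ⟨rfl, by simp⟩⟩
    · exact ⟨x₁, x₃, Or.inr (Or.inl ⟨rfl, by simp⟩)⟩
    · exact ⟨x₁, x₃, Or.inr (Or.inr ⟨rfl, by simp⟩)⟩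
  · rintro ⟨x₁, x₃, ⟨rfl, rfl⟩ | ⟨rfl, rfl⟩ | ⟨rfl, rfl⟩⟩
    · exact ⟨x₁, [e 0], x₃, rfl, _, Or.inl rfl, rfl, _, rfl, by simp⟩
    · exact ⟨x₁, [e 3], x₃, rfl, _, Or.inr (Or.inl rfl), rfl, _, rfl, by simp⟩
    · exact ⟨x₁, [e 4], x₃, rfl, _, Or.inr (Or.inr rfl), rfl, _, rfl, by simp⟩

/-- The letters `a`, `f`, `g` of a word. -/
def skeleton (e : ℕ ↪ α) (w : List α) : List α :=
  w.filter fun x => x = e 0 ∨ x = e 3 ∨ x = e 4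

theorem skeleton_append (x y : List α) : skeleton e (x ++ y) = skeleton e x ++ skeleton e y :=
  List.filter_append ..

theorem count_skeleton (w : List α) : (skeleton e w).count (e 0) = w.count (e 0) :=
  List.count_filter (by simp)

/-- There are two types of words, derived from `a` and from `faag`. In both of them, the number of
pairs of a letter `a` before a letter `d`, minus the number of pairs of a letter `a` before a letter
`c`, is the number of letters `d` and `s`: inserting a `d` directly behind one `a` adds one pair for
it and one for each earlier `a`, while `c` is inserted in front of the same `a`; the `d` in front of
`g` lies behind two letters `a`, which the letter `s` compensates. -/
theorem doubleGrammar_invariant {w : List α} (hw : w ∈ (doubleGrammar e).inLanguage) :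
    (skeleton e w = [e 0] ∧ w.count (e 1) = w.count (e 2) ∨
      skeleton e w = [e 3, e 0, e 0, e 4]) ∧
    pairCount (e 0) (e 2) w = pairCount (e 0) (e 1) w + w.count (e 2) + w.count (e 5) := by
  obtain ⟨x, hx, hw⟩ := hw
  induction hw with
  | refl =>
    rcases hx with rfl | rfl <;> simp [skeleton, pairCount]
  | tail _ hst ih =>
    obtain ⟨x₁, x₃, ⟨rfl, rfl⟩ | ⟨rfl, rfl⟩ | ⟨rfl, rfl⟩⟩ := doubleGrammar_inStep.1 hst
    · simp only [skeleton_append, pairCount_append, List.count_append] at ih ⊢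
      simp only [skeleton] at ih ⊢
      simp [pairCount] at ih ⊢
      refine ⟨ih.1.imp (fun h => ⟨h.1, by omega⟩) id, ?_⟩
      have := ih.2
      ring_nf at this ⊢
      omega
    · have hsk : skeleton e x₁ ++ e 3 :: skeleton e x₃ = [e 3, e 0, e 0, e 4] := by
        have hsk := ih.1.resolve_left fun h => by
          have : e 3 ∈ skeleton e (x₁ ++ [e 3] ++ x₃) := by simp [skeleton]
          rw [h.1] at this
          simp at this
        rw [← hsk]
        simp [skeleton]
      have hx₁ : skeleton e x₁ = [] := by
        have := (List.append_cons_inj_of_notMem (x₁ := []) (z₁ := [e 0, e 0, e 4]) (a₁ := e 3)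
          (by simp) (by simp)).1 hsk.symm
        exact this.1.symm
      have ha : x₁.count (e 0) = 0 := by rw [← count_skeleton, hx₁]; rfl
      refine ⟨Or.inr ?_, ?_⟩
      · rw [← hsk]
        simp [skeleton]
      · have := ih.2
        simp only [pairCount_append, List.count_append, ha] at this ⊢
        simp [pairCount] at this ⊢
        omega
    · have hsk : skeleton e x₁ ++ e 4 :: skeleton e x₃ = [e 3, e 0, e 0, e 4] := by
        have hsk := ih.1.resolve_left fun h => by
          have : e 4 ∈ skeleton e (x₁ ++ [e 4] ++ x₃) := by simp [skeleton]
          rw [h.1] at this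
          simp at this
        rw [← hsk]
        simp [skeleton]
      have hx₁ : skeleton e x₁ = [e 3, e 0, e 0] := by
        have := (List.append_cons_inj_of_notMem (x₁ := [e 3, e 0, e 0]) (z₁ := []) (a₁ := e 4)
          (by simp) (by simp)).1 hsk.symm
        exact this.1.symm
      have ha : x₁.count (e 0) = 2 := by rw [← count_skeleton, hx₁]; simp
      refine ⟨Or.inr ?_, ?_⟩
      · rw [← hsk]
        simp [skeleton]
      · have := ih.2
        simp only [pairCount_append, List.count_append, ha] at this ⊢
        simp [pairCount] at this ⊢
        omega

theorem single_mem_doubleGrammar (n : ℕ) : List.replicate n (e 1) ++ e 0 :: List.replicate n (e 2) ∈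
    (doubleGrammar e).inLanguage := by
  refine ⟨[e 0], Or.inl rfl, ?_⟩
  induction n with
  | zero => exact .refl
  | succ n ih =>
    refine ih.tail (doubleGrammar_inStep.2 ⟨List.replicate n (e 1), List.replicate n (e 2),
      Or.inl ⟨by simp, ?_⟩⟩)
    nth_rw 1 [List.replicate_succ']
    simp [List.replicate_succ]

theorem double_mem_doubleGrammar (j k : ℕ) :
    e 3 :: List.replicate (j + k) (e 1) ++ e 0 :: List.replicate k (e 2) ++
      List.replicate j (e 1) ++ e 0 :: List.replicate (j + k) (e 2) ++
      e 4 :: List.replicate k (e 5) ∈ (doubleGrammar e).inLanguage := by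
  refine ⟨[e 3, e 0, e 0, e 4], Or.inr rfl, ?_⟩
  -- the powers are built from the right to the left
  have h1 : ∀ k, Relation.ReflTransGen (doubleGrammar e).InStep [e 3, e 0, e 0, e 4]
      ([e 3, e 0, e 0] ++ List.replicate k (e 2) ++ e 4 :: List.replicate k (e 5)) := by
    intro k
    induction k with
    | zero => exact .refl
    | succ n ih =>
      refine ih.tail (doubleGrammar_inStep.2 ⟨[e 3, e 0, e 0] ++ List.replicate n (e 2),
        List.replicate n (e 5), Or.inr (Or.inr ⟨by simp, ?_⟩)⟩)
      nth_rw 1 [List.replicate_succ']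
      simp [List.replicate_succ]
  have h2 : ∀ n (x y : List α), Relation.ReflTransGen (doubleGrammar e).InStep (x ++ e 0 :: y)
      (x ++ List.replicate n (e 1) ++ e 0 :: List.replicate n (e 2) ++ y) := by
    intro n x y
    induction n with
    | zero => simpa using .refl
    | succ n ih =>
      refine ih.tail (doubleGrammar_inStep.2 ⟨x ++ List.replicate n (e 1),
        List.replicate n (e 2) ++ y, Or.inl ⟨by simp, ?_⟩⟩)
      nth_rw 1 [List.replicate_succ']
      simp [List.replicate_succ]
  have h3 : ∀ n (y : List α), Relation.ReflTransGen (doubleGrammar e).InStep (e 3 :: y)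
      (e 3 :: List.replicate n (e 1) ++ y) := by
    intro n y
    induction n with
    | zero => exact .refl
    | succ n ih =>
      refine ih.tail (doubleGrammar_inStep.2 ⟨[], List.replicate n (e 1) ++ y,
        Or.inr (Or.inl ⟨by simp, ?_⟩)⟩)
      simp [List.replicate_succ]
  have h4 := h2 j [e 3, e 0] (List.replicate k (e 2) ++ e 4 :: List.replicate k (e 5))
  have h5 := h2 k [e 3] (List.replicate j (e 1) ++ e 0 :: List.replicate j (e 2) ++
    (List.replicate k (e 2) ++ e 4 :: List.replicate k (e 5)))
  have h6 := h3 j (List.replicate k (e 1) ++ e 0 :: List.replicate k (e 2) ++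
    (List.replicate j (e 1) ++ e 0 :: List.replicate j (e 2) ++
    (List.replicate k (e 2) ++ e 4 :: List.replicate k (e 5))))
  have e1 := List.replicate_add j k (a := e 1)
  have e2 := List.replicate_add j k (a := e 2)
  rw [e1, e2]
  refine Relation.ReflTransGen.trans (h1 k) ?_
  simp only [List.append_assoc, List.cons_append, List.nil_append] at h4 h5 h6 ⊢
  exact (h4.trans h5).trans h6

end Double

/-- A rule that leads to `c^n a d^n` selects a word `x₂ = c^j a d^k` with a context `(c^i, d^i)`. A
symmetric definite language that contains `x₂` contains `x₂x₂`, which is a factor of a word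
derived from `faag`. The context put around it does not respect the invariant of those words. -/
theorem not_IC_FIN_subset_SYDEF [Infinite α] : ¬ IC (α := α) FIN ⊆ IC SYDEF := by
  classical
  intro h
  let e : ℕ ↪ α := Infinite.natEmbedding α
  obtain ⟨G, hG, hL⟩ := h ⟨doubleGrammar e, by
    rintro _ (rfl | rfl | rfl)
    · exact ⟨_, (doubleGrammar e).alphabet_nonempty, subset_rfl, FIN_singleton (by
        simp [doubleGrammar])⟩
    · exact ⟨_, (doubleGrammar e).alphabet_nonempty, subset_rfl, FIN_singleton (by
        simp [doubleGrammar])⟩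
    · exact ⟨_, (doubleGrammar e).alphabet_nonempty, subset_rfl, FIN_singleton (by
        simp [doubleGrammar])⟩, rfl⟩
  obtain ⟨K, hK⟩ := exists_length_bound G.initial_finite
  have hz := single_mem_doubleGrammar (e := e) K
  set z := List.replicate K (e 1) ++ e 0 :: List.replicate K (e 2) with hzdef
  have hz' := hz
  rw [← hL] at hz'
  obtain ⟨x, hx, hz'⟩ := hz'
  rcases hz'.cases_tail with h | ⟨y, hy, x₁, x₂, x₃, rfl, p, hp, hx₂, k, hk, h⟩
  · have := hK x hx
    rw [← h] at this
    simp [hzdef] at this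
  have hy' : x₁ ++ x₂ ++ x₃ ∈ (doubleGrammar e).inLanguage := hL ▸ ⟨x, hx, hy⟩
  rw [h] at hz hzdef
  -- the letters of `c^n a d^n` are in order
  have hzp : (x₁ ++ k.1 ++ x₂ ++ k.2 ++ x₃).Pairwise fun x y => ¬ (x = e 0 ∧ y = e 1) ∧
      ¬ (x = e 2 ∧ y = e 0) ∧ ¬ (x = e 2 ∧ y = e 1) ∧ ¬ (x = e 0 ∧ y = e 0) := by
    rw [hzdef, List.pairwise_append, List.pairwise_cons]
    refine ⟨List.pairwise_of_forall_mem_list fun x hx y hy => ?_, ⟨fun y hy => ?_,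
      List.pairwise_of_forall_mem_list fun x hx y hy => ?_⟩, fun x hx y hy => ?_⟩
    · rw [List.eq_of_mem_replicate hx]; simp
    · rw [List.eq_of_mem_replicate hy]; simp
    · rw [List.eq_of_mem_replicate hx, List.eq_of_mem_replicate hy]; simp
    · rw [List.eq_of_mem_replicate hx]; simp
  have hno : ∀ l₁ l₂, x₁ ++ k.1 ++ x₂ ++ k.2 ++ x₃ = l₁ ++ l₂ → ¬ (e 0 ∈ l₁ ∧ e 1 ∈ l₂) ∧
      ¬ (e 2 ∈ l₁ ∧ e 0 ∈ l₂) ∧ ¬ (e 2 ∈ l₁ ∧ e 1 ∈ l₂) ∧ ¬ (e 0 ∈ l₁ ∧ e 0 ∈ l₂) := by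
    intro l₁ l₂ hl
    rw [hl, List.pairwise_append] at hzp
    have h3 := hzp.2.2
    exact ⟨fun h => (h3 _ h.1 _ h.2).1 ⟨rfl, rfl⟩, fun h => (h3 _ h.1 _ h.2).2.1 ⟨rfl, rfl⟩,
      fun h => (h3 _ h.1 _ h.2).2.2.1 ⟨rfl, rfl⟩, fun h => (h3 _ h.1 _ h.2).2.2.2 ⟨rfl, rfl⟩⟩
  have hlet : ∀ x ∈ x₁ ++ k.1 ++ x₂ ++ k.2 ++ x₃, x = e 1 ∨ x = e 0 ∨ x = e 2 := by
    intro x hx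
    rw [hzdef, List.mem_append, List.mem_cons] at hx
    exact hx.imp List.eq_of_mem_replicate (Or.imp_right List.eq_of_mem_replicate)
  have hf : ∀ w ∈ (doubleGrammar e).inLanguage, e 3 ∉ w →
      w.count (e 0) = 1 ∧ w.count (e 1) = w.count (e 2) := by
    intro w hw hfw
    rcases (doubleGrammar_invariant hw).1 with h | h
    · refine ⟨by rw [← count_skeleton, h.1]; simp, h.2⟩
    · exact absurd (List.mem_of_mem_filter (show e 3 ∈ skeleton e w by rw [h]; simp)) hfw
  have cz := hf _ hz fun h3 => by simpa using hlet _ h3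
  have cy := hf _ hy' fun h3 => by
    simpa using hlet (e 3) (by simp only [List.mem_append] at h3 ⊢; tauto)
  simp only [List.count_append] at cy cz
  -- the context contains no `a`, and as many letters `c` as `d`, but at least one
  have hau : e 0 ∉ k.1 ++ k.2 := by
    rw [← List.count_eq_zero, List.count_append]
    omega
  have hcd : (k.1 ++ k.2).count (e 1) = (k.1 ++ k.2).count (e 2) := by
    simp only [List.count_append]
    omega
  have hcd' : ∀ x ∈ k.1 ++ k.2, x = e 1 ∨ x = e 2 := by
    intro x hx
    rcases hlet x (by simp only [List.mem_append] at hx ⊢; tauto) with h | rfl | h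
    · exact Or.inl h
    · exact absurd hx hau
    · exact Or.inr h
  have hpos : 0 < (k.1 ++ k.2).count (e 1) := by
    by_contra h0
    obtain ⟨x, hx⟩ := List.exists_mem_of_ne_nil _ (G.contexts_ne p hp k hk)
    rcases hcd' x hx with rfl | rfl
    · exact h0 (List.count_pos_iff.2 hx)
    · exact h0 (hcd ▸ List.count_pos_iff.2 hx)
  have hc := List.mem_append.1 (List.count_pos_iff.1 hpos)
  have hd := List.mem_append.1 (List.count_pos_iff.1 (hcd ▸ hpos))
  have ha₁ : e 0 ∉ x₁ := fun ha => (hno x₁ (k.1 ++ x₂ ++ k.2 ++ x₃) (by simp)).1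
    ⟨ha, by simp only [List.mem_append]; tauto⟩
  have ha₃ : e 0 ∉ x₃ := fun ha => (hno (x₁ ++ k.1 ++ x₂ ++ k.2) x₃ rfl).2.1
    ⟨by simp only [List.mem_append]; tauto, ha⟩
  have ha₂ : e 0 ∈ x₂ := by
    rw [← List.count_pos_iff]
    rw [← List.count_eq_zero] at ha₁ ha₃
    omega
  -- the selected word contains `a`, so the context has its `c` on the left and its `d` on the right
  have hcv : e 1 ∉ k.2 := fun hcv => (hno (x₁ ++ k.1 ++ x₂) (k.2 ++ x₃) (by simp)).1
    ⟨by simp [ha₂], by simp [hcv]⟩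
  have hdu : e 2 ∉ k.1 := fun hdu => (hno (x₁ ++ k.1) (x₂ ++ k.2 ++ x₃) (by simp)).2.1
    ⟨by simp [hdu], by simp [ha₂]⟩
  have hauv : e 0 ∉ k.1 ∧ e 0 ∉ k.2 := by simpa using hau
  obtain ⟨s, t, rfl⟩ := List.append_of_mem ha₂
  have hs : s = List.replicate s.length (e 1) := by
    refine List.eq_replicate_iff.2 ⟨rfl, fun x hx => ?_⟩
    have hn := hno (x₁ ++ k.1 ++ s) (e 0 :: t ++ k.2 ++ x₃) (by simp)
    rcases hlet x (by simp [hx]) with h | rfl | rfl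
    · exact h
    · exact absurd ⟨by simp [hx], by simp⟩ hn.2.2.2
    · exact absurd ⟨by simp [hx], by simp⟩ hn.2.1
  have ht : t = List.replicate t.length (e 2) := by
    refine List.eq_replicate_iff.2 ⟨rfl, fun x hx => ?_⟩
    have hn := hno (x₁ ++ k.1 ++ s ++ [e 0]) (t ++ k.2 ++ x₃) (by simp)
    rcases hlet x (by simp [hx]) with rfl | rfl | h
    · exact absurd ⟨by simp, by simp [hx]⟩ hn.1
    · exact absurd ⟨by simp, by simp [hx]⟩ hn.2.2.2
    · exact h
  obtain ⟨U, -, -, hU⟩ := hG p hp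
  have hTT := hU.append_self_mem hx₂
  have hW := double_mem_doubleGrammar (e := e) s.length t.length
  set l := e 3 :: List.replicate t.length (e 1) with hl
  set r := List.replicate s.length (e 2) ++ e 4 :: List.replicate t.length (e 5) with hr
  set m := s ++ e 0 :: t ++ (s ++ e 0 :: t) with hm
  have hWeq : e 3 :: List.replicate (s.length + t.length) (e 1) ++ e 0 ::
      List.replicate t.length (e 2) ++ List.replicate s.length (e 1) ++ e 0 ::
      List.replicate (s.length + t.length) (e 2) ++ e 4 :: List.replicate t.length (e 5) =
      l ++ m ++ r := by
    have e1 := List.replicate_add t.length s.length (a := e 1)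
    have e2 := List.replicate_add t.length s.length (a := e 2)
    rw [← hs, Nat.add_comm] at e1
    rw [← ht, Nat.add_comm] at e2
    rw [e1, e2, ← hs, ← ht]
    simp [hl, hr, hm]
  rw [hWeq] at hW
  have hW' : l ++ k.1 ++ m ++ k.2 ++ r ∈ (doubleGrammar e).inLanguage := by
    have hW2 := hW
    rw [← hL] at hW2 ⊢
    obtain ⟨x', hx', hW2⟩ := hW2
    exact ⟨x', hx', hW2.tail ⟨l, m, r, rfl, p, hp, hTT, k, hk, rfl⟩⟩
  -- the letters `d` of the context lie behind both letters `a`, without new letters `s`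
  have i1 := (doubleGrammar_invariant hW).2
  have i2 := (doubleGrammar_invariant hW').2
  have hal : l.count (e 0) = 0 := by simp [hl, List.count_replicate]
  have ham : m.count (e 0) = 2 := by
    rw [hm, hs, ht]
    simp [List.count_replicate]
  have hau' := List.count_eq_zero.2 hauv.1
  have hav' := List.count_eq_zero.2 hauv.2
  have hdu' := List.count_eq_zero.2 hdu
  have hcv' := List.count_eq_zero.2 hcv
  have hsv : e 5 ∉ k.1 ++ k.2 := fun h5 => by simpa using hcd' _ h5
  rw [List.mem_append, not_or] at hsv
  have hsu' := List.count_eq_zero.2 hsv.1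
  have hsv' := List.count_eq_zero.2 hsv.2
  simp only [List.count_append, hdu', hcv'] at hcd hpos
  simp only [pairCount_append, List.count_append, hal, ham, hau', hav', hdu', hcv', hsu', hsv',
    pairCount_eq_zero hauv.1, pairCount_eq_zero hauv.2] at i1 i2
  omega

/-! ### The diagram -/

theorem not_IC_FIN_subset_PRE [Infinite α] : ¬ IC (α := α) FIN ⊆ IC PRE :=
  not_IC_FIN_subset_of_nil_mem fun _ _ h _ hw => PRE.nil_mem h hw

theorem not_IC_FIN_subset_SUF [Infinite α] : ¬ IC (α := α) FIN ⊆ IC SUF :=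
  not_IC_FIN_subset_of_nil_mem fun _ _ h _ hw => SUF.nil_mem h hw

theorem not_IC_FIN_subset_STAR [Infinite α] : ¬ IC (α := α) FIN ⊆ IC STAR :=
  not_IC_FIN_subset_of_nil_mem fun _ _ h _ _ => STAR.nil_mem h

theorem not_IC_COMB_subset_PRE [Infinite α] : ¬ IC (α := α) COMB ⊆ IC PRE :=
  not_IC_COMB_subset_of_nil_mem fun _ _ h _ hw => PRE.nil_mem h hw

theorem not_IC_COMB_subset_SUF [Infinite α] : ¬ IC (α := α) COMB ⊆ IC SUF :=
  not_IC_COMB_subset_of_nil_mem fun _ _ h _ hw => SUF.nil_mem h hw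

theorem not_IC_COMB_subset_STAR [Infinite α] : ¬ IC (α := α) COMB ⊆ IC STAR :=
  not_IC_COMB_subset_of_nil_mem fun _ _ h _ _ => STAR.nil_mem h

theorem IC_MON_subset_COMB : IC (α := α) MON ⊆ IC COMB :=
  (IC_mono fun _ _ _ h => Or.inl h).trans IC_mon_or_comb_subset

theorem IC_subset_of_arrow {X Y : Node} (h : Arrow X Y) :
    IC (α := α) X.family ⊆ IC Y.family := by
  cases h with
  | mon_nil => exact IC_mono fun _ _ _ h => MON.nil h
  | mon_comb => exact IC_MON_subset_COMB
  | mon_inf => exact IC_mono fun _ _ _ h => MON.inf h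
  | mon_star => exact IC_mono fun _ _ _ h => MON.star h
  | mon_comm => exact IC_mono fun _ _ _ h => MON.comm h
  | fin_nil => exact IC_mono fun _ _ _ h => FIN.nil h
  | nil_def => exact IC_mono fun _ _ _ h => NIL.def h
  | comb_def => exact IC_mono fun _ _ _ h => COMB.def h
  | comb_sydef => exact IC_mono fun _ _ _ h => COMB.sydef h
  | def_ord => exact IC_mono fun _ _ _ h => DEF.ord h
  | ord_nc => exact IC_mono fun _ _ _ h => ORD.nc h
  | nc_ps => exact IC_mono fun _ _ _ h => NC.ps h
  | sydef_ps => exact IC_mono fun _ _ _ h => SYDEF.ps h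
  | inf_pre => exact IC_mono fun _ _ _ h => INF.pre h
  | inf_suf => exact IC_mono fun _ _ _ h => INF.suf h
  | pre_ps => exact IC_mono fun _ _ _ h => PRE.ps h
  | suf_ps => exact IC_mono fun _ _ _ h => SUF.ps h
  | comm_circ => exact IC_mono fun _ _ _ h => COMM.circ h
  | ps_reg => exact IC_mono fun _ _ _ h => h.1
  | star_reg => exact IC_mono fun _ _ _ h => h.1
  | circ_reg => exact IC_mono fun _ _ _ h => h.1

theorem IC_subset_of_path {X Y : Node} (h : Path X Y) : IC (α := α) X.family ⊆ IC Y.family := by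
  induction h with
  | refl => exact subset_rfl
  | tail _ h ih => exact ih.trans (IC_subset_of_arrow h)

/-- The targets of the arrows that start at a node. -/
def Node.successors : Node → List Node
  | .MON => [.NIL, .COMB, .INF, .STAR, .COMM]
  | .FIN => [.NIL]
  | .NIL => [.DEF]
  | .COMB => [.DEF, .SYDEF]
  | .DEF => [.ORD]
  | .ORD => [.NC]
  | .NC => [.PS]
  | .PS => [.REG]
  | .SYDEF => [.PS]
  | .INF => [.PRE, .SUF]
  | .PRE => [.PS]
  | .SUF => [.PS]
  | .STAR => [.REG]
  | .COMM => [.CIRC]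
  | .CIRC => [.REG]
  | .REG => []

theorem arrow_iff_mem_successors {X Y : Node} : Arrow X Y ↔ Y ∈ X.successors := by
  constructor
  · intro h
    cases h <;> simp [Node.successors]
  · cases X <;> simp only [Node.successors, List.mem_cons, List.not_mem_nil, or_false,
      false_imp_iff]
    all_goals
      rintro (rfl | rfl | rfl | rfl | rfl) <;> constructor

theorem path_iff {X Y : Node} : Path X Y ↔ X = Y ∨ ∃ Z ∈ X.successors, Path Z Y := by
  rw [Path, Relation.ReflTransGen.cases_head_iff]
  simp only [arrow_iff_mem_successors]

theorem path_MON_iff {Y : Node} :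
    Path .MON Y ↔ .MON = Y ∨
      Path .NIL Y ∨ Path .COMB Y ∨ Path .INF Y ∨ Path .STAR Y ∨ Path .COMM Y := by
  rw [path_iff]; simp [Node.successors]

theorem path_FIN_iff {Y : Node} : Path .FIN Y ↔ .FIN = Y ∨ Path .NIL Y := by
  rw [path_iff]; simp [Node.successors]

theorem path_NIL_iff {Y : Node} : Path .NIL Y ↔ .NIL = Y ∨ Path .DEF Y := by
  rw [path_iff]; simp [Node.successors]

theorem path_COMB_iff {Y : Node} : Path .COMB Y ↔ .COMB = Y ∨ Path .DEF Y ∨ Path .SYDEF Y := by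
  rw [path_iff]; simp [Node.successors]

theorem path_DEF_iff {Y : Node} : Path .DEF Y ↔ .DEF = Y ∨ Path .ORD Y := by
  rw [path_iff]; simp [Node.successors]

theorem path_ORD_iff {Y : Node} : Path .ORD Y ↔ .ORD = Y ∨ Path .NC Y := by
  rw [path_iff]; simp [Node.successors]

theorem path_NC_iff {Y : Node} : Path .NC Y ↔ .NC = Y ∨ Path .PS Y := by
  rw [path_iff]; simp [Node.successors]

theorem path_PS_iff {Y : Node} : Path .PS Y ↔ .PS = Y ∨ Path .REG Y := by
  rw [path_iff]; simp [Node.successors]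

theorem path_SYDEF_iff {Y : Node} : Path .SYDEF Y ↔ .SYDEF = Y ∨ Path .PS Y := by
  rw [path_iff]; simp [Node.successors]

theorem path_INF_iff {Y : Node} : Path .INF Y ↔ .INF = Y ∨ Path .PRE Y ∨ Path .SUF Y := by
  rw [path_iff]; simp [Node.successors]

theorem path_PRE_iff {Y : Node} : Path .PRE Y ↔ .PRE = Y ∨ Path .PS Y := by
  rw [path_iff]; simp [Node.successors]

theorem path_SUF_iff {Y : Node} : Path .SUF Y ↔ .SUF = Y ∨ Path .PS Y := by
  rw [path_iff]; simp [Node.successors]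

theorem path_STAR_iff {Y : Node} : Path .STAR Y ↔ .STAR = Y ∨ Path .REG Y := by
  rw [path_iff]; simp [Node.successors]

theorem path_COMM_iff {Y : Node} : Path .COMM Y ↔ .COMM = Y ∨ Path .CIRC Y := by
  rw [path_iff]; simp [Node.successors]

theorem path_CIRC_iff {Y : Node} : Path .CIRC Y ↔ .CIRC = Y ∨ Path .REG Y := by
  rw [path_iff]; simp [Node.successors]

theorem path_REG_iff {Y : Node} : Path .REG Y ↔ .REG = Y := by
  rw [path_iff]; simp [Node.successors]

/-- The maximal nodes among those that cannot be reached from a node. -/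
def Node.separators : Node → List Node
  | .MON => [.FIN]
  | .FIN => [.SYDEF, .PRE, .SUF, .STAR, .CIRC]
  | .NIL => [.FIN, .SYDEF, .PRE, .SUF, .STAR, .CIRC]
  | .COMB => [.NIL, .PRE, .SUF, .STAR, .CIRC]
  | .DEF => [.NIL, .SYDEF, .PRE, .SUF, .STAR, .CIRC]
  | .ORD => [.DEF, .SYDEF, .PRE, .SUF, .STAR, .CIRC]
  | .NC => [.ORD, .SYDEF, .PRE, .SUF, .STAR, .CIRC]
  | .PS => [.NC, .SYDEF, .PRE, .SUF, .STAR, .CIRC]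
  | .SYDEF => [.NC, .PRE, .SUF, .STAR, .CIRC]
  | .INF => [.NC, .SYDEF, .STAR, .CIRC]
  | .PRE => [.NC, .SYDEF, .SUF, .STAR, .CIRC]
  | .SUF => [.NC, .SYDEF, .PRE, .STAR, .CIRC]
  | .STAR => [.PS, .CIRC]
  | .COMM => [.PS, .STAR]
  | .CIRC => [.PS, .STAR, .COMM]
  | .REG => [.PS, .STAR, .CIRC]

/-- Every node that cannot be reached from `X` leads to a separator of `X`. -/
theorem path_or_exists_separator (X Y : Node) : Path X Y ∨ ∃ Z ∈ X.separators, Path Y Z := by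
  cases X <;> cases Y <;> 
    simp [Node.separators, path_MON_iff, path_FIN_iff, path_NIL_iff, path_COMB_iff, path_DEF_iff,
      path_ORD_iff, path_NC_iff, path_PS_iff, path_SYDEF_iff, path_INF_iff, path_PRE_iff,
      path_SUF_iff, path_STAR_iff, path_COMM_iff, path_CIRC_iff, path_REG_iff]

/-- Each case is one of the separations above for a family contained in that of `X`. -/
theorem not_IC_subset_of_mem_separators [Infinite α] {X Z : Node} (h : Z ∈ X.separators) :
    ¬ IC (α := α) X.family ⊆ IC Z.family := by
  have key : ∀ (X' : Node), ¬ IC (α := α) X'.family ⊆ IC Z.family → Path X' X →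
      ¬ IC (α := α) X.family ⊆ IC Z.family := fun X' hn hX hs =>
    hn ((IC_subset_of_path hX).trans hs)
  cases X <;> simp only [Node.separators, List.mem_cons, List.not_mem_nil, or_false] at h
  · subst h
    exact not_IC_MON_subset_FIN
  · rcases h with rfl | rfl | rfl | rfl | rfl
    · exact not_IC_FIN_subset_SYDEF
    · exact not_IC_FIN_subset_PRE
    · exact not_IC_FIN_subset_SUF
    · exact not_IC_FIN_subset_STAR
    · exact not_IC_FIN_subset_CIRC
  · rcases h with rfl | rfl | rfl | rfl | rfl | rfl
    · exact key .MON not_IC_MON_subset_FIN (by simp [path_MON_iff, path_NIL_iff])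
    · exact key .FIN not_IC_FIN_subset_SYDEF (by simp [path_FIN_iff, path_NIL_iff])
    · exact key .FIN not_IC_FIN_subset_PRE (by simp [path_FIN_iff, path_NIL_iff])
    · exact key .FIN not_IC_FIN_subset_SUF (by simp [path_FIN_iff, path_NIL_iff])
    · exact key .FIN not_IC_FIN_subset_STAR (by simp [path_FIN_iff, path_NIL_iff])
    · exact key .FIN not_IC_FIN_subset_CIRC (by simp [path_FIN_iff, path_NIL_iff])
  · rcases h with rfl | rfl | rfl | rfl | rfl
    · exact not_IC_COMB_subset_NIL
    · exact not_IC_COMB_subset_PRE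
    · exact not_IC_COMB_subset_SUF
    · exact not_IC_COMB_subset_STAR
    · exact not_IC_COMB_subset_CIRC
  · rcases h with rfl | rfl | rfl | rfl | rfl | rfl
    · exact key .COMB not_IC_COMB_subset_NIL (by simp [path_COMB_iff, path_DEF_iff])
    · exact key .FIN not_IC_FIN_subset_SYDEF (by simp [path_FIN_iff, path_NIL_iff, path_DEF_iff])
    · exact key .FIN not_IC_FIN_subset_PRE (by simp [path_FIN_iff, path_NIL_iff, path_DEF_iff])
    · exact key .FIN not_IC_FIN_subset_SUF (by simp [path_FIN_iff, path_NIL_iff, path_DEF_iff])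
    · exact key .FIN not_IC_FIN_subset_STAR (by simp [path_FIN_iff, path_NIL_iff, path_DEF_iff])
    · exact key .FIN not_IC_FIN_subset_CIRC (by simp [path_FIN_iff, path_NIL_iff, path_DEF_iff])
  · rcases h with rfl | rfl | rfl | rfl | rfl | rfl
    · exact not_IC_ORD_subset_DEF
    · exact key .FIN not_IC_FIN_subset_SYDEF
        (by simp [path_FIN_iff, path_NIL_iff, path_DEF_iff, path_ORD_iff])
    · exact key .FIN not_IC_FIN_subset_PRE
        (by simp [path_FIN_iff, path_NIL_iff, path_DEF_iff, path_ORD_iff])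
    · exact key .FIN not_IC_FIN_subset_SUF
        (by simp [path_FIN_iff, path_NIL_iff, path_DEF_iff, path_ORD_iff])
    · exact key .FIN not_IC_FIN_subset_STAR
        (by simp [path_FIN_iff, path_NIL_iff, path_DEF_iff, path_ORD_iff])
    · exact key .FIN not_IC_FIN_subset_CIRC
        (by simp [path_FIN_iff, path_NIL_iff, path_DEF_iff, path_ORD_iff])
  · rcases h with rfl | rfl | rfl | rfl | rfl | rfl
    · exact not_IC_NC_subset_ORD
    · exact key .FIN not_IC_FIN_subset_SYDEF
        (by simp [path_FIN_iff, path_NIL_iff, path_DEF_iff, path_ORD_iff, path_NC_iff])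
    · exact key .FIN not_IC_FIN_subset_PRE
        (by simp [path_FIN_iff, path_NIL_iff, path_DEF_iff, path_ORD_iff, path_NC_iff])
    · exact key .FIN not_IC_FIN_subset_SUF
        (by simp [path_FIN_iff, path_NIL_iff, path_DEF_iff, path_ORD_iff, path_NC_iff])
    · exact key .FIN not_IC_FIN_subset_STAR
        (by simp [path_FIN_iff, path_NIL_iff, path_DEF_iff, path_ORD_iff, path_NC_iff])
    · exact key .FIN not_IC_FIN_subset_CIRC
        (by simp [path_FIN_iff, path_NIL_iff, path_DEF_iff, path_ORD_iff, path_NC_iff])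
  · rcases h with rfl | rfl | rfl | rfl | rfl | rfl
    · exact key .SYDEF not_IC_SYDEF_subset_NC (by simp [path_SYDEF_iff, path_PS_iff])
    · exact key .FIN not_IC_FIN_subset_SYDEF
        (by simp [path_FIN_iff, path_NIL_iff, path_DEF_iff, path_ORD_iff, path_NC_iff, path_PS_iff])
    · exact key .FIN not_IC_FIN_subset_PRE
        (by simp [path_FIN_iff, path_NIL_iff, path_DEF_iff, path_ORD_iff, path_NC_iff, path_PS_iff])
    · exact key .FIN not_IC_FIN_subset_SUF
        (by simp [path_FIN_iff, path_NIL_iff, path_DEF_iff, path_ORD_iff, path_NC_iff, path_PS_iff])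
    · exact key .FIN not_IC_FIN_subset_STAR
        (by simp [path_FIN_iff, path_NIL_iff, path_DEF_iff, path_ORD_iff, path_NC_iff, path_PS_iff])
    · exact key .FIN not_IC_FIN_subset_CIRC
        (by simp [path_FIN_iff, path_NIL_iff, path_DEF_iff, path_ORD_iff, path_NC_iff, path_PS_iff])
  · rcases h with rfl | rfl | rfl | rfl | rfl
    · exact not_IC_SYDEF_subset_NC
    · exact key .COMB not_IC_COMB_subset_PRE (by simp [path_COMB_iff, path_SYDEF_iff])
    · exact key .COMB not_IC_COMB_subset_SUF (by simp [path_COMB_iff, path_SYDEF_iff])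
    · exact key .COMB not_IC_COMB_subset_STAR (by simp [path_COMB_iff, path_SYDEF_iff])
    · exact key .COMB not_IC_COMB_subset_CIRC (by simp [path_COMB_iff, path_SYDEF_iff])
  · rcases h with rfl | rfl | rfl | rfl
    · exact not_IC_INF_subset_NC
    · exact not_IC_INF_subset_SYDEF
    · exact not_IC_INF_subset_STAR
    · exact not_IC_INF_subset_CIRC
  · rcases h with rfl | rfl | rfl | rfl | rfl
    · exact key .INF not_IC_INF_subset_NC (by simp [path_INF_iff, path_PRE_iff])
    · exact key .INF not_IC_INF_subset_SYDEF (by simp [path_INF_iff, path_PRE_iff])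
    · exact not_IC_PRE_subset_SUF
    · exact key .INF not_IC_INF_subset_STAR (by simp [path_INF_iff, path_PRE_iff])
    · exact key .INF not_IC_INF_subset_CIRC (by simp [path_INF_iff, path_PRE_iff])
  · rcases h with rfl | rfl | rfl | rfl | rfl
    · exact key .INF not_IC_INF_subset_NC (by simp [path_INF_iff, path_SUF_iff])
    · exact key .INF not_IC_INF_subset_SYDEF (by simp [path_INF_iff, path_SUF_iff])
    · exact not_IC_SUF_subset_PRE
    · exact key .INF not_IC_INF_subset_STAR (by simp [path_INF_iff, path_SUF_iff])
    · exact key .INF not_IC_INF_subset_CIRC (by simp [path_INF_iff, path_SUF_iff])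
  · rcases h with rfl | rfl
    · exact not_IC_STAR_subset_PS
    · exact not_IC_STAR_subset_CIRC
  · rcases h with rfl | rfl
    · exact not_IC_COMM_subset_PS
    · exact not_IC_COMM_subset_STAR
  · rcases h with rfl | rfl | rfl
    · exact key .COMM not_IC_COMM_subset_PS (by simp [path_COMM_iff, path_CIRC_iff])
    · exact key .COMM not_IC_COMM_subset_STAR (by simp [path_COMM_iff, path_CIRC_iff])
    · exact not_IC_CIRC_subset_COMM
  · rcases h with rfl | rfl | rfl
    · exact key .STAR not_IC_STAR_subset_PS (by simp [path_STAR_iff, path_REG_iff])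
    · exact key .COMM not_IC_COMM_subset_STAR (by simp [path_COMM_iff, path_CIRC_iff, path_REG_iff])
    · exact key .STAR not_IC_STAR_subset_CIRC (by simp [path_STAR_iff, path_REG_iff])


/-- The diagram describes the inclusions completely: where there is no path, there is no
inclusion. -/
theorem not_IC_subset_of_not_path [Infinite α] {X Y : Node} (h : ¬ Path X Y) :
    ¬ IC (α := α) X.family ⊆ IC Y.family := by
  obtain ⟨Z, hZ, hYZ⟩ := (path_or_exists_separator X Y).resolve_left h
  exact fun hs => not_IC_subset_of_mem_separators hZ (hs.trans (IC_subset_of_path hYZ))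

theorem not_path_of_arrow {X Y : Node} (h : Arrow X Y) : ¬ Path Y X := by
  cases h <;> simp [path_NIL_iff, path_COMB_iff, path_DEF_iff, path_ORD_iff,
    path_NC_iff, path_PS_iff, path_SYDEF_iff, path_INF_iff, path_PRE_iff, path_SUF_iff,
    path_STAR_iff, path_COMM_iff, path_CIRC_iff, path_REG_iff]

theorem IC_ssubset_of_arrow [Infinite α] {X Y : Node} (h : Arrow X Y) :
    IC (α := α) X.family ⊂ IC Y.family :=
  ⟨IC_subset_of_arrow h, not_IC_subset_of_not_path (not_path_of_arrow h)⟩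

theorem incomparable_of_not_path [Infinite α] {X Y : Node} (h : ¬ Path X Y) (h' : ¬ Path Y X) :
    Incomparable (α := α) (IC X.family) (IC Y.family) :=
  ⟨not_IC_subset_of_not_path h, not_IC_subset_of_not_path h'⟩

theorem IC_REG_eq_UF [Infinite α] : IC (α := α) REG = IC UF :=
  IC_REG_subset_UF.antisymm (IC_mono fun _ _ _ h => h.1)

theorem IC_REG_eq_LCOM [Infinite α] : IC (α := α) REG = IC LCOM :=
  IC_REG_subset_LCOM.antisymm (IC_mono fun _ _ _ h => h.1)

theorem IC_REG_eq_RCOM [Infinite α] : IC (α := α) REG = IC RCOM :=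
  IC_REG_subset_RCOM.antisymm (IC_mono fun _ _ _ h => h.1)

theorem IC_REG_eq_TCOM [Infinite α] : IC (α := α) REG = IC TCOM :=
  (IC_REG_subset_LCOM.trans (IC_mono fun _ _ _ h => LCOM.tcom h)).antisymm
    (IC_mono fun _ _ _ h => h.1)

end SubregularIC

theorem mainTheorem1 (α : Type*) [Infinite α] :
    -- every arrow of the diagram is a proper inclusion
    (∀ X Y : SubregularIC.Node, SubregularIC.Arrow X Y →
      SubregularIC.IC (α := α) X.family ⊂ SubregularIC.IC Y.family) ∧
    -- families not connected by a directed path are incomparable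
    (∀ X Y : SubregularIC.Node, ¬ SubregularIC.Path X Y → ¬ SubregularIC.Path Y X →
      SubregularIC.Incomparable (α := α)
        (SubregularIC.IC X.family) (SubregularIC.IC Y.family)) ∧
    -- the equalities at the top node
    SubregularIC.IC (α := α) SubregularIC.REG = SubregularIC.IC SubregularIC.UF ∧
    SubregularIC.IC (α := α) SubregularIC.REG = SubregularIC.IC SubregularIC.LCOM ∧
    SubregularIC.IC (α := α) SubregularIC.REG = SubregularIC.IC SubregularIC.RCOM ∧
    SubregularIC.IC (α := α) SubregularIC.REG = SubregularIC.IC SubregularIC.TCOM ∧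
    -- in particular
    SubregularIC.IC (α := α) SubregularIC.INF ⊂ SubregularIC.IC SubregularIC.PRE ∧
    SubregularIC.IC (α := α) SubregularIC.SUF ⊂ SubregularIC.IC SubregularIC.PS ∧
    SubregularIC.Incomparable (α := α)
      (SubregularIC.IC SubregularIC.SUF) (SubregularIC.IC SubregularIC.ORD) ∧
    SubregularIC.Incomparable (α := α)
      (SubregularIC.IC SubregularIC.SUF) (SubregularIC.IC SubregularIC.NC) := by
  refine ⟨fun X Y => SubregularIC.IC_ssubset_of_arrow,
    fun X Y => SubregularIC.incomparable_of_not_path,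
    SubregularIC.IC_REG_eq_UF, SubregularIC.IC_REG_eq_LCOM, SubregularIC.IC_REG_eq_RCOM,
    SubregularIC.IC_REG_eq_TCOM, SubregularIC.IC_ssubset_of_arrow .inf_pre,
    SubregularIC.IC_ssubset_of_arrow .suf_ps,
    SubregularIC.incomparable_of_not_path (X := .SUF) (Y := .ORD) ?_ ?_,
    SubregularIC.incomparable_of_not_path (X := .SUF) (Y := .NC) ?_ ?_⟩
  all_goals
    simp [SubregularIC.path_SUF_iff, SubregularIC.path_ORD_iff, SubregularIC.path_NC_iff,
      SubregularIC.path_PS_iff, SubregularIC.path_REG_iff]
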